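/- Let $X$ be a finite connected CW complex with universal covering $\widetilde X\to X$ and fundamental group $G=\pi_1(X)$, acting on $\widetilde X$ by deck transformations. For a domain $B$ and a representation $\sigma:G\to \mathrm{GL}(n,B)$ let $H^*(X,\sigma)$ be the cohomology of $C^*(X,\sigma)=\mathrm{Hom}_G(C_*(\widetilde X),B^n)$, where $C_*(\widetilde X)$ is the complex of singular chains of $\widetilde X$, and let $\beta_k(X,\sigma)$ be the dimension of $H^k(X,\sigma)\otimes_B\{B\}$ over the field of fractions $\{B\}$ of $B$. Let $\rho:G\to\mathrm{GL}(n,\mathbb C)$ be a representation and $\alpha\in H^1(X,\mathbb C)$. Put $\gamma_t(g)=e^{t\langle\alpha,g\rangle}\rho(g)\in\mathrm{GL}(n,\mathbb C)$ for $t\in\mathbb C$, and let $\widehat\gamma(g)=e^{t\langle\alpha,g\rangle}\rho(g)\in\mathrm{GL}(n,\mathbb C[[t]])$, where the exponential is now a formal power series. The long exact cohomology sequence of $$0\to C^*(X,\widehat\gamma)\xrightarrow{\ t\ }C^*(X,\widehat\gamma)\xrightarrow{\ t\mapsto 0\ }C^*(X,\rho)\to 0$$ is an exact couple with first component $D=H^*(X,\widehat\gamma)$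 and second component $W_1=H^*(X,\rho)$. Let $(W_r^*)_{r\ge1}$ be the spectral sequence obtained by iterating the derived couple, and let $W_\infty^*=\bigcap_r Z_r\big/\bigcup_r B_r$ be its limit term, where $Z_r\subseteq W_1$ consists of the elements that survive to $W_r$, and $B_r\subseteq Z_r$ of those that represent $0$ in $W_r$. Then for every $k\ge 0$ the number $\beta_k(X,\widehat\gamma)$ is finite and $$\dim_{\mathbb C}W_\infty^k=\beta_k(X,\widehat\gamma),$$ and there is a closed discrete subset $S_k\subset\mathbb C$ such that $$\beta_k(X,\widehat\gamma)=\beta_k(X,\gamma_t)\qquad\text{for all } t\in\mathbb C\setminus S_k.$$ -/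

import Mathlib

universe u v w

open CategoryTheory

/-- An exact couple of graded `R`-modules, graded by `k ≥ 0`, with `i : D → D` and `j : D → E` of
degree `0` and `δ : E → D` of degree `1` (everything is zero in negative degrees, which is why
`i` is injective in degree `0`). -/
structure ExactCouple (R : Type u) [Ring R] where
  D : ℕ → ModuleCat.{v} R
  E : ℕ → ModuleCat.{v} R
  i : ∀ k, D k →ₗ[R] D k
  j : ∀ k, D k →ₗ[R] E k
  δ : ∀ k, E k →ₗ[R] D (k + 1)
  ker_j : ∀ k, LinearMap.ker (j k) = LinearMap.range (i k)
  ker_δ : ∀ k, LinearMap.ker (δ k) = LinearMap.range (j k)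
  ker_i_succ : ∀ k, LinearMap.ker (i (k + 1)) = LinearMap.range (δ k)
  ker_i_zero : LinearMap.ker (i 0) = ⊥

namespace ExactCouple

variable {R : Type u} [Ring R] (C : ExactCouple.{u, v} R)

/-- The differential `j ∘ δ` of an exact couple. -/
def d (k : ℕ) : C.E k →ₗ[R] C.E (k + 1) := C.j (k + 1) ∘ₗ C.δ k

/-- `Ker (j δ)` in degree `k`. -/
def cycles (k : ℕ) : Submodule R (C.E k) := LinearMap.ker (C.d k)

/-- `Im (j δ)` in degree `k`. -/
def boundaries : ∀ k : ℕ, Submodule R (C.E k)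
  | 0 => ⊥
  | k + 1 => LinearMap.range (C.d k)

theorem δ_j (k : ℕ) (x : C.D k) : C.δ k (C.j k x) = 0 := by
  have : C.j k x ∈ LinearMap.ker (C.δ k) := C.ker_δ k ▸ LinearMap.mem_range_self _ x
  exact this

theorem j_mem_cycles (k : ℕ) (x : C.D k) : C.j k x ∈ C.cycles k := by
  simp [cycles, d, C.δ_j k x]

theorem δ_eq_zero_of_mem_boundaries (k : ℕ) (x : C.E k) (hx : x ∈ C.boundaries k) :
    C.δ k x = 0 := by
  cases k with
  | zero => simp [boundaries] at hx; simp [hx]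
  | succ k =>
    obtain ⟨y, rfl⟩ := hx
    exact C.δ_j _ _

theorem δ_mem_range_of_mem_cycles (k : ℕ) (x : C.E k) (hx : x ∈ C.cycles k) :
    C.δ k x ∈ LinearMap.range (C.i (k + 1)) := by
  rw [← C.ker_j]; exact hx

theorem j_mem_boundaries_of_mem_ker (k : ℕ) (x : C.D k) (hx : x ∈ LinearMap.ker (C.i k)) :
    C.j k x ∈ C.boundaries k := by
  cases k with
  | zero => rw [C.ker_i_zero] at hx; simp [boundaries, (Submodule.mem_bot R).1 hx]
  | succ k =>
    rw [C.ker_i_succ] at hx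
    obtain ⟨y, rfl⟩ := hx
    exact ⟨y, rfl⟩

/-- The second component `E' = Ker (j δ) / Im (j δ)` of the derived couple. -/
abbrev derivedE (k : ℕ) : Type v := C.cycles k ⧸ (C.boundaries k).submoduleOf (C.cycles k)

/-- The first component `D' = i(D)` of the derived couple. -/
abbrev derivedD (k : ℕ) : Type v := LinearMap.range (C.i k)

/-- The map `D → E'` sending `x` to the class of `j x`. -/
def jClass (k : ℕ) : C.D k →ₗ[R] C.derivedE k :=
  ((C.boundaries k).submoduleOf (C.cycles k)).mkQ ∘ₗ (C.j k).codRestrict _ (C.j_mem_cycles k)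

theorem ker_i_le_ker_jClass (k : ℕ) : LinearMap.ker (C.i k) ≤ LinearMap.ker (C.jClass k) := by
  intro x hx
  exact (Submodule.Quotient.mk_eq_zero _).2 (C.j_mem_boundaries_of_mem_ker k x hx)

/-- The map `D' → E'` sending `i x` to the class of `j x`. -/
noncomputable def derivedJ (k : ℕ) : C.derivedD k →ₗ[R] C.derivedE k :=
  (LinearMap.ker (C.i k)).liftQ (C.jClass k) (C.ker_i_le_ker_jClass k) ∘ₗ
    (C.i k).quotKerEquivRange.symm.toLinearMap

theorem derivedJ_apply (k : ℕ) (x : C.D k) :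
    C.derivedJ k ⟨C.i k x, LinearMap.mem_range_self _ x⟩ = C.jClass k x := by
  have : (C.i k).quotKerEquivRange.symm ⟨C.i k x, LinearMap.mem_range_self _ x⟩
      = Submodule.Quotient.mk x := by
    rw [LinearEquiv.symm_apply_eq]; rfl
  simp [derivedJ, this]

/-- The map `E' → D'` sending the class of `x` to `δ x`. -/
def derivedδ (k : ℕ) : C.derivedE k →ₗ[R] C.derivedD (k + 1) :=
  Submodule.liftQ _
    ((C.δ k).restrict (p := C.cycles k) (q := LinearMap.range (C.i (k + 1)))
      (C.δ_mem_range_of_mem_cycles k))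
    (fun x hx => Subtype.ext (C.δ_eq_zero_of_mem_boundaries k x.1 hx))

/-- The derived couple `(i(D), Ker (j δ) / Im (j δ))`. -/
noncomputable def derived : ExactCouple.{u, v} R where
  D k := ModuleCat.of R (C.derivedD k)
  E k := ModuleCat.of R (C.derivedE k)
  i k := (C.i k).restrict (p := LinearMap.range (C.i k)) (q := LinearMap.range (C.i k))
    (fun x _ => LinearMap.mem_range_self _ x)
  j := C.derivedJ
  δ := C.derivedδ
  ker_j k := by
    ext ⟨_, x, rfl⟩
    change C.derivedJ k ⟨C.i k x, _⟩ = 0 ↔ _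
    rw [derivedJ_apply]
    constructor
    · intro h
      have hb : C.j k x ∈ C.boundaries k := by
        have : (⟨C.j k x, C.j_mem_cycles k x⟩ : C.cycles k) ∈
            (C.boundaries k).submoduleOf (C.cycles k) := (Submodule.Quotient.mk_eq_zero _).1 h
        exact this
      suffices ∃ z ∈ LinearMap.range (C.i k), C.i k z = C.i k x by
        obtain ⟨z, hz, hzx⟩ := this
        exact ⟨⟨z, hz⟩, Subtype.ext hzx⟩
      cases k with
      | zero =>
        have : x ∈ LinearMap.ker (C.j 0) := by simpa [boundaries] using hb
        rw [C.ker_j] at this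
        exact ⟨x, this, rfl⟩
      | succ k =>
        obtain ⟨y, hy⟩ := hb
        refine ⟨x - C.δ k y, ?_, ?_⟩
        · rw [← C.ker_j, LinearMap.mem_ker, map_sub, ← hy]; exact sub_self _
        · have : C.δ k y ∈ LinearMap.ker (C.i (k + 1)) :=
            C.ker_i_succ k ▸ LinearMap.mem_range_self _ y
          rw [map_sub, LinearMap.mem_ker.1 this, sub_zero]
    · rintro ⟨⟨_, y, rfl⟩, hz⟩
      have hz' : C.i k (C.i k y) = C.i k x := congrArg Subtype.val hz
      have h1 : C.jClass k (C.i k y - x) = 0 := by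
        apply C.ker_i_le_ker_jClass k
        simp [hz']
      have h2 : C.jClass k (C.i k y) = 0 := by
        have h3 : C.i k y ∈ LinearMap.ker (C.j k) := C.ker_j k ▸ LinearMap.mem_range_self _ y
        have h4 : C.j k (C.i k y) = 0 := h3
        have : (C.j k).codRestrict (C.cycles k) (C.j_mem_cycles k) (C.i k y) = 0 :=
          Subtype.ext h4
        simp [jClass, this]
      rw [map_sub, h2, zero_sub, neg_eq_zero] at h1
      exact h1
  ker_δ k := by
    ext x
    obtain ⟨⟨x, hx⟩, rfl⟩ := Submodule.Quotient.mk_surjective _ x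
    constructor
    · intro h
      have h0 : C.δ k x = 0 := congrArg Subtype.val h
      have h1 : x ∈ LinearMap.range (C.j k) := by rw [← C.ker_δ]; exact h0
      obtain ⟨y, rfl⟩ := h1
      exact ⟨⟨C.i k y, LinearMap.mem_range_self _ y⟩, C.derivedJ_apply k y⟩
    · rintro ⟨⟨_, y, rfl⟩, hy⟩
      have hy' : C.jClass k y = Submodule.Quotient.mk ⟨x, hx⟩ := by
        rw [← hy]; exact (C.derivedJ_apply k y).symm
      rw [LinearMap.mem_ker, ← hy']
      exact Subtype.ext (C.δ_j k y)
  ker_i_succ k := by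
    ext ⟨x, hx⟩
    constructor
    · intro h
      have h0 : x ∈ LinearMap.ker (C.i (k + 1)) := congrArg Subtype.val h
      rw [C.ker_i_succ] at h0
      obtain ⟨y, rfl⟩ := h0
      have hy : y ∈ C.cycles k := by rw [← C.ker_j] at hx; exact hx
      exact ⟨Submodule.Quotient.mk ⟨y, hy⟩, rfl⟩
    · rintro ⟨y, hy⟩
      obtain ⟨⟨y, hy'⟩, rfl⟩ := Submodule.Quotient.mk_surjective _ y
      have h1 : C.δ k y = x := congrArg Subtype.val hy
      have : x ∈ LinearMap.ker (C.i (k + 1)) := by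
        rw [C.ker_i_succ, ← h1]; exact LinearMap.mem_range_self _ y
      exact Subtype.ext this
  ker_i_zero := by
    rw [eq_bot_iff]
    rintro ⟨x, hx⟩ h
    have h0 : x ∈ LinearMap.ker (C.i 0) := congrArg Subtype.val h
    rw [C.ker_i_zero] at h0
    exact Subtype.ext h0

/-- `C.Z n k ⊆ E^k` consists of the elements on which the first `n` differentials of the spectral
sequence vanish successively, that is, of those that represent an element of the `n`-th page after
the initial one (the second component of the `n`-th iterated derived couple). -/
noncomputable def Z : ℕ → ∀ (C : ExactCouple.{u, v} R) (k : ℕ), Submodule R (C.E k)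
  | 0, _, _ => ⊤
  | n + 1, C, k =>
    ((Z n C.derived k).comap ((C.boundaries k).submoduleOf (C.cycles k)).mkQ).map
      (C.cycles k).subtype

/-- `C.B n k ⊆ C.Z n k` consists of the elements that represent zero on the `n`-th page after the
initial one. -/
noncomputable def B : ℕ → ∀ (C : ExactCouple.{u, v} R) (k : ℕ), Submodule R (C.E k)
  | 0, _, _ => ⊥
  | n + 1, C, k =>
    ((B n C.derived k).comap ((C.boundaries k).submoduleOf (C.cycles k)).mkQ).map
      (C.cycles k).subtype

/-- The term `E_∞ = (⋂ Z_n) / (⋃ B_n)` of the spectral sequence of an exact couple, in degree `k`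
(the `B_n` increase with `n`, so that their supremum is their union). -/
abbrev EInfty (k : ℕ) : Type v :=
  ↥(⨅ n, Z n C k) ⧸ (⨆ n, B n C k).submoduleOf (⨅ n, Z n C k)

end ExactCouple

section Cochains

open scoped Simplicial

/-- Equivariant cochains with values in a representation `ρ` of `G` on `V`, on a simplicial set `S`
on which `G` acts through `act`: as the group `C_m(S)` of chains is free on the `m`-simplices,
`Hom_G(C_m(S), V)` is the module of functions `φ` from `m`-simplices to `V` with
`φ (g σ) = ρ(g) (φ σ)`. -/
def equivariantCochains {k : Type u} {V : Type w} {G : Type*} [CommRing k] [AddCommGroup V]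
    [Module k V] [Monoid G] (S : SSet.{v}) (act : G → (S ⟶ S)) (ρ : Representation k G V)
    (m : SimplexCategory) : Submodule k (S.obj (.op m) → V) where
  carrier := {φ | ∀ g σ, φ ((act g).app (.op m) σ) = ρ g (φ σ)}
  add_mem' h h' g σ := by simp [h g σ, h' g σ]
  zero_mem' g σ := by simp
  smul_mem' c φ h g σ := by simp [h g σ]

/-- The cosimplicial module of equivariant cochains; the structure maps are
precomposition with the face and degeneracy maps of `S`. -/
def cosimplicialCochains {k : Type u} {V : Type w} {G : Type*} [CommRing k] [AddCommGroup V]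
    [Module k V] [Monoid G] (S : SSet.{v}) (act : G → (S ⟶ S)) (ρ : Representation k G V) :
    CosimplicialObject (ModuleCat.{max v w} k) where
  obj m := ModuleCat.of k (equivariantCochains S act ρ m)
  map {m m'} f := ModuleCat.ofHom
    { toFun φ := ⟨fun σ => φ.1 (S.map f.op σ), fun g σ => by
        refine Eq.trans ?_ (φ.2 g _)
        exact congrArg φ.1 (NatTrans.naturality_apply (act g) f.op σ).symm⟩
      map_add' _ _ := rfl
      map_smul' _ _ := rfl }
  map_id m := by
    refine ModuleCat.hom_ext (LinearMap.ext fun φ => Subtype.ext (funext fun σ => ?_))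
    change φ.1 (S.map (𝟙 _) σ) = φ.1 σ
    simp
  map_comp f g := by
    refine ModuleCat.hom_ext (LinearMap.ext fun φ => Subtype.ext (funext fun σ => ?_))
    change φ.1 (S.map (f ≫ g).op σ) = φ.1 (S.map f.op (S.map g.op σ))
    simp

/-- The complex `Hom_G(C_*(S), V)`, with differential the alternating sum of the coface maps. -/
noncomputable def cochainComplex {k : Type u} {V : Type w} {G : Type*} [CommRing k]
    [AddCommGroup V] [Module k V] [Monoid G] (S : SSet.{v}) (act : G → (S ⟶ S))
    (ρ : Representation k G V) : CochainComplex (ModuleCat.{max v w} k) ℕ :=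
  (AlgebraicTopology.alternatingCofaceMapComplex _).obj (cosimplicialCochains S act ρ)

/-- The map of complexes of cochains given by an equivariant map of coefficients. -/
def cosimplicialCochains.mapCoeff {k : Type u} {V W : Type w} {G : Type*} [CommRing k]
    [AddCommGroup V] [Module k V] [AddCommGroup W] [Module k W] [Monoid G] (S : SSet.{v})
    (act : G → (S ⟶ S)) {ρ : Representation k G V} {ρ' : Representation k G W} (f : V →ₗ[k] W)
    (hf : ∀ g x, f (ρ g x) = ρ' g (f x)) :
    cosimplicialCochains S act ρ ⟶ cosimplicialCochains S act ρ' where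
  app _ := ModuleCat.ofHom
    { toFun φ := ⟨fun σ => f (φ.1 σ), fun g σ => (congrArg f (φ.2 g σ)).trans (hf g _)⟩
      map_add' _ _ := Subtype.ext (funext fun _ => map_add f _ _)
      map_smul' _ _ := Subtype.ext (funext fun _ => map_smul f _ _) }
  naturality _ _ _ := rfl

/-- The map `Hom_G(C_*(S), V) → Hom_G(C_*(S), W)` given by an equivariant map of coefficients. -/
noncomputable def cochainComplex.mapCoeff {k : Type u} {V W : Type w} {G : Type*} [CommRing k]
    [AddCommGroup V] [Module k V] [AddCommGroup W] [Module k W] [Monoid G] (S : SSet.{v})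
    (act : G → (S ⟶ S)) {ρ : Representation k G V} {ρ' : Representation k G W} (f : V →ₗ[k] W)
    (hf : ∀ g x, f (ρ g x) = ρ' g (f x)) :
    cochainComplex S act ρ ⟶ cochainComplex S act ρ' :=
  (AlgebraicTopology.alternatingCofaceMapComplex _).map
    (cosimplicialCochains.mapCoeff S act f hf)

/-- The singular cohomology `H^m(X, ℂ)`. -/
noncomputable abbrev singularCohomology (X : Type v) [TopologicalSpace X] (m : ℕ) :
    ModuleCat.{v} ℂ :=
  (cochainComplex (TopCat.toSSet.obj (TopCat.of X)) (fun _ : Unit => 𝟙 _)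
    (1 : Representation ℂ Unit ℂ)).homology m

section Deck

variable {X : Type u} {E : Type v} [TopologicalSpace X] [TopologicalSpace E]

/-- The group of deck transformations of `p : E → X`. -/
def deckGroup (p : C(E, X)) : Subgroup (E ≃ₜ E) where
  carrier := {d | ∀ e, p (d e) = p e}
  mul_mem' {a b} ha hb e := by
    have : (a * b) e = a (b e) := rfl
    rw [this, ha, hb]
  one_mem' _ := rfl
  inv_mem' {a} ha e := by
    have h := ha (a⁻¹ e)
    have : a (a⁻¹ e) = e := a.apply_symm_apply e
    rw [this] at h
    exact h.symm

theorem deckGroup_apply {p : C(E, X)} (d : deckGroup p) (e : E) : p (d.1 e) = p e := d.2 e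

/-- The action of deck transformations on singular simplices. -/
noncomputable def deckAct (p : C(E, X)) (d : deckGroup p) :
    TopCat.toSSet.obj (TopCat.of E) ⟶ TopCat.toSSet.obj (TopCat.of E) :=
  TopCat.toSSet.map (TopCat.ofHom (d.1 : C(E, E)))

/-- The image in `X` of a path in `E` from `d e₀` to `e₀`, as an element of `π₁(X, p e₀)`. -/
def deckLoop (p : C(E, X)) (e₀ : E) (d : deckGroup p) (γ : Path (d.1 e₀) e₀) :
    FundamentalGroup X (p e₀) :=
  FundamentalGroup.fromPath
    (Path.Homotopic.Quotient.mk ((γ.map p.continuous).cast (deckGroup_apply d e₀).symm rfl))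

theorem deckLoop_eq [SimplyConnectedSpace E] (p : C(E, X)) (e₀ : E) (d : deckGroup p)
    (γ γ' : Path (d.1 e₀) e₀) : deckLoop p e₀ d γ = deckLoop p e₀ d γ' := by
  have h := (SimplyConnectedSpace.paths_homotopic γ γ').map p
  exact Quotient.sound h

/-- The homomorphism from the deck group of a simply connected covering space to `π₁(X, p e₀)`.
It sends `d` to the class of the image of any path from `d e₀` to `e₀`. (The product `a * b` in
Mathlib's `FundamentalGroup` is the class of `b` followed by `a`.) -/
noncomputable def deckToPi [SimplyConnectedSpace E] (p : C(E, X)) (e₀ : E) :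
    deckGroup p →* FundamentalGroup X (p e₀) :=
  MonoidHom.mk' (fun d => deckLoop p e₀ d (PathConnectedSpace.somePath _ _)) fun a b => by
    let γa : Path (a.1 e₀) e₀ := PathConnectedSpace.somePath _ _
    let γb : Path (b.1 e₀) e₀ := PathConnectedSpace.somePath _ _
    let γ : Path ((a * b).1 e₀) e₀ := (γb.map a.1.continuous).trans γa
    rw [deckLoop_eq p e₀ (a * b) _ γ]
    change deckLoop p e₀ (a * b) γ = deckLoop p e₀ a γa * deckLoop p e₀ b γb
    rw [FundamentalGroup.mul_def]
    change Path.Homotopic.Quotient.mk _ = Path.Homotopic.Quotient.mk (Path.trans _ _)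
    congr 1
    apply Path.ext
    funext s
    change p (γ s) = (Path.trans ((γb.map p.continuous).cast (deckGroup_apply b e₀).symm rfl)
      ((γa.map p.continuous).cast (deckGroup_apply a e₀).symm rfl)) s
    rw [Path.trans_apply]
    change p (((γb.map a.1.continuous).trans γa) s) = _
    rw [Path.trans_apply]
    split_ifs
    · exact deckGroup_apply a _
    · rfl

theorem deckAct_one (p : C(E, X)) (m : ℕ) (σ : (TopCat.toSSet.obj (TopCat.of E)) _⦋m⦌) :
    (deckAct p 1).app (.op ⦋m⦌) σ = σ := by
  apply ((TopCat.of E).toSSetObjEquiv _).injective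
  rfl

theorem deckAct_mul (p : C(E, X)) (d d' : deckGroup p) (m : ℕ)
    (σ : (TopCat.toSSet.obj (TopCat.of E)) _⦋m⦌) :
    (deckAct p (d * d')).app (.op ⦋m⦌) σ =
      (deckAct p d).app (.op ⦋m⦌) ((deckAct p d').app (.op ⦋m⦌) σ) := by
  apply ((TopCat.of E).toSSetObjEquiv _).injective
  rfl

/-- Deck transformations act freely on singular simplices. -/
theorem deckAct_free [PreconnectedSpace E] (p : C(E, X)) (hp : IsCoveringMap p)
    (d d' : deckGroup p) (m : ℕ) (σ : (TopCat.toSSet.obj (TopCat.of E)) _⦋m⦌)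
    (h : (deckAct p d).app (.op ⦋m⦌) σ = (deckAct p d').app (.op ⦋m⦌) σ) : d = d' := by
  let c : C(stdSimplex ℝ (Fin (m + 1)), E) := (TopCat.of E).toSSetObjEquiv (.op ⦋m⦌) σ
  have h1 : (d.1 : C(E, E)).comp c = (d'.1 : C(E, E)).comp c :=
    congrArg ((TopCat.of E).toSSetObjEquiv (.op ⦋m⦌)) h
  let s : stdSimplex ℝ (Fin (m + 1)) := stdSimplex.vertex 0
  have h2 : d.1 (c s) = d'.1 (c s) := congrArg (fun f : C(_, E) => f s) h1
  have h3 := hp.eq_of_comp_eq d.1.continuous d'.1.continuous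
    (funext fun e => (d.2 e).trans (d'.2 e).symm) (c s) h2
  exact Subtype.ext (Homeomorph.ext fun e => congrFun h3 e)

end Deck

section Pairing

theorem cochainComplex_d_apply {k : Type u} {V : Type w} {G : Type*} [CommRing k]
    [AddCommGroup V] [Module k V] [Monoid G] (S : SSet.{v}) (act : G → (S ⟶ S))
    (ρ : Representation k G V) (m : ℕ) (φ : equivariantCochains S act ρ ⦋m⦌) (σ : S _⦋m + 1⦌) :
    (((cochainComplex S act ρ).d m (m + 1) φ : equivariantCochains S act ρ ⦋m + 1⦌)).1 σ
      = ∑ i : Fin (m + 2), (-1 : ℤ) ^ (i : ℕ) • φ.1 (S.δ i σ) := by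
  have h : (cochainComplex S act ρ).d m (m + 1) =
      AlgebraicTopology.AlternatingCofaceMapComplex.objD (cosimplicialCochains S act ρ) m :=
    CochainComplex.of_d (fun n => (cosimplicialCochains S act ρ).obj ⦋n⦌)
      (AlgebraicTopology.AlternatingCofaceMapComplex.objD (cosimplicialCochains S act ρ)) m
  let L : equivariantCochains S act ρ ⦋m + 1⦌ →+ V :=
    { toFun ψ := ψ.1 σ, map_zero' := rfl, map_add' _ _ := rfl }
  rw [h]
  let M : ((cosimplicialCochains S act ρ).obj ⦋m⦌ ⟶ (cosimplicialCochains S act ρ).obj ⦋m + 1⦌)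
      →+ V :=
    { toFun f := L (f φ), map_zero' := rfl, map_add' _ _ := rfl }
  change M (∑ i : Fin (m + 2), (-1 : ℤ) ^ (i : ℕ) • (cosimplicialCochains S act ρ).δ i) = _
  rw [map_sum]
  refine Finset.sum_congr rfl fun i _ => ?_
  rw [map_zsmul]
  rfl

variable {X : Type v} [TopologicalSpace X]

/-- A continuous map from the standard simplex, as a singular simplex. -/
noncomputable def singularSimplex {m : ℕ} (c : C(stdSimplex ℝ (Fin (m + 1)), X)) :
    (TopCat.toSSet.obj (TopCat.of X)) _⦋m⦌ :=
  ((TopCat.of X).toSSetObjEquiv (.op ⦋m⦌)).symm c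

theorem δ_singularSimplex {m : ℕ} (c : C(stdSimplex ℝ (Fin (m + 2)), X)) (i : Fin (m + 2)) :
    (TopCat.toSSet.obj (TopCat.of X)).δ i (singularSimplex c) =
      singularSimplex (c.comp ⟨stdSimplex.map i.succAbove, stdSimplex.continuous_map _⟩) := by
  rfl

theorem stdSimplex_continuous_coord {m : ℕ} (i : Fin (m + 1)) :
    Continuous fun s : stdSimplex ℝ (Fin (m + 1)) => s.1 i :=
  (continuous_apply i).comp continuous_subtype_val

/-- A path, as a singular `1`-simplex. -/
noncomputable def pathSimplex {x y : X} (γ : Path x y) :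
    (TopCat.toSSet.obj (TopCat.of X)) _⦋1⦌ :=
  singularSimplex (m := 1) (γ.toContinuousMap.comp
    ⟨fun s => ⟨s.1 1, s.2.1 1, by
        have h := s.2.2
        rw [Fin.sum_univ_two] at h
        linarith [s.2.1 0]⟩, (stdSimplex_continuous_coord 1).subtype_mk _⟩)

/-- The affine map from the standard simplex with the given vertices. -/
noncomputable def affineSimplex {W : Type*} [AddCommGroup W] [Module ℝ W] [TopologicalSpace W]
    [ContinuousAdd W] [ContinuousSMul ℝ W] {m : ℕ} (q : Fin (m + 1) → W) :
    C(stdSimplex ℝ (Fin (m + 1)), W) :=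
  ⟨fun s => ∑ i, s.1 i • q i,
    continuous_finsetSum _ fun i _ => (stdSimplex_continuous_coord i).smul continuous_const⟩

theorem affineSimplex_face {W : Type*} [AddCommGroup W] [Module ℝ W] [TopologicalSpace W]
    [ContinuousAdd W] [ContinuousSMul ℝ W] {m : ℕ} (q : Fin (m + 2) → W) (i : Fin (m + 2)) :
    (affineSimplex q).comp ⟨stdSimplex.map i.succAbove, stdSimplex.continuous_map _⟩ =
      affineSimplex (q ∘ i.succAbove) := by
  ext s
  change ∑ j, (FunOnFinite.linearMap ℝ ℝ i.succAbove s.1) j • q j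
    = ∑ j, s.1 j • q (i.succAbove j)
  classical
  simp only [FunOnFinite.linearMap_apply_apply, Finset.sum_smul]
  have h := Finset.sum_fiberwise (s := Finset.univ) (g := i.succAbove)
    (f := fun j => s.1 j • q (i.succAbove j))
  rw [← h]
  refine Finset.sum_congr rfl fun j _ => Finset.sum_congr rfl fun l hl => ?_
  rw [(Finset.mem_filter.1 hl).2]

/-- The complex of singular cochains of `X` with complex coefficients. -/
noncomputable abbrev singularCochains (X : Type v) [TopologicalSpace X] :
    CochainComplex (ModuleCat.{v} ℂ) ℕ :=
  cochainComplex (TopCat.toSSet.obj (TopCat.of X)) (fun _ : Unit => 𝟙 _)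
    (1 : Representation ℂ Unit ℂ)

theorem cocycle_edges {W : Type*} [AddCommGroup W] [Module ℝ W] [TopologicalSpace W]
    [ContinuousAdd W] [ContinuousSMul ℝ W] (H : C(W, X)) (a b c : W)
    (φ : equivariantCochains (TopCat.toSSet.obj (TopCat.of X)) (fun _ : Unit => 𝟙 _)
      (1 : Representation ℂ Unit ℂ) ⦋1⦌) (hφ : (singularCochains X).d 1 2 φ = 0) :
    φ.1 (singularSimplex (m := 1) (H.comp (affineSimplex ![a, c]))) =
      φ.1 (singularSimplex (m := 1) (H.comp (affineSimplex ![a, b]))) +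
        φ.1 (singularSimplex (m := 1) (H.comp (affineSimplex ![b, c]))) := by
  have h := cochainComplex_d_apply (TopCat.toSSet.obj (TopCat.of X)) (fun _ : Unit => 𝟙 _)
    (1 : Representation ℂ Unit ℂ) 1 φ
    (singularSimplex (m := 2) (H.comp (affineSimplex ![a, b, c])))
  rw [hφ] at h
  change (0 : ℂ) = _ at h
  simp only [δ_singularSimplex, ContinuousMap.comp_assoc, affineSimplex_face] at h
  rw [Fin.sum_univ_three] at h
  have h0 : (![a, b, c] ∘ (0 : Fin 3).succAbove) = ![b, c] := by
    ext i; fin_cases i <;> rfl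
  have h1 : (![a, b, c] ∘ (1 : Fin 3).succAbove) = ![a, c] := by
    ext i; fin_cases i <;> rfl
  have h2 : (![a, b, c] ∘ (2 : Fin 3).succAbove) = ![a, b] := by
    ext i; fin_cases i <;> rfl
  rw [h0, h1, h2] at h
  simp at h
  linear_combination h

theorem cocycle_edges_self {W : Type*} [AddCommGroup W] [Module ℝ W] [TopologicalSpace W]
    [ContinuousAdd W] [ContinuousSMul ℝ W] (H : C(W, X)) (a : W)
    (φ : equivariantCochains (TopCat.toSSet.obj (TopCat.of X)) (fun _ : Unit => 𝟙 _)
      (1 : Representation ℂ Unit ℂ) ⦋1⦌) (hφ : (singularCochains X).d 1 2 φ = 0) :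
    φ.1 (singularSimplex (m := 1) (H.comp (affineSimplex ![a, a]))) = 0 := by
  have h := cocycle_edges H a a a φ hφ
  linear_combination -h

theorem pathSimplex_eq_of_apply {W : Type*} [AddCommGroup W] [Module ℝ W] [TopologicalSpace W]
    [ContinuousAdd W] [ContinuousSMul ℝ W] (H : C(W, X)) (a b : W) {x y : X} (γ : Path x y)
    (h : ∀ s : unitInterval, H ((1 - s : ℝ) • a + (s : ℝ) • b) = γ s) :
    singularSimplex (m := 1) (H.comp (affineSimplex ![a, b])) = pathSimplex γ := by
  unfold pathSimplex
  congr 1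
  ext s
  have h0 : s.1 0 = 1 - s.1 1 := by
    have := s.2.2
    rw [Fin.sum_univ_two] at this
    linarith
  refine Eq.trans ?_ (h _)
  change H (∑ i, s.1 i • ![a, b] i) = _
  rw [Fin.sum_univ_two, h0]
  rfl

/-- Cocycles take equal values on homotopic paths. -/
theorem cocycle_homotopic
    (φ : equivariantCochains (TopCat.toSSet.obj (TopCat.of X)) (fun _ : Unit => 𝟙 _)
      (1 : Representation ℂ Unit ℂ) ⦋1⦌) (hφ : (singularCochains X).d 1 2 φ = 0) {x y : X}
    {γ γ' : Path x y} (h : γ.Homotopic γ') : φ.1 (pathSimplex γ) = φ.1 (pathSimplex γ') := by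
  obtain ⟨F⟩ := h
  let P (r : ℝ) : unitInterval := Set.projIcc 0 1 zero_le_one r
  have hP : Continuous P := continuous_projIcc
  have hPv (s : unitInterval) : P s = s := Set.projIcc_val zero_le_one s
  have hP0 : P 0 = 0 := hPv 0
  have hP1 : P 1 = 1 := hPv 1
  let H : C(ℝ × ℝ, X) := ⟨fun r => F (P r.1, P r.2), by fun_prop⟩
  have e1 := pathSimplex_eq_of_apply H (0, 0) (0, 1) γ fun s => by
    change F (P _, P _) = _
    simp [hPv, hP0]
  have e2 := pathSimplex_eq_of_apply H (1, 0) (1, 1) γ' fun s => by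
    change F (P _, P _) = _
    simp [hPv, hP1]
  have e3 := pathSimplex_eq_of_apply H (0, 0) (1, 0) (Path.refl x) fun s => by
    change F (P _, P _) = _
    simp [hPv, hP0]
  have e3' := pathSimplex_eq_of_apply H (0, 0) (0, 0) (Path.refl x) fun s => by
    change F (P _, P _) = _
    simp [hP0]
  have e4 := pathSimplex_eq_of_apply H (0, 1) (1, 1) (Path.refl y) fun s => by
    change F (P _, P _) = _
    simp [hPv, hP1]
  have e4' := pathSimplex_eq_of_apply H (1, 1) (1, 1) (Path.refl y) fun s => by
    change F (P _, P _) = _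
    simp [hP1]
  have z3 := cocycle_edges_self H (0, 0) φ hφ
  have z4 := cocycle_edges_self H (1, 1) φ hφ
  have t1 := cocycle_edges H (0, 0) (0, 1) (1, 1) φ hφ
  have t2 := cocycle_edges H (0, 0) (1, 0) (1, 1) φ hφ
  rw [e3'] at z3
  rw [e4'] at z4
  rw [e1, e4, z4] at t1
  rw [e2, e3, z3] at t2
  linear_combination t2 - t1

theorem cocycle_trans
    (φ : equivariantCochains (TopCat.toSSet.obj (TopCat.of X)) (fun _ : Unit => 𝟙 _)
      (1 : Representation ℂ Unit ℂ) ⦋1⦌) (hφ : (singularCochains X).d 1 2 φ = 0) {x y z : X}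
    (γ : Path x y) (γ' : Path y z) :
    φ.1 (pathSimplex (γ.trans γ')) = φ.1 (pathSimplex γ) + φ.1 (pathSimplex γ') := by
  let H : C(ℝ, X) := ⟨(γ.trans γ').extend, (γ.trans γ').continuous_extend⟩
  have e := pathSimplex_eq_of_apply H 0 1 (γ.trans γ') fun s => by
    change (γ.trans γ').extend _ = _
    simp
  have e1 := pathSimplex_eq_of_apply H 0 (1 / 2) γ fun s => by
    change (γ.trans γ').extend _ = _
    have := s.2.2
    rw [Path.extend_trans_of_le_half _ _ (by simp; linarith)]
    simp [mul_comm (2 : ℝ)]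
  have e2 := pathSimplex_eq_of_apply H (1 / 2) 1 γ' fun s => by
    change (γ.trans γ').extend _ = _
    have := s.2.1
    rw [Path.extend_trans_of_half_le _ _ (by simp; linarith)]
    simp
    ring_nf
    simp
  have t := cocycle_edges H 0 (1 / 2) 1 φ hφ
  rwa [e, e1, e2] at t

/-- The value of a `1`-cochain on a path. -/
noncomputable def pathEval {x y : X} (γ : Path x y) :
    (singularCochains X).X 1 ⟶ ModuleCat.of ℂ (ULift.{v} ℂ) :=
  ModuleCat.ofHom
    (X := equivariantCochains (TopCat.toSSet.obj (TopCat.of X)) (fun _ : Unit => 𝟙 _)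
      (1 : Representation ℂ Unit ℂ) ⦋1⦌)
    { toFun φ := ULift.up (φ.1 (pathSimplex γ))
      map_add' _ _ := rfl
      map_smul' _ _ := rfl }

/-- The value of a `1`-cochain on a loop depends on the cochain only modulo coboundaries. -/
noncomputable def loopEval {x : X} (γ : Path x x) :
    (singularCochains X).opcycles 1 ⟶ ModuleCat.of ℂ (ULift.{v} ℂ) :=
  (singularCochains X).descOpcycles (pathEval γ)
    0 (by simp) (by
      refine ModuleCat.hom_ext (LinearMap.ext fun φ => congrArg ULift.up ?_)
      refine (cochainComplex_d_apply _ _ _ 0 φ (pathSimplex γ)).trans ?_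
      rw [Fin.sum_univ_two]
      have h : (TopCat.toSSet.obj (TopCat.of X)).δ 0 (pathSimplex γ) =
          (TopCat.toSSet.obj (TopCat.of X)).δ 1 (pathSimplex γ) := by
        rw [pathSimplex, δ_singularSimplex, δ_singularSimplex]
        refine congrArg (singularSimplex (X := X) (m := 0)) (ContinuousMap.ext fun s => ?_)
        have hs : s.1 0 = 1 := by simpa using s.2.2
        have h0 : (FunOnFinite.linearMap ℝ ℝ (Fin.succAbove (0 : Fin 2)) s.1) 1 = 1 := by
          rw [FunOnFinite.linearMap_apply_apply, Finset.sum_filter, Fin.sum_univ_one]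
          exact (if_pos rfl).trans hs
        have h1 : (FunOnFinite.linearMap ℝ ℝ (Fin.succAbove (1 : Fin 2)) s.1) 1 = 0 := by
          rw [FunOnFinite.linearMap_apply_apply]
          simp
        exact ((congrArg γ (Subtype.ext h0)).trans γ.target).trans
          ((congrArg γ (Subtype.ext h1)).trans γ.source).symm
      rw [h]
      simp)

/-- The value `⟨α, γ⟩` of a class `α ∈ H¹(X, ℂ)` on a loop `γ`. -/
noncomputable def loopPairing (α : singularCohomology X 1) {x : X} (γ : Path x x) : ℂ :=
  (loopEval γ ((singularCochains X).homologyι 1 α)).down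

/-- If `α` is represented by the cocycle `z`, then `⟨α, γ⟩` is the value of `z` on `γ`. -/
theorem loopPairing_π (z : (singularCochains X).cycles 1) {x : X} (γ : Path x x) :
    loopPairing ((singularCochains X).homologyπ 1 z) γ =
      ((singularCochains X).iCycles 1 z : equivariantCochains (TopCat.toSSet.obj (TopCat.of X))
        (fun _ : Unit => 𝟙 _) (1 : Representation ℂ Unit ℂ) ⦋1⦌).1 (pathSimplex γ) := by
  have h : (singularCochains X).homologyπ 1 ≫ (singularCochains X).homologyι 1 ≫ loopEval γ =
      (singularCochains X).iCycles 1 ≫ (singularCochains X).pOpcycles 1 ≫ loopEval γ := by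
    simp
  rw [loopEval, HomologicalComplex.p_descOpcycles] at h
  exact congrArg ULift.down (ConcreteCategory.congr_hom h z)

theorem exists_cocycle (α : singularCohomology X 1) :
    ∃ φ : equivariantCochains (TopCat.toSSet.obj (TopCat.of X)) (fun _ : Unit => 𝟙 _)
      (1 : Representation ℂ Unit ℂ) ⦋1⦌, (singularCochains X).d 1 2 φ = 0 ∧
        ∀ {x : X} (γ : Path x x), loopPairing α γ = φ.1 (pathSimplex γ) := by
  obtain ⟨z, rfl⟩ := (ModuleCat.epi_iff_surjective ((singularCochains X).homologyπ 1)).1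
    inferInstance α
  refine ⟨(singularCochains X).iCycles 1 z, ?_, fun γ => loopPairing_π z γ⟩
  exact ConcreteCategory.congr_hom ((singularCochains X).iCycles_d 1 2) z

/-- The pairing `g ↦ ⟨α, g⟩` of `α ∈ H¹(X, ℂ)` with `π₁(X, x)`, a homomorphism to `(ℂ, +)`. -/
noncomputable def pairing (α : singularCohomology X 1) (x : X) :
    FundamentalGroup X x →* Multiplicative ℂ :=
  MonoidHom.mk'
    (fun g => Multiplicative.ofAdd (Quotient.liftOn (FundamentalGroup.toPath g)
      (fun γ => loopPairing α γ) fun γ γ' h => by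
        obtain ⟨φ, hφ, hα⟩ := exists_cocycle α
        rw [hα, hα]
        exact cocycle_homotopic φ hφ h)) fun a b => by
    obtain ⟨φ, hφ, hα⟩ := exists_cocycle α
    induction a using Quotient.inductionOn with | _ γ =>
    induction b using Quotient.inductionOn with | _ γ' =>
    change loopPairing α (γ'.trans γ) = loopPairing α γ + loopPairing α γ'
    rw [hα, hα, hα, cocycle_trans φ hφ, add_comm]

end Pairing

section Twisted

open Matrix

/-- The representation on `Bⁿ` given by a homomorphism `ρ : G → GL(n, B)`, over a ring `k` of
scalars acting on `B` (usually `k = B`). -/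
def matrixRep (k : Type*) {B : Type*} {G : Type*} [CommRing k] [CommRing B] [Algebra k B] [Group G]
    {n : ℕ} (ρ : G →* GL (Fin n) B) : Representation k G (Fin n → B) where
  toFun g := (Matrix.mulVecLin (ρ g : Matrix (Fin n) (Fin n) B)).restrictScalars k
  map_one' := by ext; simp
  map_mul' g h := by
    refine LinearMap.ext fun x => ?_
    simp

/-- The twisted representation `g ↦ χ(g) ρ(g)`. -/
def twistBy {B : Type*} {G : Type*} [CommRing B] [Group G] {n : ℕ} (ρ : G →* GL (Fin n) B)
    (χ : G →* Bˣ) : G →* GL (Fin n) B :=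
  MonoidHom.mk' (fun g => χ g • ρ g) fun a b => by
    rw [map_mul, map_mul]
    refine Units.ext ?_
    change ((χ a : B) * (χ b : B)) • ((ρ a : Matrix (Fin n) (Fin n) B) * (ρ b).1) =
      ((χ a : B) • (ρ a).1) * ((χ b : B) • (ρ b).1)
    rw [smul_mul_smul_comm]

/-- `a ↦ e^{t a}` as a homomorphism `(ℂ, +) → ℂˣ`. -/
noncomputable def expHom (t : ℂ) : Multiplicative ℂ →* ℂˣ :=
  MonoidHom.toHomUnits
    { toFun a := Complex.exp (t * a.toAdd)
      map_one' := by simp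
      map_mul' a b := by simp [mul_add, Complex.exp_add] }

/-- `a ↦ e^{t a} = ∑ aᵐ tᵐ / m!` as a homomorphism from `(ℂ, +)` to the units of `ℂ[[t]]`. -/
noncomputable def formalExpHom : Multiplicative ℂ →* (PowerSeries ℂ)ˣ :=
  MonoidHom.toHomUnits
    { toFun a := PowerSeries.rescale a.toAdd (PowerSeries.exp ℂ)
      map_one' := by simp
      map_mul' a b := by simp [PowerSeries.exp_mul_exp_eq_exp_add] }

/-- The exponential deformation `γ_t(g) = e^{t⟨α,g⟩} ρ(g)`, where `a = ⟨α, ·⟩`. -/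
noncomputable def expDeformation {G : Type*} [Group G] {n : ℕ} (ρ : G →* GL (Fin n) ℂ)
    (a : G →* Multiplicative ℂ) (t : ℂ) : G →* GL (Fin n) ℂ :=
  twistBy ρ ((expHom t).comp a)

/-- The formal exponential deformation `γ̂(g) = e^{t⟨α,g⟩} ρ(g) ∈ GL(n, ℂ[[t]])`, where
`a = ⟨α, ·⟩`. -/
noncomputable def formalExpDeformation {G : Type*} [Group G] {n : ℕ} (ρ : G →* GL (Fin n) ℂ)
    (a : G →* Multiplicative ℂ) : G →* GL (Fin n) (PowerSeries ℂ) :=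
  twistBy ((Matrix.GeneralLinearGroup.map (PowerSeries.C (R := ℂ))).comp ρ) (formalExpHom.comp a)

theorem constantCoeff_formalExpDeformation {G : Type*} [Group G] {n : ℕ} (ρ : G →* GL (Fin n) ℂ)
    (a : G →* Multiplicative ℂ) (g : G) :
    ((formalExpDeformation ρ a g : Matrix (Fin n) (Fin n) (PowerSeries ℂ))).map
      (PowerSeries.constantCoeff (R := ℂ)) = (ρ g : Matrix (Fin n) (Fin n) ℂ) := by
  ext i j
  have h (c : ℂ) : PowerSeries.constantCoeff
      ((PowerSeries.rescale c) (PowerSeries.exp ℂ)) = 1 := by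
    rw [← PowerSeries.coeff_zero_eq_constantCoeff_apply, PowerSeries.coeff_rescale]
    simp
  simp [formalExpDeformation, twistBy, formalExpHom, Units.smul_def, h]

variable {X : Type u} {E : Type v} [TopologicalSpace X] [TopologicalSpace E]
  [SimplyConnectedSpace E]

/-- The cochain complex `C^*(X, ρ) = Hom_G(C_*(E), Bⁿ)` where `p : E → X` is a universal covering,
`G = π₁(X, p e₀)` acts on `E` by deck transformations, and `ρ : G → GL(n, B)`; it is a complex of
modules over any ring `k` of scalars acting on `B`. -/
noncomputable def twistedComplex (k : Type w) {B : Type} [CommRing k] [CommRing B] [Algebra k B]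
    {n : ℕ} (p : C(E, X)) (e₀ : E) (ρ : FundamentalGroup X (p e₀) →* GL (Fin n) B) :
    CochainComplex (ModuleCat.{v} k) ℕ :=
  cochainComplex (TopCat.toSSet.obj (TopCat.of E)) (deckAct p)
    (matrixRep k (ρ.comp (deckToPi p e₀)))

/-- The twisted cohomology `H^m(X, ρ)`, as a `k`-module. -/
noncomputable abbrev twistedCohomology (k : Type w) {B : Type} [CommRing k] [CommRing B]
    [Algebra k B] {n : ℕ} (p : C(E, X)) (e₀ : E)
    (ρ : FundamentalGroup X (p e₀) →* GL (Fin n) B) (m : ℕ) : ModuleCat.{v} k :=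
  (twistedComplex k p e₀ ρ).homology m

/-- The Betti number `β_m(X, ρ)`: the dimension of `H^m(X, ρ) ⊗ {B}` over the field of fractions
`{B}` of the domain `B`. -/
noncomputable def twistedBetti {B : Type} [CommRing B] [IsDomain B] {n : ℕ} (p : C(E, X)) (e₀ : E)
    (ρ : FundamentalGroup X (p e₀) →* GL (Fin n) B) (m : ℕ) : Cardinal.{v} :=
  Module.rank (FractionRing B) (TensorProduct B (FractionRing B) (twistedCohomology B p e₀ ρ m))

variable {n : ℕ} (p : C(E, X)) (e₀ : E) (ρ : FundamentalGroup X (p e₀) →* GL (Fin n) ℂ)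
  (a : FundamentalGroup X (p e₀) →* Multiplicative ℂ)

/-- Multiplication by `t` on `ℂ[[t]]ⁿ`. -/
noncomputable def mulT (n : ℕ) : (Fin n → PowerSeries ℂ) →ₗ[ℂ] (Fin n → PowerSeries ℂ) where
  toFun x := (PowerSeries.X : PowerSeries ℂ) • x
  map_add' x y := smul_add _ x y
  map_smul' c x := smul_comm _ c x

/-- The reduction `ℂ[[t]]ⁿ → ℂⁿ` at `t = 0`. -/
noncomputable def evalZero (n : ℕ) : (Fin n → PowerSeries ℂ) →ₗ[ℂ] (Fin n → ℂ) where
  toFun x i := PowerSeries.constantCoeff (x i)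
  map_add' x y := by ext; simp
  map_smul' c x := by ext; simp

theorem mulT_equivariant {G : Type*} [Group G] (ρ : G →* GL (Fin n) (PowerSeries ℂ)) (g : G)
    (x : Fin n → PowerSeries ℂ) :
    mulT n (matrixRep ℂ ρ g x) = matrixRep ℂ ρ g (mulT n x) :=
  (Matrix.mulVec_smul (ρ g : Matrix (Fin n) (Fin n) (PowerSeries ℂ))
    (PowerSeries.X : PowerSeries ℂ) x).symm

theorem evalZero_equivariant {G H : Type*} [Group G] [Group H] (f : H →* G)
    (ρ : G →* GL (Fin n) ℂ) (a : G →* Multiplicative ℂ) (g : H) (x : Fin n → PowerSeries ℂ) :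
    evalZero n (matrixRep ℂ ((formalExpDeformation ρ a).comp f) g x) =
      matrixRep ℂ (ρ.comp f) g (evalZero n x) := by
  change _ = (ρ (f g) : Matrix (Fin n) (Fin n) ℂ) *ᵥ (evalZero n x)
  rw [← constantCoeff_formalExpDeformation ρ a]
  ext i
  exact RingHom.map_mulVec (PowerSeries.constantCoeff (R := ℂ)) _ x i

/-- Equivariant cochains lift along surjections of coefficients if the action is free. -/
theorem exists_lift_cochain {k : Type*} {V W : Type*} {G : Type*} [CommRing k]
    [AddCommGroup V] [Module k V] [AddCommGroup W] [Module k W] [Group G] (S : SSet.{v})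
    (act : G → (S ⟶ S)) {ρ : Representation k G V} {ρ' : Representation k G W} (f : V →ₗ[k] W)
    (hf : ∀ g x, f (ρ g x) = ρ' g (f x)) (hf' : Function.Surjective f) (m : ℕ)
    (hone : ∀ σ : S _⦋m⦌, (act 1).app (.op ⦋m⦌) σ = σ)
    (hmul : ∀ g g' (σ : S _⦋m⦌), (act (g * g')).app (.op ⦋m⦌) σ =
      (act g).app (.op ⦋m⦌) ((act g').app (.op ⦋m⦌) σ))
    (hfree : ∀ g g' (σ : S _⦋m⦌), (act g).app (.op ⦋m⦌) σ = (act g').app (.op ⦋m⦌) σ → g = g')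
    (φ : equivariantCochains S act ρ' ⦋m⦌) :
    ∃ ψ : equivariantCochains S act ρ ⦋m⦌, ∀ σ, f (ψ.1 σ) = φ.1 σ := by
  let r : Setoid (S _⦋m⦌) :=
    { r σ τ := ∃ g, (act g).app (.op ⦋m⦌) σ = τ
      iseqv :=
        { refl σ := ⟨1, hone σ⟩
          symm := by
            rintro σ τ ⟨g, rfl⟩
            exact ⟨g⁻¹, by rw [← hmul, inv_mul_cancel, hone]⟩
          trans := by
            rintro σ τ υ ⟨g, rfl⟩ ⟨g', rfl⟩
            exact ⟨g' * g, hmul g' g σ⟩ } }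
  let o (σ : S _⦋m⦌) : S _⦋m⦌ := (Quotient.mk r σ).out
  have ho (σ : S _⦋m⦌) : ∃ g, (act g).app (.op ⦋m⦌) (o σ) = σ := Quotient.mk_out (s := r) σ
  have ho' (g : G) (σ : S _⦋m⦌) : o ((act g).app (.op ⦋m⦌) σ) = o σ :=
    congrArg Quotient.out (Quotient.sound (s := r) ⟨g, rfl⟩).symm
  choose c hc using ho
  choose l hl using hf'
  refine ⟨⟨fun σ => ρ (c σ) (l (φ.1 (o σ))), fun g σ => ?_⟩, fun σ => ?_⟩
  · have h : c ((act g).app (.op ⦋m⦌) σ) = g * c σ := by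
      apply hfree _ _ (o σ)
      rw [hmul, hc]
      conv_lhs => rw [← ho' g σ]
      exact hc _
    change ρ (c ((act g).app (.op ⦋m⦌) σ)) (l (φ.1 (o ((act g).app (.op ⦋m⦌) σ)))) = _
    rw [h, ho', map_mul]
    rfl
  · change f (ρ (c σ) (l (φ.1 (o σ)))) = _
    rw [hf, hl]
    exact (φ.2 (c σ) (o σ)).symm.trans (congrArg φ.1 (hc σ))

/-- The sequence of complexes `0 → C^*(X, γ̂) → C^*(X, γ̂) → C^*(X, ρ) → 0` given by multiplication
by `t` and by reduction at `t = 0`, over `ℂ`. -/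
noncomputable def deformationSequence : ShortComplex (CochainComplex (ModuleCat.{v} ℂ) ℕ) :=
  ShortComplex.mk
    (X₁ := twistedComplex ℂ p e₀ (formalExpDeformation ρ a))
    (X₂ := twistedComplex ℂ p e₀ (formalExpDeformation ρ a))
    (X₃ := twistedComplex ℂ p e₀ ρ)
    (cochainComplex.mapCoeff _ _ (mulT n) (mulT_equivariant _))
    (cochainComplex.mapCoeff _ _ (evalZero n) (evalZero_equivariant _ ρ a)) (by
      refine HomologicalComplex.hom_ext _ _ fun m => ModuleCat.hom_ext (LinearMap.ext fun φ =>
        Subtype.ext (funext fun σ => funext fun i => ?_))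
      change PowerSeries.constantCoeff (PowerSeries.X * _) = (0 : ℂ)
      simp)

theorem deformationSequence_shortExact (hp : IsCoveringMap p) :
    (deformationSequence p e₀ ρ a).ShortExact := by
  refine HomologicalComplex.shortExact_of_degreewise_shortExact _ fun m => ?_
  have hX : Function.Injective (mulT n) := by
    intro x y h
    funext i
    exact mul_left_cancel₀ PowerSeries.X_ne_zero (congrFun h i)
  refine ShortComplex.ShortExact.mk' ?_ ?_ ?_
  · rw [ShortComplex.ShortExact.moduleCat_exact_iff_function_exact]
    intro (φ : equivariantCochains _ (deckAct p)
      (matrixRep ℂ ((formalExpDeformation ρ a).comp (deckToPi p e₀))) ⦋m⦌)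
    constructor
    · intro h
      have h1 (σ) (i : Fin n) : PowerSeries.constantCoeff (φ.1 σ i) = 0 :=
        congrFun (congrFun (congrArg Subtype.val h) σ) i
      have h2 (σ) (i : Fin n) : ∃ c, φ.1 σ i = PowerSeries.X * c :=
        PowerSeries.X_dvd_iff.2 (h1 σ i)
      choose c hc using h2
      have hc' (σ) : mulT n (c σ) = φ.1 σ := funext fun i => (hc σ i).symm
      refine ⟨(⟨c, fun g σ => hX ?_⟩ : equivariantCochains _ (deckAct p)
        (matrixRep ℂ ((formalExpDeformation ρ a).comp (deckToPi p e₀))) ⦋m⦌),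
        Subtype.ext (funext hc')⟩
      rw [hc', mulT_equivariant, hc']
      exact φ.2 g σ
    · rintro ⟨ψ, rfl⟩
      refine Subtype.ext (funext fun σ => funext fun i => ?_)
      change PowerSeries.constantCoeff (PowerSeries.X * _) = (0 : ℂ)
      simp
  · rw [ModuleCat.mono_iff_injective]
    intro φ ψ h
    exact Subtype.ext (funext fun σ => hX (congrFun (congrArg Subtype.val h) σ))
  · rw [ModuleCat.epi_iff_surjective]
    intro φ
    obtain ⟨ψ, hψ⟩ := exists_lift_cochain _ (deckAct p) (evalZero n)
      (evalZero_equivariant (deckToPi p e₀) ρ a)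
      (fun x => ⟨fun i => PowerSeries.C (x i), by ext; simp [evalZero]⟩) m
      (deckAct_one p m) (deckAct_mul p · · m) (deckAct_free p hp · · m) φ
    exact ⟨ψ, Subtype.ext (funext hψ)⟩

/-- The exact couple given by the long exact cohomology sequence of
`0 → C^*(X, γ̂) → C^*(X, γ̂) → C^*(X, ρ) → 0`, with `D = H^*(X, γ̂)` and `E = H^*(X, ρ)`. -/
noncomputable def deformationCouple (hp : IsCoveringMap p) : ExactCouple.{0, v} ℂ where
  D m := twistedCohomology ℂ p e₀ (formalExpDeformation ρ a) m
  E m := twistedCohomology ℂ p e₀ ρ m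
  i m := (HomologicalComplex.homologyMap (deformationSequence p e₀ ρ a).f m).hom
  j m := (HomologicalComplex.homologyMap (deformationSequence p e₀ ρ a).g m).hom
  δ m := ((deformationSequence_shortExact p e₀ ρ a hp).δ m (m + 1) rfl).hom
  ker_j m := ((ShortComplex.moduleCat_exact_iff_range_eq_ker _).1
    ((deformationSequence_shortExact p e₀ ρ a hp).homology_exact₂ m)).symm
  ker_δ m := ((ShortComplex.moduleCat_exact_iff_range_eq_ker _).1
    ((deformationSequence_shortExact p e₀ ρ a hp).homology_exact₃ m (m + 1) rfl)).symm
  ker_i_succ m := ((ShortComplex.moduleCat_exact_iff_range_eq_ker _).1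
    ((deformationSequence_shortExact p e₀ ρ a hp).homology_exact₁ m (m + 1) rfl)).symm
  ker_i_zero := by
    have hmono := (deformationSequence_shortExact p e₀ ρ a hp).mono_f
    have hπ : ∀ K : CochainComplex (ModuleCat.{v} ℂ) ℕ, IsIso (K.homologyπ 0) := fun K =>
      K.isIso_homologyπ 0 0 (by simp) (K.shape _ _ (by simp))
    have h1 := hπ (deformationSequence p e₀ ρ a).X₁
    have h2 := hπ (deformationSequence p e₀ ρ a).X₂
    have h : HomologicalComplex.homologyMap (deformationSequence p e₀ ρ a).f 0 =
        inv ((deformationSequence p e₀ ρ a).X₁.homologyπ 0) ≫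
          HomologicalComplex.cyclesMap (deformationSequence p e₀ ρ a).f 0 ≫
            (deformationSequence p e₀ ρ a).X₂.homologyπ 0 := by
      simp [← HomologicalComplex.homologyπ_naturality]
    have h3 : Mono (HomologicalComplex.homologyMap (deformationSequence p e₀ ρ a).f 0) := by
      rw [h]; infer_instance
    exact LinearMap.ker_eq_bot.2 ((ModuleCat.mono_iff_injective _).1 h3)

end Twisted

end Cochains

/-! All Betti numbers in question are computed from ranks of finite matrices that depend on the
representation in a universal way. A finite CW complex is compact and locally contractible, and this
alone yields a finite model for the singular complex of its universal covering. Fix a finite net in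
$X$; the sequences of points over the net that are pairwise close form a complex on which the deck
group acts, freely on nonempty sequences and with finitely many orbits in each degree. Singular
chains are subdivided equivariantly until they are small and then sent to nearby net points of their
vertices; close sequences are realized by filling boundaries inside contractible balls. The
composite on singular chains is equivariantly homotopic to the identity up to any prescribed degree
(`BallSystem.nonempty_finiteModel`).

Domination in this one direction suffices. It exhibits $H^k$ as the quotient of $\ker D_1$ by the
vectors $z$ with $ez\in\operatorname{im}D_0$, where the matrix entries are fixed integer
combinations of entries of the $\gamma(g)$ (`MatrixPresentation`). Over a Noetherian domain,
rank-nullity then gives the rank of $H^k$ as the rank of a block matrix minus the ranks of $D_1$ and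
$D_0$ (`finrank_add_rank_add_rank`).

The matrices for $\gamma_t$ and for $\widehat\gamma$ are specializations of the same matrices over
formal exponential sums. A minor is thus an entire function of $t$ whose Taylor series is the
corresponding minor over $\mathbb C[[t]]$. If the series is zero, the minor vanishes for every $t$;
otherwise it vanishes only on a closed discrete set. Hence ranks agree off such a set
(`ExpSum.eventually_rank_eq`).

For the limit term, $i$ is multiplication by $t$, and induction on the derived couples shows that
$x$ survives all pages iff $\delta x$ is divisible by every power of $t$, and eventually represents
zero iff it is $j$ of a class killed by a power of $t$ (`ExactCouple.mem_Z_iff`,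
`ExactCouple.mem_B_iff`). Since $D$ is finitely generated over $\mathbb C[[t]]$ in each degree,
Krull's intersection theorem turns the first condition into $\delta x=0$, that is
$x\in\operatorname{im}j$. So $W_\infty\cong D/(T+tD)$ with $T$ the torsion of $D$, and $D/T$ is free
of rank $\beta_k(X,\widehat\gamma)$ (`ExactCouple.rank_eInfty`). -/

/-! ### Local contractibility of finite CW complexes -/

section LocalContractibility

open Set Metric

variable {X : Type*} [TopologicalSpace X]

/-- The set `A` can be contracted to a point inside `B`. -/
def ContractsIn (A B : Set X) : Prop :=
  ∃ (c : X) (H : X × ℝ → X), ContinuousOn H (A ×ˢ Icc 0 1) ∧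
    (∀ a ∈ A, ∀ s ∈ Icc (0 : ℝ) 1, H (a, s) ∈ B) ∧ (∀ a ∈ A, H (a, 0) = a) ∧
      ∀ a ∈ A, H (a, 1) = c

theorem ContractsIn.mono {A A' B B' : Set X} (h : ContractsIn A B) (hA : A' ⊆ A) (hB : B ⊆ B') :
    ContractsIn A' B' := by
  obtain ⟨c, H, h1, h2, h3, h4⟩ := h
  exact ⟨c, H, h1.mono (prod_mono hA subset_rfl), fun a ha s hs => hB (h2 a (hA ha) s hs),
    fun a ha => h3 a (hA ha), fun a ha => h4 a (hA ha)⟩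

/-- Every point of `Y` has arbitrarily small neighbourhoods in `Y` that can be contracted to a
point inside a given neighbourhood. -/
def LocallyContractibleOn (Y : Set X) : Prop :=
  ∀ x ∈ Y, ∀ U, IsOpen U → x ∈ U → ∃ V, IsOpen V ∧ x ∈ V ∧ ContractsIn (V ∩ Y) (U ∩ Y)

/-- A closed map is a quotient map onto its image, and stays one over any subset `N`. This lets
homotopies descend from a closed disc to a closed cell, although the characteristic map need not be
injective on the sphere. -/
theorem IsClosedMap.continuousOn_inter_range {A B Z : Type*} [TopologicalSpace A]
    [TopologicalSpace B] [TopologicalSpace Z] {f : A → B} (hf : IsClosedMap f) {g : B → Z}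
    {N : Set B} (h : ContinuousOn (g ∘ f) (f ⁻¹' N)) : ContinuousOn g (N ∩ range f) := by
  rw [continuousOn_iff_isClosed] at h ⊢
  intro K hK
  obtain ⟨C, hC, hC'⟩ := h K hK
  refine ⟨f '' C, hf C hC, ?_⟩
  ext x
  constructor
  · rintro ⟨hx, hxN, a, rfl⟩
    have : a ∈ C ∩ f ⁻¹' N := hC' ▸ ⟨hx, hxN⟩
    exact ⟨⟨a, this.1, rfl⟩, hxN, a, rfl⟩
  · rintro ⟨⟨a, ha, rfl⟩, hxN, -⟩
    have : a ∈ g ∘ f ⁻¹' K ∩ f ⁻¹' N := hC'.symm ▸ ⟨ha, hxN⟩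
    exact ⟨this.1, hxN, a, rfl⟩

/-- At a point outside a closed set `D` there is nothing to check along `D`, so continuity along
each closed piece may be tested at all points of `N`. -/
theorem ContinuousOn.union_inter_isClosed {B Z : Type*} [TopologicalSpace B] [TopologicalSpace Z]
    {g : B → Z} {N C C' : Set B} (h : ContinuousOn g (N ∩ C)) (h' : ContinuousOn g (N ∩ C'))
    (hC : IsClosed C) (hC' : IsClosed C') : ContinuousOn g (N ∩ (C ∪ C')) := by
  have key {D : Set B} (hD : IsClosed D) (hg : ContinuousOn g (N ∩ D)) {x : B} (hx : x ∈ N) :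
      ContinuousWithinAt g (N ∩ D) x := by
    by_cases hxD : x ∈ D
    · exact hg x ⟨hx, hxD⟩
    · exact continuousWithinAt_of_notMem_closure fun hx' =>
        hxD (hD.closure_eq ▸ closure_mono inter_subset_right hx')
  rw [inter_union_distrib_left]
  intro x hx
  have hxN : x ∈ N := by rcases hx with hx | hx <;> exact hx.1
  exact (key hC h hxN).union (key hC' h' hxN)

/-- Pushing points of the punctured unit ball to the unit sphere, radially. -/
noncomputable def radialPush {n : ℕ} (z : Fin n → ℝ) (s : ℝ) : Fin n → ℝ :=
  (1 - s + s * ‖z‖⁻¹) • z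

/-- The scaling factor is nonnegative. The formula shows that the push stays in the unit ball and
reaches the sphere at `s = 1`. -/
theorem norm_radialPush {n : ℕ} {z : Fin n → ℝ} (hz : z ≠ 0) {s : ℝ} (hs : s ∈ Icc (0 : ℝ) 1) :
    ‖radialPush z s‖ = (1 - s) * ‖z‖ + s := by
  have hz' : 0 < ‖z‖ := norm_pos_iff.2 hz
  have h0 : 0 ≤ 1 - s + s * ‖z‖⁻¹ := by
    have := hs.1; have := hs.2
    have : 0 ≤ s * ‖z‖⁻¹ := by positivity
    linarith
  rw [radialPush, norm_smul, Real.norm_of_nonneg h0]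
  field_simp

theorem continuousOn_radialPush {n : ℕ} :
    ContinuousOn (fun q : (Fin n → ℝ) × ℝ => radialPush q.1 q.2) {q | q.1 ≠ 0} := by
  have h : ContinuousOn (fun q : (Fin n → ℝ) × ℝ => ‖q.1‖⁻¹) {q | q.1 ≠ 0} :=
    ContinuousOn.inv₀ (by fun_prop) fun q hq => norm_ne_zero_iff.2 hq
  unfold radialPush
  fun_prop

/-- This is the tube lemma for the compact interval. -/
theorem IsOpen.setOf_forall_Icc_mem {O : Set (X × ℝ)} (hO : IsOpen O) :
    IsOpen {x : X | ∀ s ∈ Icc (0 : ℝ) 1, (x, s) ∈ O} := by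
  rw [isOpen_iff_mem_nhds]
  intro x hx
  obtain ⟨u, v, hu, -, hxu, hv, huv⟩ := generalized_tube_lemma (isCompact_singleton (x := x))
    (isCompact_Icc (a := (0 : ℝ)) (b := 1)) hO (by rintro ⟨a, s⟩ ⟨rfl, hs⟩; exact hx s hs)
  exact Filter.mem_of_superset (hu.mem_nhds (hxu rfl)) fun y hy s hs => huv ⟨hy, hv hs⟩

/-- If `R` deforms the neighbourhood `N` of `y` in `Z` into `Y`, fixing `y`, and `Y` is locally
contractible, then so is `Z` at `y`. -/
theorem LocallyContractibleOn.of_deformation {Y Z : Set X} (hLC : LocallyContractibleOn Y)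
    (hYZ : Y ⊆ Z) {O : Set X} (hO : IsOpen O) {R : X × ℝ → X}
    (hR : ContinuousOn R ((O ∩ Z) ×ˢ Icc 0 1))
    (hRZ : ∀ x ∈ O ∩ Z, ∀ s ∈ Icc (0 : ℝ) 1, R (x, s) ∈ Z)
    (hR0 : ∀ x ∈ O ∩ Z, R (x, 0) = x) (hR1 : ∀ x ∈ O ∩ Z, R (x, 1) ∈ Y)
    {y : X} (hy : y ∈ Y) (hyO : y ∈ O) (hRy : ∀ s, R (y, s) = y) {U : Set X} (hU : IsOpen U)
    (hyU : y ∈ U) : ∃ V, IsOpen V ∧ y ∈ V ∧ ContractsIn (V ∩ Z) (U ∩ Z) := by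
  obtain ⟨V₀, hV₀, hyV₀, c, H, hH, hHU, hH0, hH1⟩ := hLC y hy U hU hyU
  obtain ⟨P, hP, hP'⟩ := (_root_.continuousOn_iff'.1 hR) U hU
  have hR1c : ContinuousOn (fun x => R (x, 1)) (O ∩ Z) :=
    hR.comp (by fun_prop) fun x hx => ⟨hx, by simp⟩
  obtain ⟨Q, hQ, hQ'⟩ := (_root_.continuousOn_iff'.1 hR1c) V₀ hV₀
  -- The three conditions say that `R` is defined, that its whole track stays in `U`, and that its
  -- end lies in `V₀`. They hold at `y` because `R` fixes `y`.
  refine ⟨O ∩ {x | ∀ s ∈ Icc (0 : ℝ) 1, (x, s) ∈ P} ∩ Q,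
    (hO.inter hP.setOf_forall_Icc_mem).inter hQ, ⟨⟨hyO, fun s hs => ?_⟩, ?_⟩, ?_⟩
  · have : (y, s) ∈ R ⁻¹' U ∩ (O ∩ Z) ×ˢ Icc 0 1 :=
      ⟨by simpa [hRy s] using hyU, ⟨hyO, hYZ hy⟩, hs⟩
    exact (hP' ▸ this).1
  · have : y ∈ (fun x => R (x, 1)) ⁻¹' V₀ ∩ (O ∩ Z) :=
      ⟨by simpa [hRy 1] using hyV₀, hyO, hYZ hy⟩
    exact (hQ' ▸ this).1
  set V := O ∩ {x | ∀ s ∈ Icc (0 : ℝ) 1, (x, s) ∈ P} ∩ Q with hV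
  have hVO : V ∩ Z ⊆ O ∩ Z := fun x hx => ⟨hx.1.1.1, hx.2⟩
  have hRU : ∀ x ∈ V ∩ Z, ∀ s ∈ Icc (0 : ℝ) 1, R (x, s) ∈ U := fun x hx s hs => by
    have : (x, s) ∈ P ∩ (O ∩ Z) ×ˢ Icc 0 1 := ⟨hx.1.1.2 s hs, hVO hx, hs⟩
    exact (hP'.symm ▸ this).1
  have hRV : ∀ x ∈ V ∩ Z, R (x, 1) ∈ V₀ ∩ Y := fun x hx => by
    have : x ∈ Q ∩ (O ∩ Z) := ⟨hx.1.2, hVO hx⟩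
    exact ⟨(hQ'.symm ▸ this).1, hR1 x (hVO hx)⟩
  -- Deform into `Y` during the first half of the time, then contract inside `Y`.
  refine ⟨c, fun q => if q.2 ≤ 1 / 2 then R (q.1, 2 * q.2) else H (R (q.1, 1), 2 * q.2 - 1),
    ?_, ?_, ?_, ?_⟩
  · have hA : ContinuousOn (fun q : X × ℝ => R (q.1, 2 * q.2)) ((V ∩ Z) ×ˢ Icc 0 (1 / 2)) := by
      refine hR.comp (by fun_prop) ?_
      rintro ⟨x, s⟩ ⟨hx, hs⟩
      refine ⟨hVO hx, ?_, ?_⟩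
      · simpa using hs.1
      · have := hs.2; simp only at this ⊢; linarith
    have hB : ContinuousOn (fun q : X × ℝ => H (R (q.1, 1), 2 * q.2 - 1))
        ((V ∩ Z) ×ˢ Icc (1 / 2) 1) := by
      refine hH.comp (ContinuousOn.prodMk ?_ (by fun_prop)) ?_
      · exact hR1c.comp (by fun_prop) fun q hq => hVO hq.1
      · rintro ⟨x, s⟩ ⟨hx, hs⟩
        refine ⟨hRV x hx, ?_, ?_⟩
        · have := hs.1; simp only at this ⊢; linarith
        · have := hs.2; simp only at this ⊢; linarith
    refine ContinuousOn.if ?_ ?_ ?_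
    · rintro ⟨x, s⟩ ⟨⟨hx, hs⟩, hf⟩
      have hs' : s = 1 / 2 := frontier_le_subset_eq (by fun_prop) (by fun_prop) hf
      subst hs'
      simp only
      norm_num
      exact (hH0 _ (hRV x hx)).symm
    · refine hA.mono ?_
      rintro ⟨x, s⟩ ⟨⟨hx, hs⟩, hf⟩
      have : s ≤ 1 / 2 := by
        rw [closure_le_eq (by fun_prop) (by fun_prop)] at hf
        exact hf
      exact ⟨hx, hs.1, this⟩
    · refine hB.mono ?_
      rintro ⟨x, s⟩ ⟨⟨hx, hs⟩, hf⟩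
      have : 1 / 2 ≤ s := by
        have h := closure_lt_subset_le (f := fun _ : X × ℝ => (1 / 2 : ℝ)) (g := fun q => q.2)
          (by fun_prop) (by fun_prop)
        simp only [not_le] at hf
        exact h hf
      exact ⟨hx, this, hs.2⟩
  · intro x hx s hs
    simp only
    split_ifs with h
    · have : 2 * s ∈ Icc (0 : ℝ) 1 := ⟨by linarith [hs.1], by linarith⟩
      exact ⟨hRU x hx _ this, hRZ x (hVO hx) _ this⟩
    · have := hHU _ (hRV x hx) (2 * s - 1) ⟨by linarith [hs.1], by linarith [hs.2]⟩
      exact ⟨this.1, hYZ this.2⟩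
  · intro x hx
    simp [hR0 x (hVO hx)]
  · intro x hx
    have := hH1 _ (hRV x hx)
    norm_num
    exact this

/-- Attaching a cell preserves local contractibility. -/
theorem LocallyContractibleOn.union_cell [T2Space X] {Y : Set X} (hY : IsClosed Y)
    (hLC : LocallyContractibleOn Y) {n : ℕ} (φ : PartialEquiv (Fin n → ℝ) X)
    (hsrc : φ.source = ball 0 1) (hφ : ContinuousOn φ (closedBall 0 1))
    (hφ' : ContinuousOn φ.symm φ.target) (hsph : MapsTo φ (sphere 0 1) Y)
    (hdisj : Disjoint (φ '' ball 0 1) Y) :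
    LocallyContractibleOn (Y ∪ φ '' closedBall 0 1) := by
  have h0 : (0 : Fin n → ℝ) ∈ ball (0 : Fin n → ℝ) 1 := by simp
  have hinv : ∀ z ∈ ball (0 : Fin n → ℝ) 1, φ.symm (φ z) = z := fun z hz =>
    φ.left_inv (hsrc ▸ hz)
  have hnot : ∀ z ∈ ball (0 : Fin n → ℝ) 1, φ z ∉ Y := fun z hz =>
    disjoint_left.1 hdisj ⟨z, hz, rfl⟩
  have hcases : ∀ z ∈ closedBall (0 : Fin n → ℝ) 1, z ∈ ball (0 : Fin n → ℝ) 1 ∨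
      (‖z‖ = 1 ∧ φ z ∈ Y) := fun z hz => by
    rcases (mem_closedBall_zero_iff.1 hz).lt_or_eq with h | h
    · exact Or.inl (mem_ball_zero_iff.2 h)
    · exact Or.inr ⟨h, hsph (mem_sphere_zero_iff_norm.2 h)⟩
  have hballopen : IsOpen Yᶜ := hY.isOpen_compl
  have hcompl : ∀ x ∈ Y ∪ φ '' closedBall 0 1, x ∉ Y → ∃ z ∈ ball (0 : Fin n → ℝ) 1, φ z = x := by
    rintro x (hx | ⟨z, hz, rfl⟩) hxY
    · exact absurd hx hxY
    · rcases hcases z hz with h | h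
      · exact ⟨z, h, rfl⟩
      · exact absurd h.2 hxY
  intro x hx U hU hxU
  by_cases hxY : x ∈ Y
  · classical
    -- Near a point of `Y`, the cell punctured at its centre is pushed radially onto its boundary.
    -- Values outside `Y` and the cell are irrelevant.
    let R : X × ℝ → X := fun q => if q.1 ∈ Y then q.1 else φ (radialPush (φ.symm q.1) q.2)
    have hRY : ∀ y ∈ Y, ∀ s, R (y, s) = y := fun y hy s => if_pos hy
    have hRφ : ∀ z ∈ closedBall (0 : Fin n → ℝ) 1, z ≠ 0 → ∀ s, R (φ z, s) =
        φ (radialPush z s) := fun z hz hz0 s => by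
      rcases hcases z hz with h | h
      · simp only [R, if_neg (hnot z h), hinv z h]
      · rw [hRY _ h.2, radialPush, h.1]; simp
    have hpush : ∀ z ∈ closedBall (0 : Fin n → ℝ) 1, z ≠ 0 → ∀ s ∈ Icc (0 : ℝ) 1,
        radialPush z s ∈ closedBall (0 : Fin n → ℝ) 1 := fun z hz hz0 s hs => by
      rw [mem_closedBall_zero_iff] at hz ⊢
      rw [norm_radialPush hz0 hs]
      nlinarith [hs.1, hs.2]
    have hO : IsOpen ({φ 0}ᶜ : Set X) := isOpen_compl_singleton
    have hne : ∀ z : Fin n → ℝ, φ z ≠ φ 0 → z ≠ 0 := fun z h h' => h (h' ▸ rfl)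
    have hmem : ∀ x ∈ {φ 0}ᶜ ∩ (Y ∪ φ '' closedBall 0 1), x ∈ Y ∨
        ∃ z ∈ closedBall (0 : Fin n → ℝ) 1, z ≠ 0 ∧ φ z = x := by
      rintro x ⟨h, hx | ⟨z, hz, rfl⟩⟩
      · exact Or.inl hx
      · exact Or.inr ⟨z, hz, hne z h, rfl⟩
    refine hLC.of_deformation subset_union_left hO (R := R) ?_ ?_ ?_ ?_ hxY ?_ (hRY x hxY) hU hxU
    · let f : closedBall (0 : Fin n → ℝ) 1 × Icc (0 : ℝ) 1 → X × ℝ := fun q => (φ q.1, q.2)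
      have hφc : Continuous fun q : closedBall (0 : Fin n → ℝ) 1 => φ q :=
        continuousOn_iff_continuous_domRestrict.1 hφ
      have hf : Continuous f := by
        refine Continuous.prodMk (hφc.comp continuous_fst) (by fun_prop)
      have : CompactSpace (closedBall (0 : Fin n → ℝ) 1) :=
        isCompact_iff_compactSpace.1 (isCompact_closedBall _ _)
      have hfc : IsClosedMap f := hf.isClosedMap
      -- Continuity on the closed cell is checked upstairs on the compact disc times interval, where
      -- `R` becomes the radial push.
      have h1 : ContinuousOn R ((({φ 0}ᶜ : Set X) ×ˢ univ) ∩ range f) := by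
        refine hfc.continuousOn_inter_range ?_
        have : ContinuousOn (fun q : closedBall (0 : Fin n → ℝ) 1 × Icc (0 : ℝ) 1 =>
            φ (radialPush q.1 q.2)) (f ⁻¹' (({φ 0}ᶜ : Set X) ×ˢ univ)) := by
          refine hφ.comp (continuousOn_radialPush.comp (f := fun q : closedBall (0 : Fin n → ℝ) 1 ×
            Icc (0 : ℝ) 1 => ((q.1 : Fin n → ℝ), (q.2 : ℝ))) (by fun_prop) ?_) ?_
          · rintro q hq; exact hne _ hq.1
          · rintro q hq; exact hpush _ q.1.2 (hne _ hq.1) _ q.2.2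
        refine this.congr fun q hq => hRφ _ q.1.2 (hne _ hq.1) _
      have h2 : ContinuousOn R ((({φ 0}ᶜ : Set X) ×ˢ univ) ∩ Y ×ˢ Icc 0 1) := by
        refine (continuous_fst.continuousOn).congr ?_
        rintro ⟨y, s⟩ ⟨-, hy, -⟩
        exact hRY y hy s
      refine (h2.union_inter_isClosed h1 (hY.prod isClosed_Icc) hfc.isClosed_range).mono ?_
      rintro ⟨y, s⟩ ⟨⟨hy, hy' | ⟨z, hz, rfl⟩⟩, hs⟩
      · exact ⟨⟨hy, trivial⟩, Or.inl ⟨hy', hs⟩⟩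
      · exact ⟨⟨hy, trivial⟩, Or.inr ⟨(⟨z, hz⟩, ⟨s, hs⟩), rfl⟩⟩
    · intro y hy s hs
      rcases hmem y hy with h | ⟨z, hz, hz0, rfl⟩
      · rw [hRY y h]; exact Or.inl h
      · rw [hRφ z hz hz0]; exact Or.inr ⟨_, hpush z hz hz0 s hs, rfl⟩
    · intro y hy
      rcases hmem y hy with h | ⟨z, hz, hz0, rfl⟩
      · rw [hRY y h]
      · rw [hRφ z hz hz0, radialPush]; simp
    · intro y hy
      rcases hmem y hy with h | ⟨z, hz, hz0, rfl⟩
      · rw [hRY y h]; exact h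
      · rw [hRφ z hz hz0]
        refine hsph (mem_sphere_zero_iff_norm.2 ?_)
        rw [norm_radialPush hz0 (by simp)]
        simp
    · exact fun h => hnot 0 h0 (h ▸ hxY)
  · obtain ⟨z, hz, rfl⟩ := hcompl x hx hxY
    obtain ⟨O, hO, hO'⟩ := (_root_.continuousOn_iff'.1 (hφ.mono ball_subset_closedBall)) U hU
    have hzO : z ∈ O ∩ ball 0 1 := hO' ▸ ⟨hxU, hz⟩
    obtain ⟨ε, hε, hεO⟩ := Metric.isOpen_iff.1 (hO.inter isOpen_ball) z hzO
    have htgt : φ.target = φ '' ball 0 1 := by rw [← hsrc, φ.image_source_eq_target]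
    obtain ⟨P, hP, hP'⟩ := (_root_.continuousOn_iff'.1 hφ') (ball z ε) isOpen_ball
    have hV : ∀ y ∈ P ∩ Yᶜ ∩ (Y ∪ φ '' closedBall 0 1), ∃ w ∈ ball z ε, w ∈ ball 0 1 ∧ φ w = y := by
      rintro y ⟨⟨hyP, hyY⟩, hy⟩
      obtain ⟨w, hw, rfl⟩ := hcompl y hy hyY
      have : φ w ∈ P ∩ φ.target := ⟨hyP, htgt ▸ ⟨w, hw, rfl⟩⟩
      have := (hP'.symm ▸ this : φ w ∈ φ.symm ⁻¹' ball z ε ∩ φ.target).1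
      rw [mem_preimage, hinv w hw] at this
      exact ⟨w, this, hw, rfl⟩
    -- At an interior point of the cell, contract along straight segments to `z` in the coordinates
    -- of the disc; the small ball around `z` is convex and is mapped into `U`.
    refine ⟨P ∩ Yᶜ, hP.inter hY.isOpen_compl, ⟨?_, hxY⟩, φ z,
      fun q => φ ((1 - q.2) • φ.symm q.1 + q.2 • z), ?_, ?_, ?_, ?_⟩
    · have : φ z ∈ φ.symm ⁻¹' ball z ε ∩ φ.target :=
        ⟨by rw [mem_preimage, hinv z hz]; exact mem_ball_self hε, htgt ▸ ⟨z, hz, rfl⟩⟩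
      exact (hP' ▸ this).1
    all_goals
      have hconv : ∀ w ∈ ball z ε, ∀ s ∈ Icc (0 : ℝ) 1, (1 - s) • w + s • z ∈ ball z ε :=
        fun w hw s hs => convex_ball z ε hw (mem_ball_self hε) (by linarith [hs.2]) hs.1 (by ring)
    · have hsymm : ContinuousOn (fun q : X × ℝ => φ.symm q.1)
          ((P ∩ Yᶜ ∩ (Y ∪ φ '' closedBall 0 1)) ×ˢ Icc 0 1) := by
        refine hφ'.comp continuousOn_fst ?_
        rintro ⟨y, s⟩ ⟨hy, hs⟩
        obtain ⟨w, -, hw, rfl⟩ := hV y hy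
        exact htgt ▸ ⟨w, hw, rfl⟩
      refine hφ.comp (by fun_prop) ?_
      · rintro ⟨y, s⟩ ⟨hy, hs⟩
        obtain ⟨w, hwε, hw, rfl⟩ := hV y hy
        simp only [hinv w hw]
        exact ball_subset_closedBall (hεO (hconv w hwε s hs)).2
    · intro y hy s hs
      obtain ⟨w, hwε, hw, rfl⟩ := hV y hy
      simp only [hinv w hw]
      have h := hεO (hconv w hwε s hs)
      exact ⟨(hO'.symm ▸ h : _ ∈ φ ⁻¹' U ∩ ball 0 1).1,
        Or.inr ⟨_, ball_subset_closedBall h.2, rfl⟩⟩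
    · intro y hy
      obtain ⟨w, -, hw, rfl⟩ := hV y hy
      simp [hinv w hw]
    · intro y _
      simp

open Topology in
/-- Finite CW complexes are locally contractible. -/
theorem locallyContractibleOn_of_finite_CWComplex [T2Space X] [CWComplex (univ : Set X)]
    [CWComplex.Finite (univ : Set X)] : LocallyContractibleOn (univ : Set X) := by
  have key (m : ℕ) : LocallyContractibleOn (RelCWComplex.skeletonLT (univ : Set X) m : Set X) := by
    induction m with
    | zero =>
      intro x hx
      have := CWComplex.skeletonLT_zero_eq_empty (C := (univ : Set X))
      simp only [Nat.cast_zero] at hx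
      rw [this] at hx
      exact hx.elim
    | succ m ih =>
      have hfin := RelCWComplex.FiniteType.finite_cell (C := (univ : Set X)) (D := ∅) m
      -- The cells of dimension `m` are attached one at a time, so that each attachment is along a
      -- closed locally contractible set.
      have step : ∀ t : Set (RelCWComplex.cell (univ : Set X) m), t.Finite →
          IsClosed ((RelCWComplex.skeletonLT (univ : Set X) m : Set X) ∪
            ⋃ j ∈ t, RelCWComplex.closedCell m j) ∧
          LocallyContractibleOn ((RelCWComplex.skeletonLT (univ : Set X) m : Set X) ∪
            ⋃ j ∈ t, RelCWComplex.closedCell m j) := by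
        intro t ht
        refine ⟨(RelCWComplex.skeletonLT (univ : Set X) m).closed.union
          (ht.isClosed_biUnion fun j _ => RelCWComplex.isClosed_closedCell), ?_⟩
        induction t, ht using Set.Finite.induction_on with
        | empty => simpa using ih
        | @insert a t ha ht' iht =>
          have hcl : IsClosed ((RelCWComplex.skeletonLT (univ : Set X) m : Set X) ∪
              ⋃ j ∈ t, RelCWComplex.closedCell m j) :=
            (RelCWComplex.skeletonLT (univ : Set X) m).closed.union
              (ht'.isClosed_biUnion fun j _ => RelCWComplex.isClosed_closedCell)
          have := LocallyContractibleOn.union_cell hcl iht (RelCWComplex.map m a)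
            (RelCWComplex.source_eq m a) (RelCWComplex.continuousOn m a)
            (RelCWComplex.continuousOn_symm m a) ?_ ?_
          · rw [biUnion_insert, union_comm (RelCWComplex.closedCell m a), ← union_assoc]
            exact this
          · intro z hz
            exact Or.inl (RelCWComplex.cellFrontier_subset_skeletonLT m a ⟨z, hz, rfl⟩)
          · rw [disjoint_union_right]
            have hd := RelCWComplex.disjoint_skeletonLT_openCell (C := (univ : Set X)) (n := m)
              (m := m) (j := a) le_rfl
            refine ⟨hd.symm, ?_⟩
            rw [disjoint_iUnion₂_right]
            intro j hj
            rw [← RelCWComplex.cellFrontier_union_openCell_eq_closedCell, disjoint_union_right]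
            refine ⟨hd.symm.mono_right (RelCWComplex.cellFrontier_subset_skeletonLT m j), ?_⟩
            refine RelCWComplex.disjoint_openCell_of_ne fun h => ha ?_
            cases h
            exact hj
      have := (step univ finite_univ).2
      rw [Nat.cast_succ, ← RelCWComplex.skeletonLT_union_iUnion_closedCell_eq_skeletonLT_succ]
      simpa using this
  obtain ⟨N, hN⟩ := Filter.eventually_atTop.1
    (RelCWComplex.FiniteDimensional.eventually_isEmpty_cell (C := (univ : Set X)) (D := ∅))
  have hs : (RelCWComplex.skeletonLT (univ : Set X) N : Set X) = univ := by
    refine eq_univ_of_univ_subset ?_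
    refine (CWComplex.union (C := (univ : Set X))).symm.subset.trans ?_
    refine iUnion_subset fun m => iUnion_subset fun j => ?_
    have hm : m < N := by
      by_contra h
      exact (hN m (not_lt.1 h)).false j
    refine (RelCWComplex.closedCell_subset_skeletonLT m j).trans ?_
    exact RelCWComplex.skeletonLT_mono (by exact_mod_cast hm)
  exact hs ▸ key N

open Topology in
theorem compactSpace_of_finite_CWComplex [T2Space X] [CWComplex (univ : Set X)]
    [CWComplex.Finite (univ : Set X)] : CompactSpace X := by
  have hfin := RelCWComplex.finite_cells_of_finite (C := (univ : Set X))
  refine ⟨?_⟩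
  have h : (⋃ q : Σ m, RelCWComplex.cell (univ : Set X) m, RelCWComplex.closedCell q.1 q.2) =
      (univ : Set X) := (iUnion_sigma _).trans (CWComplex.union (C := (univ : Set X)))
  rw [← h]
  exact isCompact_iUnion fun q => RelCWComplex.isCompact_closedCell

end LocalContractibility

/-! ### Small balls in a covering of a compact locally contractible space -/

section SmallBalls

open Set Topology unitInterval

/-- In a compact locally contractible space there are arbitrarily fine systems of neighbourhoods
of all points, each of which is contractible inside the preceding one. -/
theorem LocallyContractibleOn.exists_scales {X : Type*} [TopologicalSpace X] [CompactSpace X]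
    [T2Space X] (hX : LocallyContractibleOn (univ : Set X)) :
    ∃ U : ℕ → X → Set X, (∀ j x, U j x ∈ 𝓝 x) ∧
      (∀ j x y, y ∈ U (j + 1) x → U (j + 1) y ⊆ U j x ∧ U (j + 1) x ⊆ U j y) ∧
      (∀ j x, ContractsIn (U (j + 1) x) (U j x)) ∧ ∀ x, ContractsIn (U 0 x) univ := by
  -- A compact Hausdorff space carries a compatible uniformity; the neighbourhoods will be the balls
  -- of a sequence of entourages.
  let : UniformSpace X := uniformSpaceOfCompactR1
  let ball (x : X) (V : Set (X × X)) : Set X := UniformSpace.ball x V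
  have step (V : Set (X × X)) (hV : V ∈ uniformity X) : ∃ W ∈ uniformity X,
      (∀ x y, y ∈ ball x W → ball y W ⊆ ball x V ∧ ball x W ⊆ ball y V) ∧
        ∀ x, ContractsIn (ball x W) (ball x V) := by
    obtain ⟨V', hV', hsymm, hcomp⟩ := comp_symm_of_uniformity hV
    have hcomp' : ∀ a b c, (a, b) ∈ V' → (b, c) ∈ V' → (a, c) ∈ V := fun a b c h h' =>
      hcomp (SetRel.prodMk_mem_comp h h')
    have hloc (x : X) : ∃ N, IsOpen N ∧ x ∈ N ∧ N ⊆ ball x V' ∧ ContractsIn N (ball x V') := by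
      obtain ⟨O, hO, hOo, hxO⟩ := mem_nhds_iff.1 (UniformSpace.ball_mem_nhds x hV')
      obtain ⟨N, hN, hxN, hc⟩ := hX x trivial O hOo hxO
      have hc' := hc.mono (A' := N ∩ O) (by simp) (inter_subset_left.trans hO)
      exact ⟨N ∩ O, hN.inter hOo, ⟨hxN, hxO⟩, inter_subset_right.trans hO, hc'⟩
    choose N hN hxN hNV hNc using hloc
    -- By the Lebesgue number lemma each `W`-ball lies in some contractible `N c`. The contraction
    -- moves in the `V'`-ball of `c`, and passing from `c` to `x` costs one composition of `V'` with
    -- itself.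
    obtain ⟨W, hW, hWN⟩ := lebesgue_number_lemma (U := N) isCompact_univ hN
      fun x _ => mem_iUnion.2 ⟨x, hxN x⟩
    refine ⟨W ∩ V', Filter.inter_mem hW hV', fun x y hy => ⟨fun z hz => ?_, fun z hz => ?_⟩,
      fun x => ?_⟩
    · exact hcomp' x y z hy.2 hz.2
    · exact hcomp' y x z (hsymm hy.2) hz.2
    · obtain ⟨c, hc⟩ := hWN x trivial
      have hxc : x ∈ ball c V' := hNV c (hc (UniformSpace.mem_ball_self x hW))
      exact (hNc c).mono (fun z hz => hc hz.1) fun z hz => hcomp' x c z (hsymm hxc) hz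
  -- Starting from the whole space makes the balls of the coarsest scale contractible in `X`, which
  -- later gives injectivity of the covering on them.
  obtain ⟨V₀, hV₀, -, hV₀c⟩ := step univ Filter.univ_mem
  choose! f hf hf' hf'' using step
  have hmem (j : ℕ) : f^[j] V₀ ∈ uniformity X := by
    induction j with
    | zero => exact hV₀
    | succ j ih => rw [Function.iterate_succ_apply']; exact hf _ ih
  refine ⟨fun j x => ball x (f^[j] V₀), fun j x => UniformSpace.ball_mem_nhds x (hmem j),
    fun j x y hy => ?_, fun j x => ?_, fun x => (hV₀c x).mono subset_rfl (subset_univ _)⟩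
  · simp only [Function.iterate_succ_apply'] at hy ⊢
    exact hf' _ (hmem j) x y hy
  · simp only [Function.iterate_succ_apply']
    exact hf'' _ (hmem j) x

/-- The tracks of the contraction join every point of `V` to `c` inside `O`, so the path component
of `x` in `O` contains `V`. -/
theorem LocallyContractibleOn.locallyPathConnectedSpace {X : Type*} [TopologicalSpace X]
    (hX : LocallyContractibleOn (univ : Set X)) : LocallyPathConnectedSpace X := by
  refine ⟨fun x => Filter.hasBasis_self.2 fun t ht => ?_⟩
  obtain ⟨O, hO, hOo, hxO⟩ := mem_nhds_iff.1 ht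
  obtain ⟨V, hV, hxV, c, H, hH, hHU, hH0, hH1⟩ := hX x trivial O hOo hxO
  simp only [inter_univ] at hH hHU hH0 hH1
  refine ⟨pathComponentIn O x, Filter.mem_of_superset (hV.mem_nhds hxV) fun y hy => ?_,
    isPathConnected_pathComponentIn hxO, pathComponentIn_subset.trans hO⟩
  have key (y : X) (hy : y ∈ V) : JoinedIn O y c := by
    have h1 : IsPathConnected ((fun s : ℝ => H (y, s)) '' Icc 0 1) :=
      ((convex_Icc (0 : ℝ) 1).isPathConnected ⟨0, by simp⟩).image'
        (hH.comp (by fun_prop) fun s hs => ⟨hy, hs⟩)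
    refine (h1.joinedIn y ⟨0, by simp, hH0 y hy⟩ c ⟨1, by simp, hH1 y hy⟩).mono ?_
    rintro _ ⟨s, hs, rfl⟩
    exact hHU y hy s hs
  exact (key x hxV).trans (key y hy).symm

theorem IsLocalHomeomorph.locallyPathConnectedSpace {X E : Type*} [TopologicalSpace X]
    [TopologicalSpace E] [LocallyPathConnectedSpace X] {p : E → X} (hp : IsLocalHomeomorph p) :
    LocallyPathConnectedSpace E := by
  choose φ hφ _ using hp
  let : ChartedSpace X E :=
    { atlas := range φ
      chartAt := φ
      mem_chart_source := hφ
      chart_mem_atlas := fun e => ⟨e, rfl⟩ }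
  exact ChartedSpace.locallyPathConnectedSpace X E

variable {X E : Type*} [TopologicalSpace X] [TopologicalSpace E] {p : C(E, X)}

/-- The lift of a contraction to a covering space. -/
theorem ContractsIn.exists_lift (hp : IsCoveringMap p) {S T : Set X} (h : ContractsIn S T)
    {A : Set E} (hA : A ⊆ p ⁻¹' S) :
    ∃ H : C(I × A, E), (∀ a, H (0, a) = a) ∧ (∀ s a, p (H (s, a)) ∈ T) ∧
      (∀ a a' : A, p a = p a' → ∀ s, p (H (s, a)) = p (H (s, a'))) ∧
        ∃ c, ∀ a, p (H (1, a)) = c := by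
  obtain ⟨c, K, hK, hKT, hK0, hK1⟩ := h
  let F : C(I × A, X) := ⟨fun q => K (p q.2, q.1), hK.comp_continuous (by fun_prop)
    fun q => ⟨hA q.2.2, q.1.2⟩⟩
  have hF : ∀ a : A, F (0, a) = p a := fun a => hK0 _ (hA a.2)
  let H := hp.liftHomotopy F ⟨Subtype.val, continuous_subtype_val⟩ hF
  have hH (q) : p (H q) = F q :=
    congrFun (hp.liftHomotopy_lifts F ⟨Subtype.val, continuous_subtype_val⟩ hF) q
  refine ⟨H, fun a => hp.liftHomotopy_zero F ⟨Subtype.val, continuous_subtype_val⟩ hF a, ?_, ?_,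
    c, ?_⟩
  · intro s a
    rw [hH]
    exact hKT _ (hA a.2) s s.2
  · intro a a' ha s
    rw [hH, hH]
    exact congrArg (fun x => K (x, s)) ha
  · intro a
    rw [hH]
    exact hK1 _ (hA a.2)

/-- The part of `p⁻¹(U)` that can be joined to `e` inside `p⁻¹(U)`. -/
def sheetIn (p : C(E, X)) (U : Set X) (e : E) : Set E := pathComponentIn (p ⁻¹' U) e

theorem sheetIn_mono {U U' : Set X} (h : U ⊆ U') (e : E) : sheetIn p U e ⊆ sheetIn p U' e :=
  pathComponentIn_mono (preimage_mono h)

theorem sheetIn_subset (U : Set X) (e : E) : sheetIn p U e ⊆ p ⁻¹' U := pathComponentIn_subset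

theorem mem_sheetIn_self {U : Set X} {e : E} (h : p e ∈ U) : e ∈ sheetIn p U e :=
  mem_pathComponentIn_self h

/-- The end points lie in a single fibre, which is discrete, and they depend continuously on a point
of a connected set. -/
theorem exists_constant_end (hp : IsCoveringMap p) {A : Set E} (hA : IsPathConnected A)
    (H : C(I × A, E)) {c : X} (hc : ∀ a, p (H (1, a)) = c) (a a' : A) : H (1, a) = H (1, a') := by
  have : PathConnectedSpace A := isPathConnected_iff_pathConnectedSpace.1 hA
  exact hp.const_of_comp (g := fun a : A => H (1, a)) (by fun_prop) (fun a a' => by rw [hc, hc])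
    a a'

/-- The lifted contraction ends at a single point because the sheet is path connected, and its
tracks are paths over `T`, so they do not leave the sheet over `T`. -/
theorem ContractsIn.sheetIn (hp : IsCoveringMap p) {S T : Set X} (h : ContractsIn S T)
    (hST : S ⊆ T) {e : E} (he : p e ∈ S) : ContractsIn (sheetIn p S e) (sheetIn p T e) := by
  obtain ⟨H, hH0, hHT, -, c, hHc⟩ := h.exists_lift hp (sheetIn_subset S e)
  have hconst := exists_constant_end hp (isPathConnected_pathComponentIn he) H hHc
  classical
  refine ⟨H (1, ⟨e, mem_sheetIn_self he⟩),
    fun q => if hq : q.1 ∈ _root_.sheetIn p S e then H (projIcc 0 1 zero_le_one q.2, ⟨q.1, hq⟩)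
      else q.1, ?_, ?_, ?_, ?_⟩
  · rw [continuousOn_iff_continuous_domRestrict]
    have : Continuous fun q : ((_root_.sheetIn p S e) ×ˢ Icc (0 : ℝ) 1 : Set (E × ℝ)) =>
        H (projIcc 0 1 zero_le_one q.1.2, ⟨q.1.1, q.2.1⟩) := by
      refine H.continuous.comp (Continuous.prodMk ?_ ?_)
      · exact continuous_projIcc.comp (by fun_prop)
      · exact Continuous.subtype_mk (by fun_prop) _
    convert this with q
    simp only [Set.domRestrict_apply, dif_pos q.2.1]
  · intro a ha s hs
    simp only [dif_pos ha]
    have : PathConnectedSpace I := isPathConnected_iff_pathConnectedSpace.1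
      ((convex_Icc (0 : ℝ) 1).isPathConnected ⟨0, by simp⟩)
    have h1 : IsPathConnected (range fun t : I => H (t, ⟨a, ha⟩)) :=
      isPathConnected_range (by fun_prop)
    have h2 : JoinedIn (p ⁻¹' T) a (H (projIcc 0 1 zero_le_one s, ⟨a, ha⟩)) := by
      refine (h1.joinedIn a ⟨0, hH0 _⟩ _ ⟨_, rfl⟩).mono ?_
      rintro _ ⟨t, rfl⟩
      exact hHT t _
    exact (sheetIn_mono hST e ha : JoinedIn _ _ _).trans h2
  · intro a ha
    simp only [dif_pos ha]
    rw [projIcc_left]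
    exact hH0 _
  · intro a ha
    simp only [dif_pos ha]
    rw [projIcc_right]
    exact hconst _ _

/-- Two points of the sheet with the same image have lifted tracks over the same path and with the
same end; by uniqueness of lifts the tracks coincide, in particular at the start. -/
theorem ContractsIn.injOn_sheetIn (hp : IsCoveringMap p) {S T : Set X} (h : ContractsIn S T)
    {e : E} (he : p e ∈ S) : InjOn p (_root_.sheetIn p S e) := by
  obtain ⟨H, hH0, -, hHp, c, hHc⟩ := h.exists_lift hp (sheetIn_subset S e)
  have hconst := exists_constant_end hp (isPathConnected_pathComponentIn he) H hHc
  intro a ha a' ha' haa'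
  have h1 := hp.eq_of_comp_eq (g₁ := fun t : I => H (t, ⟨a, ha⟩))
    (g₂ := fun t : I => H (t, ⟨a', ha'⟩)) (by fun_prop) (by fun_prop)
    (funext fun t => hHp ⟨a, ha⟩ ⟨a', ha'⟩ haa' t) 1 (hconst _ _)
  simpa [hH0] using congrFun h1 0

theorem ContractsIn.joinedIn {S T : Set X} (h : ContractsIn S T) {x y : X} (hx : x ∈ S)
    (hy : y ∈ S) : JoinedIn T x y := by
  obtain ⟨c, H, hH, hHU, hH0, hH1⟩ := h
  have key (y : X) (hy : y ∈ S) : JoinedIn T y c := by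
    have h1 : IsPathConnected ((fun s : ℝ => H (y, s)) '' Icc 0 1) :=
      ((convex_Icc (0 : ℝ) 1).isPathConnected ⟨0, by simp⟩).image'
        (hH.comp (by fun_prop) fun s hs => ⟨hy, hs⟩)
    refine (h1.joinedIn y ⟨0, by simp, hH0 y hy⟩ c ⟨1, by simp, hH1 y hy⟩).mono ?_
    rintro _ ⟨s, hs, rfl⟩
    exact hHU y hy s hs
  exact (key x hx).trans (key y hy).symm

theorem JoinedIn.exists_lift (hp : IsCoveringMap p) {T : Set X} {e : E} {y : X}
    (h : JoinedIn T (p e) y) : ∃ e', p e' = y ∧ JoinedIn (p ⁻¹' T) e e' := by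
  obtain ⟨γ, hγ⟩ := h
  let Γ := hp.liftPath γ e γ.source
  have hΓ (t : I) : p (Γ t) = γ t := congrFun (hp.liftPath_lifts γ e γ.source) t
  refine ⟨Γ 1, (hΓ 1).trans γ.target, ⟨Γ, hp.liftPath_zero γ e γ.source, rfl⟩, fun t => ?_⟩
  change p (Γ t) ∈ T
  rw [hΓ]
  exact hγ t

theorem deck_image_sheetIn_subset (g : deckGroup p) (U : Set X) (e : E) :
    g.1 '' sheetIn p U e ⊆ sheetIn p U (g.1 e) := by
  rintro _ ⟨a, ⟨γ, hγ⟩, rfl⟩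
  refine ⟨γ.map g.1.continuous, fun t => ?_⟩
  change p (g.1 (γ t)) ∈ U
  rw [deckGroup_apply]
  exact hγ t

/-- Deck transformations of a simply connected covering act transitively on the fibres. -/
theorem exists_deck_apply_eq [SimplyConnectedSpace E] [LocallyPathConnectedSpace E]
    (hp : IsCoveringMap p) {e e' : E} (h : p e = p e') : ∃ g : deckGroup p, g.1 e = e' := by
  -- As `E` is simply connected and locally path connected, `p` lifts through itself with any
  -- prescribed value over `p e`. The two lifts are mutually inverse by uniqueness.
  obtain ⟨F, ⟨hF, hFp⟩, -⟩ := hp.existsUnique_continuousMap_lifts p e e' h.symm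
  obtain ⟨F', ⟨hF', hFp'⟩, -⟩ := hp.existsUnique_continuousMap_lifts p e' e h
  have h1 : ⇑F' ∘ ⇑F = id := hp.eq_of_comp_eq (by fun_prop) continuous_id
    (by rw [← Function.comp_assoc, hFp', hFp]; rfl) e (by simp [hF, hF'])
  have h2 : ⇑F ∘ ⇑F' = id := hp.eq_of_comp_eq (by fun_prop) continuous_id
    (by rw [← Function.comp_assoc, hFp, hFp']; rfl) e' (by simp [hF, hF'])
  refine ⟨⟨⟨⟨F, F', congrFun h1, congrFun h2⟩, F.continuous, F'.continuous⟩, congrFun hFp⟩, hF⟩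

theorem deck_free [PreconnectedSpace E] (hp : IsCoveringMap p) {g g' : deckGroup p} {e : E}
    (h : g.1 e = g'.1 e) : g = g' := by
  have h3 := hp.eq_of_comp_eq g.1.continuous g'.1.continuous
    (funext fun e => (g.2 e).trans (g'.2 e).symm) e h
  exact Subtype.ext (Homeomorph.ext fun e => congrFun h3 e)

/-- A decreasing sequence of systems of small balls in a covering space, invariant under deck
transformations. -/
structure BallSystem (p : C(E, X)) where
  /-- The ball around a point at a given scale. -/
  ball : ℕ → E → Set E
  mem_nhds : ∀ j e, ball j e ∈ 𝓝 e
  image_deck : ∀ (g : deckGroup p) j e, g.1 '' ball j e ⊆ ball j (g.1 e)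
  subset_of_mem : ∀ {j e e'}, e' ∈ ball (j + 1) e → ball (j + 1) e' ⊆ ball j e
  symm_of_mem : ∀ {j e e'}, e' ∈ ball (j + 1) e → e ∈ ball j e'
  contracts : ∀ j e, ContractsIn (ball (j + 1) e) (ball j e)
  injOn : ∀ e, InjOn p (ball 0 e)
  exists_net : ∀ j, ∃ F : Set X, F.Finite ∧ ∀ e, ∃ e', p e' ∈ F ∧ e ∈ ball j e'

/-- The ball around `e` is the sheet through `e` over the neighbourhood of `p e` of the same scale.
Composition and reversal of closeness are inherited from `X` by concatenating and reversing paths.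
-/
theorem BallSystem.nonempty [CompactSpace X] [T2Space X]
    (hX : LocallyContractibleOn (univ : Set X)) (hp : IsCoveringMap p) :
    Nonempty (BallSystem p) := by
  obtain ⟨U, hU, hU', hUc, hU0⟩ := hX.exists_scales
  have hself (j x) : x ∈ U j x := mem_of_mem_nhds (hU j x)
  have hmono (j x) : U (j + 1) x ⊆ U j x := (hU' j x x (hself _ x)).1
  have := hX.locallyPathConnectedSpace
  have : LocallyPathConnectedSpace E := hp.isLocalHomeomorph.locallyPathConnectedSpace
  refine ⟨⟨fun j e => sheetIn p (U j (p e)) e, fun j e => ?_, fun g j e => ?_, ?_, ?_,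
    fun j e => (hUc j _).sheetIn hp (hmono j _) (hself _ _),
    fun e => (hU0 _).injOn_sheetIn hp (hself _ _), fun j => ?_⟩⟩
  · exact pathComponentIn_mem_nhds (p.continuous.continuousAt.preimage_mem_nhds (hU j _))
  · rw [deckGroup_apply]
    exact deck_image_sheetIn_subset g _ e
  · intro j e e' he' a ha
    have h := hU' j (p e) (p e') (sheetIn_subset _ _ he')
    exact JoinedIn.trans (sheetIn_mono (hmono j _) _ he') (sheetIn_mono h.1 _ ha)
  · intro j e e' he'
    have h := hU' j (p e) (p e') (sheetIn_subset _ _ he')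
    exact JoinedIn.symm (sheetIn_mono h.2 _ he')
  -- The cover is taken one scale finer: a point of `U (j + 1) x` can then be joined to `x` inside
  -- `U j x`, and lifting this path from `e` gives the net point.
  · obtain ⟨F, hF⟩ := (isCompact_univ (X := X)).elim_nhds_subcover' (fun x _ => U (j + 1) x)
      fun x _ => hU _ x
    refine ⟨Subtype.val '' (F : Set (univ : Set X)), F.finite_toSet.image _, fun e => ?_⟩
    have hpe : p e ∈ ⋃ x ∈ F, U (j + 1) (x : X) := hF trivial
    obtain ⟨x, hx, hex⟩ := mem_iUnion₂.1 hpe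
    obtain ⟨e', he', hj⟩ := JoinedIn.exists_lift hp
      ((hUc j (x : X)).joinedIn (x := p e) (y := x) hex (hself _ _))
    refine ⟨e', ⟨x, hx, he'.symm⟩, ?_⟩
    rw [he']
    exact hj.symm

end SmallBalls

/-! ### Augmented chains -/

section FaceSets

universe z

/-- An augmented semi-simplicial set; `obj n` is the set of simplices with `n` vertices. -/
structure FaceSet where
  obj : ℕ → Type z
  face : ∀ {n : ℕ}, Fin (n + 1) → obj (n + 1) → obj n
  face_face : ∀ {n : ℕ} (i j : Fin (n + 1)) (x : obj (n + 2)), i ≤ j →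
    face i (face j.succ x) = face j (face i.castSucc x)

namespace FaceSet

/-- The group of chains with `n` vertices. -/
abbrev Chain (K : FaceSet.{z}) (n : ℕ) : Type z := K.obj n →₀ ℤ

/-- The boundary operator. -/
noncomputable def bd (K : FaceSet.{z}) (n : ℕ) : K.Chain (n + 1) →ₗ[ℤ] K.Chain n :=
  Finsupp.linearCombination ℤ fun x =>
    ∑ i : Fin (n + 1), (-1 : ℤ) ^ (i : ℕ) • Finsupp.single (K.face i x) 1

variable (K : FaceSet.{z})

theorem bd_single {n : ℕ} (x : K.obj (n + 1)) : K.bd n (Finsupp.single x 1) =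
    ∑ i : Fin (n + 1), (-1 : ℤ) ^ (i : ℕ) • Finsupp.single (K.face i x) 1 := by
  simp [bd]

theorem bd_bd_single {n : ℕ} (x : K.obj (n + 2)) :
    K.bd n (K.bd (n + 1) (Finsupp.single x 1)) = 0 := by
  rw [bd_single, map_sum]
  simp only [map_smul, bd_single, Finset.smul_sum, smul_smul]
  rw [← Finset.sum_product']
  let P := Fin (n + 2) × Fin (n + 1)
  -- The terms with `i ≤ j` cancel against the remaining ones under `(i, j) ↦ (j + 1, i)`, by the
  -- simplicial identity and the change of sign.
  let S : Finset P := {ij : P | (ij.1 : ℕ) ≤ (ij.2 : ℕ)}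
  rw [Finset.univ_product_univ, ← Finset.sum_add_sum_compl S, ← eq_neg_iff_add_eq_zero,
    ← Finset.sum_neg_distrib]
  let φ : ∀ ij : P, ij ∈ S → P := fun ij hij =>
    (ij.2.succ, Fin.castLT ij.1 (lt_of_le_of_lt (Finset.mem_filter.mp hij).right (Fin.is_lt ij.2)))
  apply Finset.sum_bij φ
  · intro ij hij
    simp_rw [S, φ, Finset.compl_filter, Finset.mem_filter_univ, Fin.val_succ,
      Fin.val_castLT] at hij ⊢
    lia
  · rintro ⟨i, j⟩ hij ⟨i', j'⟩ hij' h
    have h1 : (j.succ : ℕ) = j'.succ := congrArg (fun x : P => (x.1 : ℕ)) h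
    have h2 : (i : ℕ) = i' := congrArg (fun x : P => (x.2 : ℕ)) h
    exact Prod.ext (Fin.ext h2) (Fin.ext (by simpa using h1))
  · rintro ⟨i', j'⟩ hij'
    simp_rw [S, Finset.compl_filter, Finset.mem_filter_univ, not_le] at hij'
    refine ⟨(Fin.castSucc j', i'.pred ?_), ?_, ?_⟩
    · rintro rfl
      simp only [Fin.val_zero, not_lt_zero] at hij'
    · simp only [S, Finset.mem_filter_univ, Fin.val_castSucc, Fin.val_pred]
      lia
    · simp only [φ, Fin.castLT_castSucc, Fin.succ_pred]
  · rintro ⟨i, j⟩ hij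
    simp only [S, Finset.mem_filter_univ] at hij
    simp only [φ, ← neg_smul]
    have h := K.face_face (i.castLT (lt_of_le_of_lt hij j.isLt)) j x hij
    rw [Fin.castSucc_castLT] at h
    rw [h]
    congr 1
    simp only [Fin.val_succ, Fin.val_castLT, pow_succ]
    ring

theorem bd_bd {n : ℕ} (c : K.Chain (n + 2)) : K.bd n (K.bd (n + 1) c) = 0 := by
  induction c using Finsupp.induction_linear with
  | zero => simp
  | add f g hf hg => rw [map_add, map_add, hf, hg, add_zero]
  | single x r =>
    rw [← mul_one r, ← smul_eq_mul, ← Finsupp.smul_single, map_smul, map_smul, bd_bd_single,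
      smul_zero]

variable {K}

theorem bd_mapDomain {L : FaceSet.{w}} {n : ℕ} (f : K.obj n → L.obj n)
    (f' : K.obj (n + 1) → L.obj (n + 1)) (h : ∀ i x, L.face i (f' x) = f (K.face i x))
    (c : K.Chain (n + 1)) :
    L.bd n (Finsupp.mapDomain f' c) = Finsupp.mapDomain f (K.bd n c) := by
  have : L.bd n ∘ₗ Finsupp.lmapDomain ℤ ℤ f' = Finsupp.lmapDomain ℤ ℤ f ∘ₗ K.bd n := by
    refine Finsupp.lhom_ext' fun x => LinearMap.ext_ring ?_
    simp [bd_single, Finsupp.mapDomain_single, h]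
  exact LinearMap.congr_fun this c

/-- Chains supported on a set of simplices. -/
abbrev chainsIn (K : FaceSet.{z}) {n : ℕ} (A : Set (K.obj n)) : Submodule ℤ (K.Chain n) :=
  Finsupp.supported ℤ ℤ A

theorem bd_mem_chainsIn {n : ℕ} {A : Set (K.obj (n + 1))} {A' : Set (K.obj n)}
    (h : ∀ x ∈ A, ∀ i, K.face i x ∈ A') {c : K.Chain (n + 1)} (hc : c ∈ K.chainsIn A) :
    K.bd n c ∈ K.chainsIn A' := by
  rw [chainsIn, Finsupp.supported_eq_span_single] at hc
  induction hc using Submodule.span_induction with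
  | mem c hc =>
    obtain ⟨x, hx, rfl⟩ := hc
    rw [bd_single]
    exact Submodule.sum_mem _ fun i _ => Submodule.smul_mem _ _
      (Finsupp.single_mem_supported ℤ 1 (h x hx i))
  | zero => simp
  | add c c' _ _ h h' => rw [map_add]; exact add_mem h h'
  | smul r c _ h => rw [map_smul]; exact Submodule.smul_mem _ _ h

end FaceSet

theorem Finsupp.linearCombination_mem_of_supported {α M : Type*} [AddCommGroup M] {A : Set α}
    {N : Submodule ℤ M} {f : α → M} (hf : ∀ x ∈ A, f x ∈ N) {c : α →₀ ℤ}
    (hc : c ∈ Finsupp.supported ℤ ℤ A) : Finsupp.linearCombination ℤ f c ∈ N := by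
  rw [Finsupp.linearCombination_apply, Finsupp.sum]
  exact Submodule.sum_mem _ fun x hx => Submodule.smul_mem _ _ (hf x (hc hx))

theorem Fin.succAbove_succ_comp {n : ℕ} {i j : Fin (n + 1)} (h : i ≤ j) :
    j.succ.succAbove ∘ i.succAbove = i.castSucc.succAbove ∘ j.succAbove := by
  funext k
  simp only [Function.comp, Fin.succAbove, Fin.lt_def, Fin.le_def, Fin.ext_iff] at *
  split_ifs <;> simp at * <;> lia

/-- The augmented semi-simplicial set of finite sequences in `P`. -/
def tuples (P : Type z) : FaceSet.{z} where
  obj n := Fin n → P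
  face i q := q ∘ i.succAbove
  face_face i j q h := by rw [Function.comp_assoc, Fin.succAbove_succ_comp h]; rfl

/-- Adding a vertex in front of a sequence. -/
abbrev tupleCons {P : Type z} (b : P) {n : ℕ} (q : (tuples P).obj n) : (tuples P).obj (n + 1) :=
  Fin.cons (α := fun _ => P) b q

/-- The cone operator on chains of sequences. -/
noncomputable def tupleCone {P : Type z} (b : P) (n : ℕ) :
    (tuples P).Chain n →ₗ[ℤ] (tuples P).Chain (n + 1) :=
  Finsupp.lmapDomain ℤ ℤ (tupleCons b)

theorem tupleCone_single {P : Type z} (b : P) {n : ℕ} (q : (tuples P).obj n) :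
    tupleCone b n (Finsupp.single q 1) = Finsupp.single (tupleCons b q) 1 := by
  simp [tupleCone, Finsupp.mapDomain_single]

theorem face_succ_tupleCons {P : Type z} (b : P) {n : ℕ} (q : (tuples P).obj (n + 1))
    (i : Fin (n + 1)) :
    (tuples P).face i.succ (tupleCons b q) = tupleCons b ((tuples P).face i q) := by
  funext k
  change Fin.cons (α := fun _ => P) b q (i.succ.succAbove k) = _
  refine Fin.cases ?_ (fun k => ?_) k
  · rw [Fin.succ_succAbove_zero]; rfl
  · rw [Fin.succ_succAbove_succ]; rfl

/-- Deleting the apex gives back `c`; deleting any other vertex commutes with coning, and the index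
shift reverses the sign. -/
theorem bd_tupleCone_succ {P : Type z} (b : P) {n : ℕ} (c : (tuples P).Chain (n + 1)) :
    (tuples P).bd (n + 1) (tupleCone b (n + 1) c) = c - tupleCone b n ((tuples P).bd n c) := by
  have : (tuples P).bd (n + 1) ∘ₗ tupleCone b (n + 1) =
      LinearMap.id - tupleCone b n ∘ₗ (tuples P).bd n := by
    refine Finsupp.lhom_ext' fun q => LinearMap.ext_ring ?_
    simp only [LinearMap.comp_apply, Finsupp.lsingle_apply, tupleCone_single, FaceSet.bd_single,
      LinearMap.sub_apply, LinearMap.id_apply, map_sum, map_smul]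
    rw [Fin.sum_univ_succ, sub_eq_add_neg, ← Finset.sum_neg_distrib]
    congr 1
    · simp only [Fin.val_zero, pow_zero, one_smul]
      congr 1
    · refine Finset.sum_congr rfl fun i _ => ?_
      rw [Fin.val_succ, pow_succ, mul_neg_one, neg_smul]
      rw [face_succ_tupleCons]
  exact LinearMap.congr_fun this c

end FaceSets

/-! ### Barycentric subdivision of singular simplices -/

section Subdivision

/-- The affine map between standard simplices with the given vertices. -/
noncomputable def simplexComb {n l : ℕ} (q : Fin n → stdSimplex ℝ (Fin l)) :
    C(stdSimplex ℝ (Fin n), stdSimplex ℝ (Fin l)) where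
  toFun s := ⟨∑ i, s.1 i • (q i).1, (convex_stdSimplex ℝ (Fin l)).sum_mem (fun i _ => s.2.1 i)
    s.2.2 fun i _ => (q i).2⟩
  continuous_toFun := Continuous.subtype_mk (continuous_finsetSum _ fun i _ =>
    ((continuous_apply i).comp continuous_subtype_val).smul continuous_const) _

theorem simplexComb_val {n l : ℕ} (q : Fin n → stdSimplex ℝ (Fin l)) (s : stdSimplex ℝ (Fin n)) :
    (simplexComb q s).1 = ∑ i, s.1 i • (q i).1 := rfl

theorem simplexComb_map {m n l : ℕ} (q : Fin n → stdSimplex ℝ (Fin l)) (f : Fin m → Fin n)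
    (s : stdSimplex ℝ (Fin m)) : simplexComb q (stdSimplex.map f s) = simplexComb (q ∘ f) s := by
  apply Subtype.ext
  change ∑ j, (FunOnFinite.linearMap ℝ ℝ f s.1) j • (q j).1 = ∑ j, s.1 j • (q (f j)).1
  classical
  simp only [FunOnFinite.linearMap_apply_apply, Finset.sum_smul]
  rw [← Finset.sum_fiberwise (s := Finset.univ) (g := f) (f := fun j => s.1 j • (q (f j)).1)]
  refine Finset.sum_congr rfl fun j _ => Finset.sum_congr rfl fun l hl => ?_
  rw [(Finset.mem_filter.1 hl).2]

theorem simplexComb_simplexComb {m n l : ℕ} (q : Fin n → stdSimplex ℝ (Fin l))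
    (r : Fin m → stdSimplex ℝ (Fin n)) (s : stdSimplex ℝ (Fin m)) :
    simplexComb q (simplexComb r s) = simplexComb (simplexComb q ∘ r) s := by
  apply Subtype.ext
  simp only [simplexComb_val, Function.comp, Finset.sum_apply, Pi.smul_apply, Finset.sum_smul,
    Finset.smul_sum, smul_smul, smul_eq_mul]
  exact Finset.sum_comm

theorem simplexComb_vertex {n l : ℕ} (q : Fin n → stdSimplex ℝ (Fin l)) (i : Fin n) :
    simplexComb q (stdSimplex.vertex i) = q i := by
  apply Subtype.ext
  simp [simplexComb_val, Pi.single_apply]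

theorem simplexComb_vertices {n : ℕ} (s : stdSimplex ℝ (Fin n)) :
    simplexComb (fun i => stdSimplex.vertex i) s = s := by
  apply Subtype.ext
  simp only [simplexComb_val]
  ext j
  simp [Finset.sum_apply, Pi.single_apply]

/-- The barycenter of a nonempty finite sequence of points of a simplex. -/
noncomputable def tupleBarycenter {n l : ℕ} (q : Fin (n + 1) → stdSimplex ℝ (Fin l)) :
    stdSimplex ℝ (Fin l) :=
  simplexComb q stdSimplex.barycenter

/-- Barycentric subdivision of chains of sequences of points of a simplex. -/
noncomputable def tupleSd (l : ℕ) : ∀ n : ℕ, (tuples (stdSimplex ℝ (Fin l))).Chain n →ₗ[ℤ]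
    (tuples (stdSimplex ℝ (Fin l))).Chain n
  | 0 => LinearMap.id
  | n + 1 => Finsupp.linearCombination ℤ fun q => tupleCone (tupleBarycenter q) n
      (tupleSd l n ((tuples (stdSimplex ℝ (Fin l))).bd n (Finsupp.single q 1)))

/-- The chain homotopy between the identity and barycentric subdivision. -/
noncomputable def tupleSdHomotopy (l : ℕ) : ∀ n : ℕ,
    (tuples (stdSimplex ℝ (Fin l))).Chain n →ₗ[ℤ] (tuples (stdSimplex ℝ (Fin l))).Chain (n + 1)
  | 0 => 0
  | n + 1 => Finsupp.linearCombination ℤ fun q => tupleCone (tupleBarycenter q) (n + 1)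
      (Finsupp.single q 1 -
        tupleSdHomotopy l n ((tuples (stdSimplex ℝ (Fin l))).bd n (Finsupp.single q 1)))

theorem tupleSd_succ_single {l n : ℕ} (q : (tuples (stdSimplex ℝ (Fin l))).obj (n + 1)) :
    tupleSd l (n + 1) (Finsupp.single q 1) = tupleCone (tupleBarycenter q) n
      (tupleSd l n ((tuples (stdSimplex ℝ (Fin l))).bd n (Finsupp.single q 1))) := by
  rw [tupleSd, Finsupp.linearCombination_single, one_smul]

theorem tupleSdHomotopy_succ_single {l n : ℕ} (q : (tuples (stdSimplex ℝ (Fin l))).obj (n + 1)) :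
    tupleSdHomotopy l (n + 1) (Finsupp.single q 1) = tupleCone (tupleBarycenter q) (n + 1)
      (Finsupp.single q 1 -
        tupleSdHomotopy l n ((tuples (stdSimplex ℝ (Fin l))).bd n (Finsupp.single q 1))) := by
  rw [tupleSdHomotopy, Finsupp.linearCombination_single, one_smul]

theorem Finsupp.linearMap_congr {α M : Type*} [AddCommGroup M] {f g : (α →₀ ℤ) →ₗ[ℤ] M}
    (h : ∀ x, f (Finsupp.single x 1) = g (Finsupp.single x 1)) (c : α →₀ ℤ) : f c = g c := by
  have : f = g := Finsupp.lhom_ext' fun x => LinearMap.ext_ring (h x)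
  rw [this]

theorem Finsupp.mapDomain_mem_supported {α β : Type*} {A : Set α} {B : Set β} {f : α → β}
    (hf : Set.MapsTo f A B) {c : α →₀ ℤ} (hc : c ∈ Finsupp.supported ℤ ℤ A) :
    Finsupp.mapDomain f c ∈ Finsupp.supported ℤ ℤ B := by
  have h : Finsupp.lmapDomain ℤ ℤ f c ∈ Finsupp.supported ℤ ℤ (f '' A) := by
    rw [← Finsupp.lmapDomain_supported]
    exact Submodule.mem_map_of_mem hc
  exact Finsupp.supported_mono hf.image_subset h

/-- The homotopy cones `w = q - H∂q` from the barycenter. Inductively `∂w = Sd ∂q`, and the cone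
over `Sd ∂q` is `Sd q`; now apply the boundary formula for a cone. -/
theorem bd_tupleSdHomotopy (l n : ℕ) (c : (tuples (stdSimplex ℝ (Fin l))).Chain (n + 1)) :
    (tuples (stdSimplex ℝ (Fin l))).bd (n + 1) (tupleSdHomotopy l (n + 1) c) =
      c - tupleSd l (n + 1) c -
        tupleSdHomotopy l n ((tuples (stdSimplex ℝ (Fin l))).bd n c) := by
  induction n with
  | zero =>
    refine Finsupp.linearMap_congr (f := (tuples _).bd 1 ∘ₗ tupleSdHomotopy l 1)
      (g := LinearMap.id - tupleSd l 1 - tupleSdHomotopy l 0 ∘ₗ (tuples _).bd 0) (fun q => ?_) c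
    simp only [LinearMap.comp_apply, LinearMap.sub_apply, LinearMap.id_apply]
    rw [tupleSdHomotopy_succ_single, bd_tupleCone_succ, tupleSd_succ_single]
    simp [tupleSdHomotopy, tupleSd]
  | succ n ih =>
    refine Finsupp.linearMap_congr (f := (tuples _).bd (n + 2) ∘ₗ tupleSdHomotopy l (n + 2))
      (g := LinearMap.id - tupleSd l (n + 2) - tupleSdHomotopy l (n + 1) ∘ₗ (tuples _).bd (n + 1))
      (fun q => ?_) c
    simp only [LinearMap.comp_apply, LinearMap.sub_apply, LinearMap.id_apply]
    rw [tupleSdHomotopy_succ_single, bd_tupleCone_succ, tupleSd_succ_single, map_sub, ih,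
      FaceSet.bd_bd, map_zero, sub_zero, sub_sub_cancel]
    abel

/-- The image of a sequence of points under an affine map. -/
noncomputable def tupleImage {l l' : ℕ} (r : (tuples (stdSimplex ℝ (Fin l'))).obj l) {n : ℕ}
    (q : (tuples (stdSimplex ℝ (Fin l))).obj n) : (tuples (stdSimplex ℝ (Fin l'))).obj n :=
  fun i => simplexComb r (q i)

/-- Pushing chains of sequences forward along an affine map. -/
noncomputable abbrev tuplePush {l l' : ℕ} (r : (tuples (stdSimplex ℝ (Fin l'))).obj l) (n : ℕ) :
    (tuples (stdSimplex ℝ (Fin l))).Chain n →ₗ[ℤ] (tuples (stdSimplex ℝ (Fin l'))).Chain n :=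
  Finsupp.lmapDomain ℤ ℤ (tupleImage r)

theorem tuplePush_single {l l' : ℕ} (r : (tuples (stdSimplex ℝ (Fin l'))).obj l) {n : ℕ}
    (q : (tuples (stdSimplex ℝ (Fin l))).obj n) : tuplePush r n (Finsupp.single q 1) =
      Finsupp.single (tupleImage r q) 1 :=
  Finsupp.mapDomain_single

theorem bd_tuplePush {l l' : ℕ} (r : (tuples (stdSimplex ℝ (Fin l'))).obj l) (n : ℕ)
    (c : (tuples (stdSimplex ℝ (Fin l))).Chain (n + 1)) :
    (tuples (stdSimplex ℝ (Fin l'))).bd n (tuplePush r (n + 1) c) =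
      tuplePush r n ((tuples (stdSimplex ℝ (Fin l))).bd n c) :=
  FaceSet.bd_mapDomain (K := tuples (stdSimplex ℝ (Fin l))) (L := tuples (stdSimplex ℝ (Fin l')))
    _ _ (fun _ _ => rfl) c

theorem tupleCone_tuplePush {l l' : ℕ} (r : (tuples (stdSimplex ℝ (Fin l'))).obj l) (n : ℕ)
    (b : stdSimplex ℝ (Fin l)) (c : (tuples (stdSimplex ℝ (Fin l))).Chain n) :
    tupleCone (simplexComb r b) n (tuplePush r n c) = tuplePush r (n + 1) (tupleCone b n c) := by
  refine Finsupp.linearMap_congr (f := tupleCone (simplexComb r b) n ∘ₗ tuplePush r n)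
    (g := tuplePush r (n + 1) ∘ₗ tupleCone b n) (fun q => ?_) c
  rw [LinearMap.comp_apply, LinearMap.comp_apply, tuplePush_single, tupleCone_single,
    tupleCone_single, tuplePush_single]
  congr 1
  funext k
  refine Fin.cases ?_ (fun k => ?_) k <;> rfl

theorem tupleBarycenter_comp {l l' : ℕ} (r : (tuples (stdSimplex ℝ (Fin l'))).obj l) {n : ℕ}
    (q : (tuples (stdSimplex ℝ (Fin l))).obj (n + 1)) :
    tupleBarycenter (tupleImage r q) = simplexComb r (tupleBarycenter q) :=
  (simplexComb_simplexComb r q _).symm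

/-- Affine maps preserve barycenters. This naturality is what allows subdivision of singular
simplices to be defined by subdividing the vertex sequence of the standard simplex. -/
theorem tupleSd_tuplePush {l l' : ℕ} (r : (tuples (stdSimplex ℝ (Fin l'))).obj l) (n : ℕ)
    (c : (tuples (stdSimplex ℝ (Fin l))).Chain n) :
    tupleSd l' n (tuplePush r n c) = tuplePush r n (tupleSd l n c) := by
  induction n with
  | zero => rfl
  | succ n ih =>
    refine Finsupp.linearMap_congr (f := tupleSd l' (n + 1) ∘ₗ tuplePush r (n + 1))
      (g := tuplePush r (n + 1) ∘ₗ tupleSd l (n + 1)) (fun q => ?_) c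
    rw [LinearMap.comp_apply, LinearMap.comp_apply, tuplePush_single, tupleSd_succ_single,
      tupleSd_succ_single, ← tuplePush_single, bd_tuplePush, ih, ← tupleCone_tuplePush,
      ← tupleBarycenter_comp]

theorem tupleSdHomotopy_tuplePush {l l' : ℕ} (r : (tuples (stdSimplex ℝ (Fin l'))).obj l) (n : ℕ)
    (c : (tuples (stdSimplex ℝ (Fin l))).Chain n) :
    tupleSdHomotopy l' n (tuplePush r n c) = tuplePush r (n + 1) (tupleSdHomotopy l n c) := by
  induction n with
  | zero => rw [tupleSdHomotopy, tupleSdHomotopy, LinearMap.zero_apply, LinearMap.zero_apply,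
      map_zero]
  | succ n ih =>
    refine Finsupp.linearMap_congr (f := tupleSdHomotopy l' (n + 1) ∘ₗ tuplePush r (n + 1))
      (g := tuplePush r (n + 2) ∘ₗ tupleSdHomotopy l (n + 1)) (fun q => ?_) c
    rw [LinearMap.comp_apply, LinearMap.comp_apply, tuplePush_single, tupleSdHomotopy_succ_single,
      tupleSdHomotopy_succ_single, ← tuplePush_single, bd_tuplePush, ih, ← map_sub,
      ← tupleCone_tuplePush, ← tupleBarycenter_comp]

/-! ### Mesh of the barycentric subdivision -/

section Mesh

variable {l : ℕ}

theorem dist_simplexComb_le {n : ℕ} {q : Fin n → stdSimplex ℝ (Fin l)} {x : stdSimplex ℝ (Fin l)}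
    {r : ℝ} (h : ∀ j, dist (q j) x ≤ r) (s : stdSimplex ℝ (Fin n)) :
    dist (simplexComb q s) x ≤ r :=
  (convex_closedBall x.1 r).sum_mem (fun i _ => s.2.1 i) s.2.2 fun i _ => h i

/-- The difference of a vertex and the barycenter is the average of the `n + 1` differences of
vertices, one of which is zero. -/
theorem dist_tupleBarycenter_le {n : ℕ} {q : Fin (n + 1) → stdSimplex ℝ (Fin l)} {d : ℝ}
    (h : ∀ i j, dist (q i) (q j) ≤ d) (j : Fin (n + 1)) :
    dist (q j) (tupleBarycenter q) ≤ n / (n + 1) * d := by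
  have hb : (tupleBarycenter q).1 = ∑ i, (n + 1 : ℝ)⁻¹ • (q i).1 := by
    rw [tupleBarycenter, simplexComb_val]
    simp
  have h1 : (q j).1 - (tupleBarycenter q).1 = ∑ i, (n + 1 : ℝ)⁻¹ • ((q j).1 - (q i).1) := by
    rw [hb]
    simp only [smul_sub, Finset.sum_sub_distrib, Finset.sum_const, Finset.card_univ,
      Fintype.card_fin]
    congr 1
    rw [← Nat.cast_smul_eq_nsmul ℝ, smul_smul, Nat.cast_succ, mul_inv_cancel₀ (by positivity),
      one_smul]
  rw [Subtype.dist_eq, dist_eq_norm, h1, Fin.sum_univ_succAbove _ j, sub_self, smul_zero, zero_add]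
  refine (norm_sum_le _ _).trans ?_
  refine (Finset.sum_le_card_nsmul _ _ ((n + 1 : ℝ)⁻¹ * d) fun i _ => ?_).trans ?_
  · rw [norm_smul, Real.norm_of_nonneg (by positivity), ← dist_eq_norm]
    exact mul_le_mul_of_nonneg_left (h j _) (by positivity)
  · rw [Finset.card_univ, Fintype.card_fin, nsmul_eq_mul, div_eq_mul_inv, mul_assoc]

/-- The sequences in the subdivision of `q` stay in the hull of `q`, and their diameter is smaller
by the factor `κ`. -/
theorem tupleSd_mem_chainsIn {n : ℕ} {κ : ℝ} (hκ : ∀ m < n, (m : ℝ) / (m + 1) ≤ κ) {d : ℝ}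
    (hd : 0 ≤ d) (q : (tuples (stdSimplex ℝ (Fin l))).obj n) (hq : ∀ i j, dist (q i) (q j) ≤ d) :
    tupleSd l n (Finsupp.single q 1) ∈ (tuples (stdSimplex ℝ (Fin l))).chainsIn
      {q' | (∀ i j, dist (q' i) (q' j) ≤ κ * d) ∧
        ∀ x r, (∀ j, dist (q j) x ≤ r) → ∀ i, dist (q' i) x ≤ r} := by
  induction n with
  | zero =>
    exact Finsupp.single_mem_supported ℤ 1 ⟨fun i => i.elim0, fun _ _ _ i => i.elim0⟩
  | succ n ih =>
    have hκ0 : 0 ≤ κ := le_trans (by positivity) (hκ n (Nat.lt_succ_self n))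
    rw [tupleSd_succ_single, FaceSet.bd_single, map_sum, map_sum]
    refine Submodule.sum_mem _ fun i _ => ?_
    rw [map_smul, map_smul]
    refine Submodule.smul_mem _ _ ?_
    have h := ih (fun m hm => hκ m (hm.trans (Nat.lt_succ_self n))) (q ∘ i.succAbove)
      fun _ _ => hq _ _
    refine Finsupp.mapDomain_mem_supported (fun q' hq' => ?_) h
    refine ⟨?_, ?_⟩
    -- The hull condition of the induction hypothesis is used with centre the new apex: a ball
    -- around it that contains the vertices of a face contains the subdivision of that face.
    · have hb (k) : dist (q' k) (tupleBarycenter q) ≤ κ * d :=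
        hq'.2 _ _ (fun j => (dist_tupleBarycenter_le hq _).trans
          (mul_le_mul_of_nonneg_right (hκ n (Nat.lt_succ_self n)) hd)) k
      intro j k
      refine Fin.cases ?_ (fun j => ?_) j <;> refine Fin.cases ?_ (fun k => ?_) k
      · exact (dist_self _).trans_le (mul_nonneg hκ0 hd)
      · exact (dist_comm _ _).trans_le (hb k)
      · exact hb j
      · exact hq'.1 j k
    · intro x r hr j
      refine Fin.cases ?_ (fun j => ?_) j
      · exact dist_simplexComb_le hr _
      · exact hq'.2 x r (fun _ => hr _) j

end Mesh

universe z

variable {E : Type z} [TopologicalSpace E]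

/-- The augmented singular simplices of `E`. -/
noncomputable def sing (E : Type z) [TopologicalSpace E] : FaceSet.{z} where
  obj n := C(stdSimplex ℝ (Fin n), E)
  face i σ := σ.comp ⟨stdSimplex.map i.succAbove, stdSimplex.continuous_map _⟩
  face_face i j σ h := by
    ext s
    change σ (stdSimplex.map j.succ.succAbove (stdSimplex.map i.succAbove s)) =
      σ (stdSimplex.map i.castSucc.succAbove (stdSimplex.map j.succAbove s))
    rw [stdSimplex.map_comp_apply, stdSimplex.map_comp_apply, Fin.succAbove_succ_comp h]

/-- A singular simplex as a continuous map. -/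
def singMap {n : ℕ} (σ : (sing E).obj n) : C(stdSimplex ℝ (Fin n), E) := σ

theorem sing_ext {n : ℕ} {σ τ : (sing E).obj n} (h : ∀ s, singMap σ s = singMap τ s) : σ = τ :=
  ContinuousMap.ext h

/-- The points of a singular simplex. -/
def singRange {n : ℕ} (σ : (sing E).obj n) : Set E := Set.range (singMap σ)

theorem singRange_face_subset {n : ℕ} (i : Fin (n + 1)) (σ : (sing E).obj (n + 1)) :
    singRange ((sing E).face i σ) ⊆ singRange σ := by
  rintro _ ⟨s, rfl⟩
  exact ⟨_, rfl⟩

/-- The restriction of a singular simplex along the affine map with given vertices. -/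
noncomputable def singComb {l : ℕ} (σ : (sing E).obj l) {n : ℕ}
    (q : (tuples (stdSimplex ℝ (Fin l))).obj n) : (sing E).obj n :=
  (singMap σ).comp (simplexComb q)

theorem singRange_singComb_subset {l : ℕ} (σ : (sing E).obj l) {n : ℕ}
    (q : (tuples (stdSimplex ℝ (Fin l))).obj n) : singRange (singComb σ q) ⊆ singRange σ := by
  rintro _ ⟨s, rfl⟩
  exact ⟨_, rfl⟩

/-- The chain map induced by `singComb`. -/
noncomputable abbrev singPush {l : ℕ} (σ : (sing E).obj l) (n : ℕ) :
    (tuples (stdSimplex ℝ (Fin l))).Chain n →ₗ[ℤ] (sing E).Chain n :=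
  Finsupp.lmapDomain ℤ ℤ (singComb σ)

theorem singPush_single {l : ℕ} (σ : (sing E).obj l) {n : ℕ}
    (q : (tuples (stdSimplex ℝ (Fin l))).obj n) :
    singPush σ n (Finsupp.single q 1) = Finsupp.single (singComb σ q) 1 :=
  Finsupp.mapDomain_single

theorem bd_singPush {l : ℕ} (σ : (sing E).obj l) (n : ℕ)
    (c : (tuples (stdSimplex ℝ (Fin l))).Chain (n + 1)) :
    (sing E).bd n (singPush σ (n + 1) c) =
      singPush σ n ((tuples (stdSimplex ℝ (Fin l))).bd n c) := by
  refine FaceSet.bd_mapDomain _ _ (fun i q => ?_) c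
  exact sing_ext fun s => congrArg (singMap σ) (simplexComb_map q _ s)

/-- The vertices of the standard simplex. -/
noncomputable def simplexVertices (l : ℕ) : (tuples (stdSimplex ℝ (Fin l))).obj l :=
  fun i => stdSimplex.vertex i

theorem singComb_vertices {l : ℕ} (σ : (sing E).obj l) : singComb σ (simplexVertices l) = σ :=
  sing_ext fun s => congrArg (singMap σ) (simplexComb_vertices s)

theorem tupleImage_vertices {l l' : ℕ} (r : (tuples (stdSimplex ℝ (Fin l'))).obj l) :
    tupleImage r (simplexVertices l) = r :=
  funext fun i => simplexComb_vertex r i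

theorem singPush_singComb {l : ℕ} (σ : (sing E).obj l) {m : ℕ}
    (r : (tuples (stdSimplex ℝ (Fin l))).obj m) (n : ℕ)
    (c : (tuples (stdSimplex ℝ (Fin m))).Chain n) :
    singPush (singComb σ r) n c = singPush σ n (tuplePush r n c) := by
  refine Finsupp.linearMap_congr (f := singPush (singComb σ r) n)
    (g := singPush σ n ∘ₗ tuplePush r n) (fun q => ?_) c
  rw [LinearMap.comp_apply, tuplePush_single, singPush_single, singPush_single]
  congr 1
  exact sing_ext fun s => congrArg (singMap σ)
    (simplexComb_simplexComb r q s)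

/-- Barycentric subdivision of singular chains. -/
noncomputable def singSd (E : Type z) [TopologicalSpace E] (n : ℕ) :
    (sing E).Chain n →ₗ[ℤ] (sing E).Chain n :=
  Finsupp.linearCombination ℤ fun σ =>
    singPush σ n (tupleSd n n (Finsupp.single (simplexVertices n) 1))

/-- The chain homotopy between the identity and barycentric subdivision. -/
noncomputable def singSdHomotopy (E : Type z) [TopologicalSpace E] (n : ℕ) :
    (sing E).Chain n →ₗ[ℤ] (sing E).Chain (n + 1) :=
  Finsupp.linearCombination ℤ fun σ =>
    singPush σ (n + 1) (tupleSdHomotopy n n (Finsupp.single (simplexVertices n) 1))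

theorem singSd_singPush {l : ℕ} (σ : (sing E).obj l) (n : ℕ)
    (c : (tuples (stdSimplex ℝ (Fin l))).Chain n) :
    singSd E n (singPush σ n c) = singPush σ n (tupleSd l n c) := by
  refine Finsupp.linearMap_congr (f := singSd E n ∘ₗ singPush σ n)
    (g := singPush σ n ∘ₗ tupleSd l n) (fun q => ?_) c
  rw [LinearMap.comp_apply, LinearMap.comp_apply, singPush_single, singSd,
    Finsupp.linearCombination_single, one_smul, singPush_singComb, ← tupleSd_tuplePush,
    tuplePush_single, tupleImage_vertices]

theorem singSdHomotopy_singPush {l : ℕ} (σ : (sing E).obj l) (n : ℕ)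
    (c : (tuples (stdSimplex ℝ (Fin l))).Chain n) :
    singSdHomotopy E n (singPush σ n c) = singPush σ (n + 1) (tupleSdHomotopy l n c) := by
  refine Finsupp.linearMap_congr (f := singSdHomotopy E n ∘ₗ singPush σ n)
    (g := singPush σ (n + 1) ∘ₗ tupleSdHomotopy l n) (fun q => ?_) c
  rw [LinearMap.comp_apply, LinearMap.comp_apply, singPush_single, singSdHomotopy,
    Finsupp.linearCombination_single, one_smul, singPush_singComb, ← tupleSdHomotopy_tuplePush,
    tuplePush_single, tupleImage_vertices]

/-- Each singular simplex is the image of the vertex sequence of the standard simplex, so the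
identity is pushed forward from chains of sequences. -/
theorem bd_singSdHomotopy (n : ℕ) (c : (sing E).Chain (n + 1)) :
    (sing E).bd (n + 1) (singSdHomotopy E (n + 1) c) =
      c - singSd E (n + 1) c - singSdHomotopy E n ((sing E).bd n c) := by
  refine Finsupp.linearMap_congr (f := (sing E).bd (n + 1) ∘ₗ singSdHomotopy E (n + 1))
    (g := LinearMap.id - singSd E (n + 1) - singSdHomotopy E n ∘ₗ (sing E).bd n) (fun σ => ?_) c
  simp only [LinearMap.comp_apply, LinearMap.sub_apply, LinearMap.id_apply]
  conv_lhs => rw [← singComb_vertices σ, ← singPush_single, singSdHomotopy_singPush, bd_singPush,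
    bd_tupleSdHomotopy, map_sub, map_sub, ← singSd_singPush, ← singSdHomotopy_singPush,
    ← bd_singPush, singPush_single, singComb_vertices]

/-- The singular simplices contained in one of the sets of a family. -/
def smallSimplices (U : E → Set E) (n : ℕ) : Set ((sing E).obj n) :=
  {σ | ∃ e, singRange σ ⊆ U e}

variable {U : E → Set E}

theorem singPush_mem_chainsIn_small {l : ℕ} {σ : (sing E).obj l} (hσ : σ ∈ smallSimplices U l)
    {n : ℕ} (c : (tuples (stdSimplex ℝ (Fin l))).Chain n) :
    singPush σ n c ∈ (sing E).chainsIn (smallSimplices U n) := by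
  obtain ⟨e, he⟩ := hσ
  refine Finsupp.mapDomain_mem_supported (A := Set.univ)
    (B := smallSimplices U n)
    (fun q _ => show ∃ e, _ from ⟨e, (singRange_singComb_subset σ q).trans he⟩) ?_
  rw [Finsupp.supported_univ]
  exact Submodule.mem_top

theorem bd_mem_small {n : ℕ} {c : (sing E).Chain (n + 1)}
    (hc : c ∈ (sing E).chainsIn (smallSimplices U (n + 1))) :
    (sing E).bd n c ∈ (sing E).chainsIn (smallSimplices U n) :=
  FaceSet.bd_mem_chainsIn (A' := smallSimplices U n) (fun σ hσ i => by
    obtain ⟨e, he⟩ := hσ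
    exact ⟨e, (singRange_face_subset i σ).trans he⟩) hc

theorem singSd_mem_small {n : ℕ} {c : (sing E).Chain n}
    (hc : c ∈ (sing E).chainsIn (smallSimplices U n)) :
    singSd E n c ∈ (sing E).chainsIn (smallSimplices U n) :=
  Finsupp.linearCombination_mem_of_supported (fun _ hσ => singPush_mem_chainsIn_small hσ _) hc

theorem singSdHomotopy_mem_small {n : ℕ} {c : (sing E).Chain n}
    (hc : c ∈ (sing E).chainsIn (smallSimplices U n)) :
    singSdHomotopy E n c ∈ (sing E).chainsIn (smallSimplices U (n + 1)) :=
  Finsupp.linearCombination_mem_of_supported (fun _ hσ => singPush_mem_chainsIn_small hσ _) hc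

theorem tupleSd_iterate_mem {l n : ℕ} {κ : ℝ} (hκ0 : 0 ≤ κ)
    (hκ : ∀ m < n, (m : ℝ) / (m + 1) ≤ κ) {d : ℝ} (hd : 0 ≤ d)
    {q : (tuples (stdSimplex ℝ (Fin l))).obj n} (hq : ∀ i j, dist (q i) (q j) ≤ d) (N : ℕ) :
    (tupleSd l n)^[N] (Finsupp.single q 1) ∈ (tuples (stdSimplex ℝ (Fin l))).chainsIn
      {q' | ∀ i j, dist (q' i) (q' j) ≤ κ ^ N * d} := by
  induction N with
  | zero => exact Finsupp.single_mem_supported ℤ 1 (by simpa using hq)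
  | succ N ih =>
    rw [Function.iterate_succ_apply']
    have key := Finsupp.linearCombination_mem_of_supported (f := fun q =>
      tupleSd l n (Finsupp.single q 1)) (N := (tuples (stdSimplex ℝ (Fin l))).chainsIn
      {q' | ∀ i j, dist (q' i) (q' j) ≤ κ ^ (N + 1) * d}) (fun q' hq' => ?_) ih
    · convert key using 1
      refine Finsupp.linearMap_congr (g := Finsupp.linearCombination ℤ fun q =>
        tupleSd l n (Finsupp.single q 1)) (fun q' => ?_) _
      rw [Finsupp.linearCombination_single, one_smul]
    · refine Finsupp.supported_mono (fun q'' hq'' => ?_)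
        (tupleSd_mem_chainsIn hκ (mul_nonneg (pow_nonneg hκ0 N) hd) q' hq')
      intro i j
      rw [pow_succ', mul_assoc]
      exact hq''.1 i j

/-- After `N` subdivisions the pieces have diameter at most `κ ^ N`, which eventually drops below a
Lebesgue number of the pulled-back cover. -/
theorem exists_singSd_iterate_small (hU : ∀ e, U e ∈ nhds e) [Nonempty E] {n : ℕ}
    (σ : (sing E).obj n) :
    ∃ N, (singSd E n)^[N] (Finsupp.single σ 1) ∈ (sing E).chainsIn (smallSimplices U n) := by
  have hit (N : ℕ) : (singSd E n)^[N] (Finsupp.single σ 1) =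
      singPush σ n ((tupleSd n n)^[N] (Finsupp.single (simplexVertices n) 1)) := by
    induction N with
    | zero => rw [Function.iterate_zero, Function.iterate_zero, id, id, singPush_single,
        singComb_vertices]
    | succ N ih => rw [Function.iterate_succ_apply', ih, singSd_singPush,
        ← Function.iterate_succ_apply' (tupleSd n n)]
  let f : C(stdSimplex ℝ (Fin n), E) := σ
  obtain ⟨δ, hδ, hδU⟩ := lebesgue_number_lemma_of_metric
    (s := (Set.univ : Set (stdSimplex ℝ (Fin n)))) (c := fun e => f ⁻¹' interior (U e))
    isCompact_univ (fun e => isOpen_interior.preimage f.continuous)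
    fun s _ => Set.mem_iUnion.2 ⟨f s, mem_interior_iff_mem_nhds.2 (hU _)⟩
  let κ : ℝ := n / (n + 1)
  have hκ0 : 0 ≤ κ := by positivity
  have hκ1 : κ < 1 := (div_lt_one (by positivity)).2 (by linarith)
  have hκ : ∀ m < n, (m : ℝ) / (m + 1) ≤ κ := fun m hm => by
    rw [div_le_div_iff₀ (by positivity) (by positivity)]
    have : (m : ℝ) ≤ n := by exact_mod_cast hm.le
    nlinarith
  obtain ⟨N, hN⟩ := exists_pow_lt_of_lt_one hδ hκ1
  refine ⟨N, ?_⟩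
  rw [hit]
  refine Finsupp.mapDomain_mem_supported (fun q hq => ?_)
    (tupleSd_iterate_mem hκ0 hκ zero_le_one (q := simplexVertices n) (fun i j => ?_) N)
  · simp only [mul_one, Set.mem_ofPred_eq] at hq
    -- A simplex without vertices is empty and lies in every set of the family, but some point of
    -- `E` is needed to name one.
    rcases Nat.eq_zero_or_pos n with rfl | hn
    · refine ⟨Classical.arbitrary E, ?_⟩
      rintro _ ⟨s, rfl⟩
      have := s.2.2
      simp at this
    · obtain ⟨e, he⟩ := hδU (q ⟨0, hn⟩) trivial
      refine ⟨e, ?_⟩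
      rintro _ ⟨s, rfl⟩
      exact interior_subset (he ((dist_simplexComb_le (fun j => hq j _) s).trans_lt hN))
  · exact (Metric.dist_le_diam_of_mem (bounded_stdSimplex (Fin n)) (Subtype.prop _)
      (Subtype.prop _)).trans diam_stdSimplex_le

/-- A singular chain whose boundary is small is homologous to a small chain. -/
theorem exists_add_bd_mem_small (hU : ∀ e, U e ∈ nhds e) [Nonempty E] {n : ℕ}
    (c : (sing E).Chain (n + 1))
    (hc : (sing E).bd n c ∈ (sing E).chainsIn (smallSimplices U n)) :
    ∃ w, c + (sing E).bd (n + 1) w ∈ (sing E).chainsIn (smallSimplices U (n + 1)) := by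
  have hmono {N N' : ℕ} (h : N ≤ N') {c : (sing E).Chain (n + 1)}
      (hc : (singSd E (n + 1))^[N] c ∈ (sing E).chainsIn (smallSimplices U (n + 1))) :
      (singSd E (n + 1))^[N'] c ∈ (sing E).chainsIn (smallSimplices U (n + 1)) := by
    induction h with
    | refl => exact hc
    | step _ ih => rw [Function.iterate_succ_apply']; exact singSd_mem_small ih
  have hex (c : (sing E).Chain (n + 1)) :
      ∃ N, (singSd E (n + 1))^[N] c ∈ (sing E).chainsIn (smallSimplices U (n + 1)) := by
    induction c using Finsupp.induction_linear with
    | zero => exact ⟨0, zero_mem _⟩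
    | add c c' h h' =>
      obtain ⟨N, h⟩ := h
      obtain ⟨N', h'⟩ := h'
      refine ⟨max N N', ?_⟩
      rw [← Module.End.coe_pow, map_add, Module.End.coe_pow]
      exact add_mem (hmono (le_max_left _ _) h) (hmono (le_max_right _ _) h')
    | single σ r =>
      obtain ⟨N, h⟩ := exists_singSd_iterate_small hU σ
      refine ⟨N, ?_⟩
      rw [← mul_one r, ← smul_eq_mul, ← Finsupp.smul_single, ← Module.End.coe_pow, map_smul,
        Module.End.coe_pow]
      exact Submodule.smul_mem _ _ h
  obtain ⟨N, hN⟩ := hex c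
  -- One subdivision at a time: `Sd c` differs from `c` by a boundary and by `H∂c`, which is small
  -- together with `∂c`.
  induction N generalizing c with
  | zero => exact ⟨0, by simpa using hN⟩
  | succ N ih =>
    have h1 := bd_singSdHomotopy n c
    have h2 : (sing E).bd n (singSd E (n + 1) c) ∈
        (sing E).chainsIn (smallSimplices U n) := by
      have h3 := congrArg ((sing E).bd n) h1
      rw [FaceSet.bd_bd, map_sub, map_sub] at h3
      have h4 : (sing E).bd n (singSd E (n + 1) c) = (sing E).bd n c -
          (sing E).bd n (singSdHomotopy E n ((sing E).bd n c)) := by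
        rw [sub_right_comm, eq_comm, sub_eq_zero] at h3
        exact h3.symm
      rw [h4]
      exact sub_mem hc (bd_mem_small (singSdHomotopy_mem_small hc))
    obtain ⟨w, hw⟩ := ih (singSd E (n + 1) c) h2 hN
    -- With this choice the sum equals `Sd c + ∂w + H∂c`.
    refine ⟨w - singSdHomotopy E (n + 1) c, ?_⟩
    rw [map_sub, h1]
    have := add_mem hw (singSdHomotopy_mem_small hc)
    convert this using 1
    abel

end Subdivision

/-! ### Cones over singular simplices -/

section Cones

open Set

theorem Finsupp.linearMap_eqOn_supported {α M : Type*} [AddCommGroup M] {A : Set α}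
    {f g : (α →₀ ℤ) →ₗ[ℤ] M} (h : ∀ x ∈ A, f (Finsupp.single x 1) = g (Finsupp.single x 1))
    {c : α →₀ ℤ} (hc : c ∈ Finsupp.supported ℤ ℤ A) : f c = g c := by
  rw [Finsupp.supported_eq_span_single] at hc
  refine LinearMap.eqOn_span (f := f) (g := g) ?_ hc
  rintro _ ⟨x, hx, rfl⟩
  exact h x hx

/-- The projection of a point of a simplex, other than the first vertex, to the opposite face. -/
noncomputable def stdSimplex.rest {n : ℕ} (s : stdSimplex ℝ (Fin (n + 1))) (h : s.1 0 < 1) :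
    stdSimplex ℝ (Fin n) :=
  ⟨fun i => s.1 i.succ / (1 - s.1 0), fun i => div_nonneg (s.2.1 _) (by linarith), by
    rw [← Finset.sum_div, div_eq_one_iff_eq (by linarith)]
    have := s.2.2
    rw [Fin.sum_univ_succ] at this
    linarith⟩

/-- The point of a simplex with given first coordinate and given projection to the opposite
face. -/
noncomputable def stdSimplex.join {n : ℕ} (x : stdSimplex ℝ (Fin n) × Icc (0 : ℝ) 1) :
    stdSimplex ℝ (Fin (n + 1)) :=
  ⟨Fin.cons (α := fun _ => ℝ) x.2.1 fun i => (1 - x.2.1) * x.1.1 i, fun i => by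
    refine Fin.cases x.2.2.1 (fun i => ?_) i
    exact mul_nonneg (by linarith [x.2.2.2]) (x.1.2.1 i), by
    rw [Fin.sum_univ_succ]
    simp only [Fin.cons_zero, Fin.cons_succ, ← Finset.mul_sum, x.1.2.2]
    ring⟩

theorem stdSimplex.continuous_join {n : ℕ} : Continuous (stdSimplex.join (n := n)) := by
  refine Continuous.subtype_mk (continuous_pi fun i => ?_) _
  refine Fin.cases ?_ (fun i => ?_) i
  · exact continuous_subtype_val.comp continuous_snd
  · have h1 : Continuous fun x : stdSimplex ℝ (Fin n) × Icc (0 : ℝ) 1 => x.1.1 i :=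
      (continuous_apply i).comp (continuous_subtype_val.comp continuous_fst)
    have h2 : Continuous fun x : stdSimplex ℝ (Fin n) × Icc (0 : ℝ) 1 => x.2.1 :=
      continuous_subtype_val.comp continuous_snd
    exact (continuous_const.sub h2).mul h1

theorem stdSimplex.join_rest {n : ℕ} (s : stdSimplex ℝ (Fin (n + 1))) (h : s.1 0 < 1) :
    stdSimplex.join (stdSimplex.rest s h, ⟨s.1 0, s.2.1 0, h.le⟩) = s := by
  refine Subtype.ext (funext fun i => ?_)
  refine Fin.cases rfl (fun i => ?_) i
  change (1 - s.1 0) * (s.1 i.succ / (1 - s.1 0)) = s.1 i.succ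
  field_simp [show (1 - s.1 0) ≠ 0 by linarith]

theorem stdSimplex.rest_join {n : ℕ} (x : stdSimplex ℝ (Fin n) × Icc (0 : ℝ) 1)
    (h : (stdSimplex.join x).1 0 < 1) : stdSimplex.rest (stdSimplex.join x) h = x.1 := by
  refine Subtype.ext (funext fun i => ?_)
  have h : x.2.1 < 1 := h
  change ((1 - x.2.1) * x.1.1 i) / (1 - x.2.1) = x.1.1 i
  field_simp [show (1 - x.2.1) ≠ 0 by linarith]

theorem stdSimplex.coord_eq_zero {n : ℕ} (s : stdSimplex ℝ (Fin (n + 1))) (h : ¬ s.1 0 < 1)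
    (i : Fin n) : s.1 i.succ = 0 := by
  have h1 := s.2.2
  rw [Fin.sum_univ_succ] at h1
  have h2 : s.1 i.succ ≤ ∑ i : Fin n, s.1 i.succ :=
    Finset.single_le_sum (f := fun i : Fin n => s.1 i.succ) (fun i _ => s.2.1 _)
      (Finset.mem_univ i)
  linarith [s.2.1 i.succ]

theorem stdSimplex.join_surjective {n : ℕ} :
    Function.Surjective (stdSimplex.join (n := n + 1)) := fun s => by
  by_cases h : s.1 0 < 1
  · exact ⟨_, stdSimplex.join_rest s h⟩
  -- The apex comes from any point of the base at parameter `1`; this is where the base has to be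
  -- nonempty.
  · refine ⟨(stdSimplex.vertex 0, ⟨1, by simp⟩), Subtype.ext (funext fun i => ?_)⟩
    refine Fin.cases ?_ (fun i => ?_) i
    · change 1 = s.1 0
      have := (mem_Icc_of_mem_stdSimplex s.2 0).2
      linarith
    · change (1 - (1 : ℝ)) * _ = _
      rw [stdSimplex.coord_eq_zero s h]
      simp

theorem stdSimplex.map_succ_succAbove_zero {n : ℕ} (i : Fin (n + 1))
    (s : stdSimplex ℝ (Fin (n + 1))) : (stdSimplex.map i.succ.succAbove s).1 0 = s.1 0 := by
  change (FunOnFinite.linearMap ℝ ℝ _ s.1) 0 = _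
  rw [FunOnFinite.linearMap_apply_apply, Finset.sum_filter, Fin.sum_univ_succ]
  simp [Fin.succ_succAbove_succ, Fin.succ_ne_zero]

theorem stdSimplex.map_succ_succAbove_succ {n : ℕ} (i : Fin (n + 1))
    (s : stdSimplex ℝ (Fin (n + 1))) (j : Fin (n + 1)) :
    (stdSimplex.map i.succ.succAbove s).1 j.succ = ∑ x with i.succAbove x = j, s.1 x.succ := by
  change (FunOnFinite.linearMap ℝ ℝ _ s.1) _ = _
  rw [FunOnFinite.linearMap_apply_apply, Finset.sum_filter, Fin.sum_univ_succ, Finset.sum_filter]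
  simp [Fin.succ_succAbove_succ, (Fin.succ_ne_zero _).symm]

theorem stdSimplex.map_zero_succAbove_zero {n : ℕ} (s : stdSimplex ℝ (Fin n)) :
    (stdSimplex.map (Fin.succAbove 0) s).1 0 = 0 := by
  change (FunOnFinite.linearMap ℝ ℝ _ s.1) 0 = _
  rw [FunOnFinite.linearMap_apply_apply]
  simp [Fin.succ_ne_zero]

theorem stdSimplex.map_zero_succAbove_succ {n : ℕ} (s : stdSimplex ℝ (Fin n)) (j : Fin n) :
    (stdSimplex.map (Fin.succAbove 0) s).1 j.succ = s.1 j := by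
  change (FunOnFinite.linearMap ℝ ℝ _ s.1) _ = _
  rw [FunOnFinite.linearMap_apply_apply, Finset.sum_filter]
  simp

theorem stdSimplex.rest_map_zero {n : ℕ} (s : stdSimplex ℝ (Fin n))
    (h : (stdSimplex.map (Fin.succAbove 0) s).1 0 < 1) :
    stdSimplex.rest (stdSimplex.map (Fin.succAbove 0) s) h = s := by
  refine Subtype.ext (funext fun i => ?_)
  change (stdSimplex.map (Fin.succAbove 0) s).1 i.succ /
    (1 - (stdSimplex.map (Fin.succAbove 0) s).1 0) = _
  rw [stdSimplex.map_zero_succAbove_succ, stdSimplex.map_zero_succAbove_zero, sub_zero, div_one]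

theorem stdSimplex.rest_map_succ {n : ℕ} (i : Fin (n + 1)) (s : stdSimplex ℝ (Fin (n + 1)))
    (hs : s.1 0 < 1) (h : (stdSimplex.map i.succ.succAbove s).1 0 < 1) :
    stdSimplex.rest (stdSimplex.map i.succ.succAbove s) h =
      stdSimplex.map i.succAbove (stdSimplex.rest s hs) := by
  refine Subtype.ext (funext fun j => ?_)
  change (stdSimplex.map i.succ.succAbove s).1 j.succ /
    (1 - (stdSimplex.map i.succ.succAbove s).1 0) = (FunOnFinite.linearMap ℝ ℝ _ _) j
  rw [FunOnFinite.linearMap_apply_apply, stdSimplex.map_succ_succAbove_succ,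
    stdSimplex.map_succ_succAbove_zero, Finset.sum_div]
  rfl

universe z

variable {E : Type z} [TopologicalSpace E]

/-- The singular simplices in a subspace. -/
def simplicesIn (A : Set E) (n : ℕ) : Set ((sing E).obj n) := {σ | singRange σ ⊆ A}

variable (H : E × ℝ → E) (c : E)

open Classical in
/-- The cone over a singular simplex, with apex `c`, along a contraction. -/
noncomputable def coneFun {n : ℕ} (σ : (sing E).obj n) (s : stdSimplex ℝ (Fin (n + 1))) : E :=
  if h : s.1 0 < 1 then H (singMap σ (stdSimplex.rest s h), s.1 0) else c

variable {H c} {A B : Set E}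

/-- Join coordinates are a quotient map because the source is compact, and in them the cone is `H (σ
x, t)`, also at `t = 1` where the base collapses. Over the empty simplex the join has empty source,
so the one-point cone is treated separately. -/
theorem continuous_coneFun (hH : ContinuousOn H (A ×ˢ Icc 0 1)) (h1 : ∀ a ∈ A, H (a, 1) = c)
    {n : ℕ} {σ : (sing E).obj n} (hσ : σ ∈ simplicesIn A n) : Continuous (coneFun H c σ) := by
  cases n with
  | zero =>
    have : Subsingleton (stdSimplex ℝ (Fin (0 + 1))) := ⟨fun s t => Subtype.ext (funext fun i => by
      have hs := s.2.2
      have ht := t.2.2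
      rw [Fin.sum_univ_succ, Fin.sum_univ_zero, add_zero] at hs ht
      have hi : i = 0 := Fin.eq_zero i
      rw [hi, hs, ht])⟩
    exact continuous_of_const fun s t => by rw [Subsingleton.elim s t]
  | succ n =>
    have hq : Topology.IsQuotientMap (stdSimplex.join (n := n + 1)) :=
      stdSimplex.continuous_join.isClosedMap.isQuotientMap stdSimplex.continuous_join
        stdSimplex.join_surjective
    rw [hq.continuous_iff]
    have : coneFun H c σ ∘ stdSimplex.join = fun x => H (singMap σ x.1, x.2.1) := by
      funext x
      change coneFun H c σ (stdSimplex.join x) = _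
      by_cases h : (stdSimplex.join x).1 0 < 1
      · rw [coneFun, dif_pos h, stdSimplex.rest_join]
        rfl
      · rw [coneFun, dif_neg h]
        have h : ¬ x.2.1 < 1 := h
        rw [le_antisymm x.2.2.2 (not_lt.1 h), h1 _ (hσ ⟨_, rfl⟩)]
    rw [this]
    refine hH.comp_continuous ?_ fun x => ⟨hσ ⟨_, rfl⟩, x.2.2⟩
    exact ((singMap σ).continuous.comp continuous_fst).prodMk
      (continuous_subtype_val.comp continuous_snd)

open Classical in
/-- The cone over a singular simplex, as a singular simplex. -/
noncomputable def coneSimplex (H : E × ℝ → E) (c : E) {n : ℕ} (σ : (sing E).obj n) :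
    (sing E).obj (n + 1) :=
  -- The constant simplex only serves to make the operator total; simplices in the contracted set
  -- never need it.
  (if h : Continuous (coneFun H c σ) then ⟨coneFun H c σ, h⟩ else ContinuousMap.const _ c :
    C(stdSimplex ℝ (Fin (n + 1)), E))

open Classical in
theorem singMap_coneSimplex {n : ℕ} {σ : (sing E).obj n} (h : Continuous (coneFun H c σ))
    (s : stdSimplex ℝ (Fin (n + 1))) : singMap (coneSimplex H c σ) s = coneFun H c σ s := by
  change (if h : Continuous (coneFun H c σ) then ⟨coneFun H c σ, h⟩ else ContinuousMap.const _ c :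
    C(stdSimplex ℝ (Fin (n + 1)), E)) s = _
  rw [dif_pos h]
  rfl

theorem singMap_face {n : ℕ} (i : Fin (n + 1)) (σ : (sing E).obj (n + 1))
    (s : stdSimplex ℝ (Fin n)) :
    singMap ((sing E).face i σ) s = singMap σ (stdSimplex.map i.succAbove s) := rfl

theorem face_zero_coneSimplex (h0 : ∀ a ∈ A, H (a, 0) = a) {n : ℕ} {σ : (sing E).obj n}
    (hσ : σ ∈ simplicesIn A n) (h : Continuous (coneFun H c σ)) :
    (sing E).face 0 (coneSimplex H c σ) = σ := by
  refine sing_ext fun s => ?_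
  have h1 := stdSimplex.map_zero_succAbove_zero s
  rw [singMap_face, singMap_coneSimplex h, coneFun, dif_pos (h1.trans_lt one_pos),
    stdSimplex.rest_map_zero]
  exact (congrArg (fun t => H (singMap σ s, t)) h1).trans (h0 _ (hσ ⟨_, rfl⟩))

theorem face_succ_coneSimplex {n : ℕ} (i : Fin (n + 1)) {σ : (sing E).obj (n + 1)}
    (h : Continuous (coneFun H c σ)) (h' : Continuous (coneFun H c ((sing E).face i σ))) :
    (sing E).face i.succ (coneSimplex H c σ) = coneSimplex H c ((sing E).face i σ) := by
  refine sing_ext fun s => ?_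
  have h1 := stdSimplex.map_succ_succAbove_zero i s
  rw [singMap_face, singMap_coneSimplex h, singMap_coneSimplex h']
  by_cases hs : s.1 0 < 1
  · rw [coneFun, coneFun, dif_pos hs, dif_pos (h1.trans_lt hs),
      stdSimplex.rest_map_succ i s hs]
    exact congrArg (fun t => H (_, t)) h1
  · rw [coneFun, coneFun, dif_neg hs, dif_neg (h1 ▸ hs)]

theorem coneSimplex_mem (hB : ∀ a ∈ A, ∀ s ∈ Icc (0 : ℝ) 1, H (a, s) ∈ B) (hc : c ∈ B) {n : ℕ}
    {σ : (sing E).obj n} (hσ : σ ∈ simplicesIn A n) (h : Continuous (coneFun H c σ)) :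
    coneSimplex H c σ ∈ simplicesIn B (n + 1) := by
  rintro _ ⟨s, rfl⟩
  rw [singMap_coneSimplex h, coneFun]
  split_ifs with hs
  · exact hB _ (hσ ⟨_, rfl⟩) _ ⟨s.2.1 0, hs.le⟩
  · exact hc

/-- The cone operator on singular chains. -/
noncomputable def coneChain (H : E × ℝ → E) (c : E) (n : ℕ) :
    (sing E).Chain n →ₗ[ℤ] (sing E).Chain (n + 1) :=
  Finsupp.lmapDomain ℤ ℤ (coneSimplex H c)

theorem coneChain_single {n : ℕ} (σ : (sing E).obj n) :
    coneChain H c n (Finsupp.single σ 1) = Finsupp.single (coneSimplex H c σ) 1 := by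
  simp [coneChain, Finsupp.mapDomain_single]

theorem face_mem_simplicesIn {n : ℕ} {σ : (sing E).obj (n + 1)} (hσ : σ ∈ simplicesIn A (n + 1))
    (i : Fin (n + 1)) : (sing E).face i σ ∈ simplicesIn A n :=
  (singRange_face_subset i σ).trans hσ

/-- Chains of empty simplices in a contractible set bound. -/
theorem ContractsIn.exists_bd_zero (h : ContractsIn A B) (hA : A.Nonempty)
    (z : (sing E).Chain 0) :
    ∃ w ∈ (sing E).chainsIn (simplicesIn B 1), (sing E).bd 0 w = z := by
  obtain ⟨c, H, hH, hB, h0, h1⟩ := h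
  have hc : c ∈ B := h1 _ hA.some_mem ▸ hB _ hA.some_mem 1 (by simp)
  have hs (σ : (sing E).obj 0) : σ ∈ simplicesIn A 0 := by
    rintro _ ⟨s, rfl⟩
    have := s.2.2
    simp at this
  have hcont (σ : (sing E).obj 0) := continuous_coneFun hH h1 (hs σ)
  refine ⟨coneChain H c 0 z, Finsupp.mapDomain_mem_supported (A := univ)
    (fun σ _ => coneSimplex_mem hB hc (hs σ) (hcont σ)) ?_, ?_⟩
  · rw [Finsupp.supported_univ]
    exact Submodule.mem_top
  · refine Finsupp.linearMap_congr (f := (sing E).bd 0 ∘ₗ coneChain H c 0) (g := LinearMap.id)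
      (fun σ => ?_) z
    rw [LinearMap.comp_apply, coneChain_single, FaceSet.bd_single, Fin.sum_univ_succ,
      Fin.sum_univ_zero, Fin.val_zero, pow_zero, one_smul, add_zero,
      face_zero_coneSimplex h0 (hs σ) (hcont σ)]
    rfl

/-- Cycles in a contractible set bound. -/
theorem ContractsIn.exists_bd_succ (h : ContractsIn A B) (hA : A.Nonempty) {n : ℕ}
    {z : (sing E).Chain (n + 1)} (hz : z ∈ (sing E).chainsIn (simplicesIn A (n + 1)))
    (hbd : (sing E).bd n z = 0) :
    ∃ w ∈ (sing E).chainsIn (simplicesIn B (n + 2)), (sing E).bd (n + 1) w = z := by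
  obtain ⟨c, H, hH, hB, h0, h1⟩ := h
  have hc : c ∈ B := h1 _ hA.some_mem ▸ hB _ hA.some_mem 1 (by simp)
  refine ⟨coneChain H c (n + 1) z, Finsupp.mapDomain_mem_supported
    (fun σ hσ => coneSimplex_mem hB hc hσ (continuous_coneFun hH h1 hσ)) hz, ?_⟩
  -- The face opposite the apex is the original simplex, as `H` starts at the identity; the other
  -- faces are cones over faces.
  have key : (sing E).bd (n + 1) (coneChain H c (n + 1) z) =
      z - coneChain H c n ((sing E).bd n z) := by
    refine Finsupp.linearMap_eqOn_supported (f := (sing E).bd (n + 1) ∘ₗ coneChain H c (n + 1))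
      (g := LinearMap.id - coneChain H c n ∘ₗ (sing E).bd n) (fun σ hσ => ?_) hz
    have hcont := continuous_coneFun hH h1 hσ
    simp only [LinearMap.comp_apply, LinearMap.sub_apply, LinearMap.id_apply]
    rw [coneChain_single, FaceSet.bd_single, FaceSet.bd_single, Fin.sum_univ_succ, map_sum,
      sub_eq_add_neg, ← Finset.sum_neg_distrib, Fin.val_zero, pow_zero, one_smul,
      face_zero_coneSimplex h0 hσ hcont]
    congr 1
    refine Finset.sum_congr rfl fun i _ => ?_
    rw [Fin.val_succ, pow_succ, mul_neg_one, neg_smul, map_smul, coneChain_single,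
      face_succ_coneSimplex i hcont (continuous_coneFun hH h1 (face_mem_simplicesIn hσ i))]
  rw [key, hbd, map_zero, sub_zero]

end Cones

/-! ### Equivariant chain maps -/

section Equivariant

universe z z'

/-- Equivariant choice on a free `G`-set. -/
theorem exists_equivariant_choice {G α β : Type*} [Group G] (act : G → α → α)
    (hone : ∀ x, act 1 x = x) (hmul : ∀ g g' x, act (g * g') x = act g (act g' x))
    (hfree : ∀ g g' x, act g x = act g' x → g = g') (act' : G → β → β)
    (hmul' : ∀ g g' x, act' (g * g') x = act' g (act' g' x)) (P : α → β → Prop)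
    (hP : ∀ g x y, P x y → P (act g x) (act' g y)) (h : ∀ x, ∃ y, P x y) :
    ∃ f : α → β, (∀ g x, f (act g x) = act' g (f x)) ∧ ∀ x, P x (f x) := by
  let r : Setoid α :=
    { r x y := ∃ g, act g x = y
      iseqv :=
        { refl x := ⟨1, hone x⟩
          symm := by
            rintro x y ⟨g, rfl⟩
            exact ⟨g⁻¹, by rw [← hmul, inv_mul_cancel, hone]⟩
          trans := by
            rintro x y w ⟨g, rfl⟩ ⟨g', rfl⟩
            exact ⟨g' * g, hmul g' g x⟩ } }
  let o (x : α) : α := (Quotient.mk r x).out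
  have ho (x : α) : ∃ g, act g (o x) = x := Quotient.mk_out (s := r) x
  have ho' (g : G) (x : α) : o (act g x) = o x :=
    congrArg Quotient.out (Quotient.sound (s := r) ⟨g, rfl⟩).symm
  choose c hc using ho
  choose l hl using h
  -- Choose a value at one representative of each orbit and transport it. Freeness makes the
  -- transporting element unique, hence equivariant in `x`.
  refine ⟨fun x => act' (c x) (l (o x)), fun g x => ?_, fun x => ?_⟩
  · have h : c (act g x) = g * c x := by
      apply hfree _ _ (o x)
      rw [hmul, hc]
      conv_lhs => rw [← ho' g x]
      exact hc _
    change act' (c (act g x)) (l (o (act g x))) = _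
    rw [h, ho', hmul']
  · have := hP (c x) _ _ (hl (o x))
    rwa [hc] at this

namespace FaceSet

/-- An action of a group on an augmented semi-simplicial set. -/
structure Action (G : Type*) [Group G] (K : FaceSet.{z}) where
  act : ∀ {n : ℕ}, G → K.obj n → K.obj n
  one_act : ∀ {n : ℕ} (x : K.obj n), act 1 x = x
  mul_act : ∀ {n : ℕ} (g g' : G) (x : K.obj n), act (g * g') x = act g (act g' x)
  face_act : ∀ {n : ℕ} (g : G) (i : Fin (n + 1)) (x : K.obj (n + 1)),
    K.face i (act g x) = act g (K.face i x)

variable {G : Type*} [Group G] {K : FaceSet.{z}} {L : FaceSet.{z'}} (A : K.Action G)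
  (A' : L.Action G)

/-- The simplices with `n` vertices are permuted freely. -/
def Action.FreeAt (n : ℕ) : Prop := ∀ (g g' : G) (x : K.obj n), A.act g x = A.act g' x → g = g'

/-- The action on chains. -/
noncomputable def Action.push (g : G) (n : ℕ) : K.Chain n →ₗ[ℤ] K.Chain n :=
  Finsupp.lmapDomain ℤ ℤ (A.act g)

theorem Action.push_single (g : G) {n : ℕ} (x : K.obj n) :
    A.push g n (Finsupp.single x 1) = Finsupp.single (A.act g x) 1 := by
  simp [Action.push, Finsupp.mapDomain_single]

theorem Action.bd_push (g : G) (n : ℕ) (c : K.Chain (n + 1)) :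
    K.bd n (A.push g (n + 1) c) = A.push g n (K.bd n c) :=
  bd_mapDomain _ _ (fun i x => A.face_act g i x) c

theorem Action.push_push (g g' : G) (n : ℕ) (c : K.Chain n) :
    A.push g n (A.push g' n c) = A.push (g * g') n c := by
  refine Finsupp.linearMap_congr (f := A.push g n ∘ₗ A.push g' n) (fun x => ?_) c
  rw [LinearMap.comp_apply, A.push_single, A.push_single, A.push_single, A.mul_act]

/-- Linear maps between chains that commute with the action. -/
def Action.IsEquivariant {m n : ℕ} (f : K.Chain n →ₗ[ℤ] L.Chain m) : Prop :=
  ∀ g c, f (A.push g n c) = A'.push g m (f c)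

variable {A A'}

theorem Action.isEquivariant_of_single {m n : ℕ} {f : K.Chain n →ₗ[ℤ] L.Chain m}
    (h : ∀ g x, f (Finsupp.single (A.act g x) 1) = A'.push g m (f (Finsupp.single x 1))) :
    A.IsEquivariant A' f := fun g c => by
  refine Finsupp.linearMap_congr (f := f ∘ₗ A.push g n) (g := A'.push g m ∘ₗ f) (fun x => ?_) c
  rw [LinearMap.comp_apply, A.push_single, h]
  rfl

/-- Equivariant choice of the values of an equivariant map on a free basis. -/
theorem Action.exists_linearMap {m n : ℕ} (hA : A.FreeAt n) (P : K.obj n → L.Chain m → Prop)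
    (hP : ∀ g x y, P x y → P (A.act g x) (A'.push g m y)) (h : ∀ x, ∃ y, P x y) :
    ∃ f : K.Chain n →ₗ[ℤ] L.Chain m, A.IsEquivariant A' f ∧ ∀ x, P x (f (Finsupp.single x 1)) := by
  obtain ⟨f, hf, hf'⟩ := exists_equivariant_choice A.act A.one_act A.mul_act hA
    (fun g => A'.push g m) (fun g g' c => (A'.push_push g g' m c).symm) P hP h
  have hf'' (x : K.obj n) : Finsupp.linearCombination ℤ f (Finsupp.single x 1) = f x := by
    rw [Finsupp.linearCombination_single, one_smul]
  refine ⟨Finsupp.linearCombination ℤ f, isEquivariant_of_single fun g x => ?_, fun x => ?_⟩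
  · rw [hf'', hf'', hf]
  · rw [hf'']
    exact hf' x

theorem Action.IsEquivariant.comp {K₃ : FaceSet.{w}} {A₃ : K₃.Action G} {l m n : ℕ}
    {f : K.Chain n →ₗ[ℤ] L.Chain m} {f' : L.Chain m →ₗ[ℤ] K₃.Chain l}
    (hf' : A'.IsEquivariant A₃ f') (hf : A.IsEquivariant A' f) : A.IsEquivariant A₃ (f' ∘ₗ f) :=
  fun g c => by rw [LinearMap.comp_apply, hf, hf', LinearMap.comp_apply]

theorem Action.IsEquivariant.add {m n : ℕ} {f f' : K.Chain n →ₗ[ℤ] L.Chain m}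
    (hf : A.IsEquivariant A' f) (hf' : A.IsEquivariant A' f') : A.IsEquivariant A' (f + f') :=
  fun g c => by rw [LinearMap.add_apply, hf, hf', LinearMap.add_apply, map_add]

/-- A chain without boundary; there is no condition on chains of empty simplices. -/
def IsCycle : ∀ {n : ℕ}, K.Chain n → Prop
  | 0, _ => True
  | n + 1, c => K.bd n c = 0

end FaceSet

/-- Dependent choice for maps built degree by degree: `Q` carries what is needed to extend, `R` is
the relation between consecutive degrees, and `P` keeps information about the initial term. -/
theorem exists_seq_of_step {F : ℕ → Type*} (Q : ∀ n, F n → Prop)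
    (R : ∀ n, F n → F (n + 1) → Prop) (h0 : ∃ f, Q 0 f)
    (hs : ∀ n f, Q n f → ∃ f', Q (n + 1) f' ∧ R n f f') (P : F 0 → Prop) (hP : ∀ f, Q 0 f → P f) :
    ∃ f : ∀ n, F n, P (f 0) ∧ ∀ n, Q n (f n) ∧ R n (f n) (f (n + 1)) := by
  choose s hs1 hs2 using hs
  obtain ⟨f0, h0⟩ := h0
  let f : ∀ n, {f : F n // Q n f} := fun n =>
    Nat.rec ⟨f0, h0⟩ (fun n f => ⟨s n f.1 f.2, hs1 n f.1 f.2⟩) n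
  exact ⟨fun n => (f n).1, hP _ (f 0).2, fun n => ⟨(f n).2, hs2 n (f n).1 (f n).2⟩⟩

theorem ContractsIn.exists_bd {E : Type z} [TopologicalSpace E] {A B : Set E}
    (h : ContractsIn A B) (hA : A.Nonempty) {n : ℕ} {z : (sing E).Chain n}
    (hz : z ∈ (sing E).chainsIn (simplicesIn A n)) (hbd : FaceSet.IsCycle z) :
    ∃ w ∈ (sing E).chainsIn (simplicesIn B (n + 1)), (sing E).bd n w = z := by
  cases n with
  | zero => exact h.exists_bd_zero hA z
  | succ n => exact h.exists_bd_succ hA hz hbd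

variable {E : Type z} [TopologicalSpace E] {G : Subgroup (E ≃ₜ E)}

/-- The action of a group of homeomorphisms on singular simplices. -/
noncomputable def singAction (G : Subgroup (E ≃ₜ E)) : (sing E).Action G where
  act g σ := (g.1 : C(E, E)).comp σ
  one_act _ := rfl
  mul_act _ _ _ := rfl
  face_act _ _ _ := rfl

theorem singRange_act (g : G) {n : ℕ} (σ : (sing E).obj n) :
    singRange ((singAction G).act g σ) = g.1 '' singRange σ := Set.range_comp g.1 (singMap σ)

theorem push_mem_chainsIn {K : FaceSet.{z}} {G : Type*} [Group G] (A : K.Action G) (g : G) {n : ℕ}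
    {B B' : Set (K.obj n)} (h : ∀ x ∈ B, A.act g x ∈ B') {c : K.Chain n} (hc : c ∈ K.chainsIn B) :
    A.push g n c ∈ K.chainsIn B' :=
  Finsupp.mapDomain_mem_supported h hc

theorem act_mem_smallSimplices {U : E → Set E} (hU : ∀ (g : G) e, g.1 '' U e ⊆ U (g.1 e)) (g : G)
    {n : ℕ} {σ : (sing E).obj n} (hσ : σ ∈ smallSimplices U n) :
    (singAction G).act g σ ∈ smallSimplices U n := by
  obtain ⟨e, he⟩ := hσ
  refine ⟨g.1 e, ?_⟩
  rw [singRange_act]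
  exact (Set.image_mono he).trans (hU g e)

theorem subset_range_of_empty (σ : (sing E).obj 0) (A : Set E) : singRange σ ⊆ A := by
  rintro _ ⟨s, rfl⟩
  have := s.2.2
  simp at this

theorem empty_mem_smallSimplices [Nonempty E] (U : E → Set E) (σ : (sing E).obj 0) :
    σ ∈ smallSimplices U 0 :=
  ⟨Classical.arbitrary E, subset_range_of_empty σ _⟩

theorem mem_chainsIn_of_forall {K : FaceSet.{z}} {n : ℕ} {A : Set (K.obj n)} (h : ∀ x, x ∈ A)
    (c : K.Chain n) : c ∈ K.chainsIn A := fun x _ => h x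

theorem mem_chainsIn_of_single {K : FaceSet.{z}} {L : FaceSet.{z'}} {n m : ℕ}
    {A : Set (L.obj m)} {f : K.Chain n →ₗ[ℤ] L.Chain m} {B : Set (K.obj n)}
    (h : ∀ x ∈ B, f (Finsupp.single x 1) ∈ L.chainsIn A) {c : K.Chain n} (hc : c ∈ K.chainsIn B) :
    f c ∈ L.chainsIn A := by
  have h1 : f c = Finsupp.linearCombination ℤ (fun x => f (Finsupp.single x 1)) c :=
    Finsupp.linearMap_congr (g := Finsupp.linearCombination ℤ fun x => f (Finsupp.single x 1))
      (fun x => by rw [Finsupp.linearCombination_single, one_smul]) c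
  rw [h1]
  exact Finsupp.linearCombination_mem_of_supported h hc

/-- The singular complex deforms equivariantly into the complex of small chains. -/
theorem exists_small_deformation [Nonempty E] {U : E → Set E} (hU : ∀ e, U e ∈ nhds e)
    (hGU : ∀ (g : G) e, g.1 '' U e ⊆ U (g.1 e)) (hG : ∀ n, (singAction G).FreeAt (n + 1)) :
    ∃ (s : ∀ n, (sing E).Chain n →ₗ[ℤ] (sing E).Chain n)
      (h : ∀ n, (sing E).Chain n →ₗ[ℤ] (sing E).Chain (n + 1)),
      s 0 = LinearMap.id ∧ h 0 = 0 ∧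
      (∀ n, (singAction G).IsEquivariant (singAction G) (s n)) ∧
      (∀ n, (singAction G).IsEquivariant (singAction G) (h n)) ∧
      (∀ n c, s n c ∈ (sing E).chainsIn (smallSimplices U n)) ∧
      (∀ n c, (sing E).bd n (s (n + 1) c) = s n ((sing E).bd n c)) ∧
      ∀ n c, (sing E).bd (n + 1) (h (n + 1) c) = s (n + 1) c - c - h n ((sing E).bd n c) := by
  let A := singAction G
  obtain ⟨f, hf0, hf⟩ := exists_seq_of_step
    (F := fun n => ((sing E).Chain n →ₗ[ℤ] (sing E).Chain n) ×
      ((sing E).Chain n →ₗ[ℤ] (sing E).Chain (n + 1)))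
    (Q := fun n f => A.IsEquivariant A f.1 ∧ A.IsEquivariant A f.2 ∧
      (∀ c, f.1 c ∈ (sing E).chainsIn (smallSimplices U n)) ∧
      (∀ c, (sing E).bd n (f.2 ((sing E).bd n c)) = f.1 ((sing E).bd n c) - (sing E).bd n c) ∧
      ∀ h : n = 0, f.1 = LinearMap.id ∧ f.2 = 0)
    (R := fun n f f' => (∀ c, (sing E).bd n (f'.1 c) = f.1 ((sing E).bd n c)) ∧
      ∀ c, (sing E).bd (n + 1) (f'.2 c) = f'.1 c - c - f.2 ((sing E).bd n c))
    ⟨(LinearMap.id, 0), fun _ _ => rfl, fun _ _ => by simp,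
      fun c => mem_chainsIn_of_forall (empty_mem_smallSimplices U) c, fun c => by simp,
      fun _ => ⟨rfl, rfl⟩⟩
    (by
      rintro n f ⟨h1, h2, h3, h4, -⟩
      -- The fourth clause of `Q` makes the boundary of `σ + h∂σ` equal to `s∂σ`, which is small.
      -- Hence this chain becomes small after adding a boundary, and the correction can be chosen
      -- equivariantly.
      obtain ⟨k, hk, hk'⟩ := A.exists_linearMap (A' := A) (m := n + 2) (hG n)
        (fun σ w => Finsupp.single σ 1 + f.2 ((sing E).bd n (Finsupp.single σ 1)) +
          (sing E).bd (n + 1) w ∈ (sing E).chainsIn (smallSimplices U (n + 1)))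
        (fun g σ w hw => by
          rw [← A.push_single, A.bd_push, h2, A.bd_push, ← map_add, ← map_add]
          exact push_mem_chainsIn A g (fun σ hσ => act_mem_smallSimplices hGU g hσ) hw)
        (fun σ => exists_add_bd_mem_small hU _ (by
          rw [map_add, h4, add_sub_cancel]
          exact h3 _))
      -- The next map is defined so that the homotopy relation holds by construction.
      let s' : (sing E).Chain (n + 1) →ₗ[ℤ] (sing E).Chain (n + 1) :=
        LinearMap.id + f.2 ∘ₗ (sing E).bd n + (sing E).bd (n + 1) ∘ₗ k
      have hs' (c) : s' c = c + f.2 ((sing E).bd n c) + (sing E).bd (n + 1) (k c) := rfl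
      have hbd (c) : (sing E).bd (n + 1) (k c) = s' c - c - f.2 ((sing E).bd n c) := by
        rw [hs']; abel
      refine ⟨(s', k), ⟨fun g c => ?_, hk, fun c => ?_, fun c => ?_, fun h => by simp at h⟩,
        fun c => ?_, hbd⟩
      · rw [hs', hs', A.bd_push, h2, hk, A.bd_push, ← map_add, ← map_add]
      · exact mem_chainsIn_of_single (B := Set.univ) (fun σ _ => hk' σ)
          (mem_chainsIn_of_forall (fun _ => trivial) c)
      · rw [hbd, FaceSet.bd_bd, map_zero, sub_zero]
      · change (sing E).bd n (s' c) = _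
        rw [hs', map_add, map_add, FaceSet.bd_bd, h4]
        abel)
    (fun f => f.1 = LinearMap.id ∧ f.2 = 0) (fun f hf => hf.2.2.2.2 rfl)
  exact ⟨fun n => (f n).1, fun n => (f n).2, hf0.1, hf0.2, fun n => (hf n).1.1,
    fun n => (hf n).1.2.1, fun n => (hf n).1.2.2.1, fun n => (hf n).2.1, fun n => (hf n).2.2⟩

end Equivariant

/-! ### A finite model of the singular complex of the universal covering -/

section FiniteModel

open Set Topology

universe z

/-- A free `G`-complex with finitely many orbits in each degree, which is equivariantly homotopy
equivalent up to degree `M` to a complex that it dominates. -/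
structure FiniteModel {G : Type*} [Group G] {C : FaceSet.{z}} (A : C.Action G) (M : ℕ) where
  F : FaceSet.{z}
  action : F.Action G
  free : ∀ n, action.FreeAt (n + 1)
  orbits_finite : ∀ n, ∃ s : Set (F.obj n), s.Finite ∧ ∀ x, ∃ y ∈ s, ∃ g, action.act g y = x
  a : ∀ n, C.Chain n →ₗ[ℤ] F.Chain n
  b : ∀ n, F.Chain n →ₗ[ℤ] C.Chain n
  h : ∀ n, C.Chain n →ₗ[ℤ] C.Chain (n + 1)
  a_equivariant : ∀ n, A.IsEquivariant action (a n)
  b_equivariant : ∀ n, action.IsEquivariant A (b n)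
  h_equivariant : ∀ n, A.IsEquivariant A (h n)
  bd_a : ∀ n < M, ∀ c, F.bd n (a (n + 1) c) = a n (C.bd n c)
  bd_b : ∀ n < M, ∀ c, C.bd n (b (n + 1) c) = b n (F.bd n c)
  h_zero : h 0 = 0
  bd_h : ∀ n < M, ∀ c, C.bd (n + 1) (h (n + 1) c) = b (n + 1) (a (n + 1) c) - c - h n (C.bd n c)

variable {X : Type u} {E : Type z} [TopologicalSpace X] [TopologicalSpace E] {p : C(E, X)}

namespace BallSystem

variable (S : BallSystem p)

theorem mem_self (j : ℕ) (e : E) : e ∈ S.ball j e := mem_of_mem_nhds (S.mem_nhds j e)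

theorem antitone {j j' : ℕ} (h : j ≤ j') (e : E) : S.ball j' e ⊆ S.ball j e := by
  induction h with
  | refl => exact subset_rfl
  | step _ ih => exact (S.subset_of_mem (S.mem_self _ e)).trans ih

theorem act_mem (g : deckGroup p) {j : ℕ} {e e' : E} (h : e' ∈ S.ball j e) :
    g.1 e' ∈ S.ball j (g.1 e) := S.image_deck g j e ⟨e', h, rfl⟩

/-- Sequences of points over `F` that are pairwise close at scale `J`. -/
def closeTuples (F : Set X) (J : ℕ) : FaceSet.{z} where
  obj n := {τ : Fin n → E // (∀ i, p (τ i) ∈ F) ∧ ∀ i j, τ i ∈ S.ball J (τ j)}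
  face i τ := ⟨τ.1 ∘ i.succAbove, fun _ => τ.2.1 _, fun _ _ => τ.2.2 _ _⟩
  face_face i j τ h := Subtype.ext (by
    change τ.1 ∘ j.succ.succAbove ∘ i.succAbove = τ.1 ∘ i.castSucc.succAbove ∘ j.succAbove
    rw [Fin.succAbove_succ_comp h])

variable {S} {F : Set X} {J : ℕ}

/-- The points of a close sequence. -/
def vertex {n : ℕ} (τ : (S.closeTuples F J).obj n) : Fin n → E := τ.1

theorem closeTuples_ext {n : ℕ} {τ τ' : (S.closeTuples F J).obj n}
    (h : ∀ i, vertex τ i = vertex τ' i) : τ = τ' := Subtype.ext (funext h)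

variable (S F J)

/-- The action of deck transformations on close sequences. -/
def closeAction : (S.closeTuples F J).Action (deckGroup p) where
  act g τ := ⟨fun i => g.1 (τ.1 i), fun i => (deckGroup_apply g _).symm ▸ τ.2.1 i,
    fun i j => S.act_mem g (τ.2.2 i j)⟩
  one_act _ := rfl
  mul_act _ _ _ := rfl
  face_act _ _ _ := rfl

theorem closeAction_free [PreconnectedSpace E] (hp : IsCoveringMap p) (n : ℕ) :
    (S.closeAction F J).FreeAt (n + 1) := fun _ _ τ h =>
  deck_free hp (e := vertex τ 0) (congrArg (fun τ : (S.closeTuples F J).obj (n + 1) => vertex τ 0) h)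

/-- Up to a deck transformation a close sequence is determined by its image in `X`: once the first
vertices agree, all others lie in a ball on which `p` is injective. There are only finitely many
images, as `F` is finite. -/
theorem closeTuples_orbits_finite [SimplyConnectedSpace E] [LocallyPathConnectedSpace E]
    (hp : IsCoveringMap p) (hF : F.Finite) (n : ℕ) :
    ∃ s : Set ((S.closeTuples F J).obj n), s.Finite ∧
      ∀ x, ∃ y ∈ s, ∃ g, (S.closeAction F J).act g y = x := by
  have := hF.to_subtype
  let f : (S.closeTuples F J).obj n → (Fin n → F) := fun τ i => ⟨p (vertex τ i), τ.2.1 i⟩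
  have hf (x y : (S.closeTuples F J).obj n) (h : f y = f x) :
      ∃ g, (S.closeAction F J).act g y = x := by
    have h (i) : p (vertex y i) = p (vertex x i) := congrArg Subtype.val (congrFun h i)
    cases n with
    | zero => exact ⟨1, closeTuples_ext fun i => i.elim0⟩
    | succ n =>
      obtain ⟨g, hg⟩ := exists_deck_apply_eq hp (h 0)
      refine ⟨g, closeTuples_ext fun i => S.injOn (vertex x 0) ?_ ?_ ?_⟩
      · rw [← hg]
        exact S.antitone (Nat.zero_le J) _ (S.act_mem g (y.2.2 i 0))
      · exact S.antitone (Nat.zero_le J) _ (x.2.2 i 0)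
      · exact (deckGroup_apply g _).trans (h i)
  refine ⟨Set.range fun t : Set.range f => t.2.choose, Set.finite_range _, fun x => ?_⟩
  exact ⟨_, ⟨⟨f x, x, rfl⟩, rfl⟩, hf _ _ (⟨f x, x, rfl⟩ : Set.range f).2.choose_spec⟩

theorem singAction_free [PreconnectedSpace E] (hp : IsCoveringMap p) (n : ℕ) :
    (singAction (deckGroup p)).FreeAt (n + 1) := fun _ _ σ h =>
  deck_free hp (e := singMap σ (stdSimplex.vertex 0))
    (congrArg (fun σ : (sing E).obj (n + 1) => singMap σ (stdSimplex.vertex 0)) h)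

theorem act_mem_simplicesIn (g : deckGroup p) {j n : ℕ} {e : E} {σ : (sing E).obj n}
    (hσ : σ ∈ simplicesIn (S.ball j e) n) :
    (singAction (deckGroup p)).act g σ ∈ simplicesIn (S.ball j (g.1 e)) n := by
  change singRange _ ⊆ _
  rw [singRange_act]
  exact (image_mono hσ).trans (S.image_deck g j e)

theorem chainsIn_simplicesIn_mono {A B : Set E} (h : A ⊆ B) (n : ℕ) :
    (sing E).chainsIn (simplicesIn A n) ≤ (sing E).chainsIn (simplicesIn B n) :=
  Finsupp.supported_mono fun _ hσ => Subset.trans hσ h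

theorem bd_single_mem {K : FaceSet.{z}} {n : ℕ} (x : K.obj (n + 1)) :
    K.bd n (Finsupp.single x 1) ∈ K.chainsIn (Set.range fun i => K.face i x) :=
  FaceSet.bd_mem_chainsIn (A := {x}) (by rintro _ rfl i; exact ⟨i, rfl⟩)
    (Finsupp.single_mem_supported ℤ 1 rfl)

/-- Close sequences are realized equivariantly by singular chains. -/
theorem exists_realization [PreconnectedSpace E] (hp : IsCoveringMap p) {M : ℕ} (hJ : 2 * M ≤ J) :
    ∃ b : ∀ n, (S.closeTuples F J).Chain n →ₗ[ℤ] (sing E).Chain n,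
      (∀ τ σ, b 0 (Finsupp.single τ 1) = Finsupp.single σ 1) ∧
      (∀ n, (S.closeAction F J).IsEquivariant (singAction (deckGroup p)) (b n)) ∧
      (∀ n < M, ∀ c, (sing E).bd n (b (n + 1) c) = b n ((S.closeTuples F J).bd n c)) ∧
      ∀ n ≤ M, ∀ (hn : 0 < n) τ, b n (Finsupp.single τ 1) ∈
        (sing E).chainsIn (simplicesIn (S.ball (J - 2 * n) (vertex τ ⟨0, hn⟩)) n) := by
  let T := S.closeTuples F J
  let A := S.closeAction F J
  let A' := singAction (deckGroup p)
  have hempty (σ σ' : (sing E).obj 0) : σ = σ' := sing_ext fun s => by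
    have := s.2.2
    simp at this
  obtain ⟨b, hb0, hb⟩ := exists_seq_of_step
    (F := fun n => T.Chain n →ₗ[ℤ] (sing E).Chain n)
    (Q := fun n b => A.IsEquivariant A' b ∧ (n ≤ M → (∀ c, FaceSet.IsCycle (b (T.bd n c))) ∧
      ∀ (hn : 0 < n) τ, b (Finsupp.single τ 1) ∈
        (sing E).chainsIn (simplicesIn (S.ball (J - 2 * n) (vertex τ ⟨0, hn⟩)) n)) ∧
      ∀ _ : n = 0, ∀ τ σ, b (Finsupp.single τ 1) = Finsupp.single σ 1)
    (R := fun n b b' => n < M → ∀ c, (sing E).bd n (b' c) = b (T.bd n c))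
    (by
      let σ₀ : (sing E).obj 0 :=
        (⟨fun s => absurd s.2.2 (by simp), continuous_of_const fun s => absurd s.2.2 (by simp)⟩ :
          C(stdSimplex ℝ (Fin 0), E))
      have h1 (x : T.obj 0) : (Finsupp.lmapDomain ℤ ℤ fun _ => σ₀) (Finsupp.single x (1 : ℤ)) =
          Finsupp.single σ₀ 1 := by simp [Finsupp.mapDomain_single]
      refine ⟨Finsupp.lmapDomain ℤ ℤ fun _ => σ₀,
        FaceSet.Action.isEquivariant_of_single fun g x => ?_,
        fun _ => ⟨fun _ => trivial, fun hn => absurd hn (lt_irrefl _)⟩, fun _ τ σ => ?_⟩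
      · rw [h1, h1, A'.push_single]
        exact congrArg (Finsupp.single · 1) (hempty _ _)
      · rw [h1]
        exact congrArg (Finsupp.single · 1) (hempty _ _))
    (by
      rintro n b ⟨h1, h2, -⟩
      obtain ⟨k, hk, hk'⟩ := A.exists_linearMap (A' := A') (m := n + 1)
        (S.closeAction_free F J hp n)
        (fun τ w => n < M → (sing E).bd n w = b (T.bd n (Finsupp.single τ 1)) ∧
          w ∈ (sing E).chainsIn (simplicesIn (S.ball (J - 2 * (n + 1)) (vertex τ 0)) (n + 1)))
        (fun g τ w hw hn => by
          refine ⟨?_, push_mem_chainsIn A' g (fun σ hσ => S.act_mem_simplicesIn g hσ) (hw hn).2⟩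
          rw [A'.bd_push, (hw hn).1, ← h1, ← A.bd_push, A.push_single])
        (fun τ => by
          by_cases hn : n < M
          · obtain ⟨h2, h3⟩ := h2 hn.le
            -- The realized boundary is filled inside a contractible ball around the first vertex.
            -- Each degree costs two scales: one to recentre the balls of the faces, one for the
            -- contraction.
            obtain ⟨w, hw, hw'⟩ := (S.contracts (J - 2 * (n + 1)) (vertex τ 0)).exists_bd
              ⟨_, S.mem_self _ _⟩ (z := b (T.bd n (Finsupp.single τ 1))) (by
                refine mem_chainsIn_of_single (B := Set.range fun i => T.face i τ) ?_
                  (bd_single_mem τ)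
                rintro _ ⟨i, rfl⟩
                cases n with
                | zero => exact mem_chainsIn_of_forall (fun σ => subset_range_of_empty σ _) _
                | succ n =>
                  refine chainsIn_simplicesIn_mono ?_ _ (h3 n.succ_pos _)
                  have h4 : vertex (T.face i τ) ⟨0, n.succ_pos⟩ ∈ S.ball J (vertex τ 0) :=
                    τ.2.2 _ _
                  have h5 : J - 2 * (n + 1) = (J - 2 * (n + 1 + 1) + 1) + 1 := by lia
                  rw [h5]
                  exact S.subset_of_mem (S.antitone (by lia) _ h4)) (h2 _)
            exact ⟨w, fun _ => ⟨hw', hw⟩⟩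
          · exact ⟨0, fun h => absurd h hn⟩)
      have hbd (hn : n < M) (c) : (sing E).bd n (k c) = b (T.bd n c) :=
        Finsupp.linearMap_congr (f := (sing E).bd n ∘ₗ k) (g := b ∘ₗ T.bd n)
          (fun τ => (hk' τ hn).1) c
      refine ⟨k, ⟨hk, fun hn => ⟨fun c => ?_, fun _ τ => (hk' τ hn).2⟩, fun h => by simp at h⟩, hbd⟩
      change (sing E).bd n _ = 0
      rw [hbd hn, FaceSet.bd_bd, map_zero])
    (fun b => ∀ τ σ, b (Finsupp.single τ 1) = Finsupp.single σ 1) (fun b hb => hb.2.2 rfl)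
  exact ⟨b, hb0, fun n => (hb n).1.1, fun n => (hb n).2, fun n hn => ((hb n).1.2.1 hn).2⟩

end BallSystem

end FiniteModel

/-! ### Approximation of small singular chains by close sequences -/

section FiniteModel

open Set Topology

universe z

variable {X : Type u} {E : Type z} [TopologicalSpace X] [TopologicalSpace E] {p : C(E, X)}

namespace BallSystem

variable (S : BallSystem p) {F : Set X} {J : ℕ}

/-- Follow the chain `v e₂`, `e₂`, `e`, `e₁`, `v e₁` of close points. The initial reversal and the
three compositions cost one scale each, whence `J + 4`. -/
theorem vertex_mem_of_small {v : E → E} (hv : ∀ e, e ∈ S.ball (J + 4) (v e)) {e e₁ e₂ : E}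
    (h₁ : e₁ ∈ S.ball (J + 4) e) (h₂ : e₂ ∈ S.ball (J + 4) e) : v e₁ ∈ S.ball J (v e₂) := by
  have h3 : e ∈ S.ball (J + 3) e₂ := S.symm_of_mem h₂
  have h4 : e ∈ S.ball (J + 2) (v e₂) :=
    S.subset_of_mem (S.antitone (by lia) _ (hv e₂)) h3
  have h5 : e₁ ∈ S.ball (J + 1) (v e₂) :=
    S.subset_of_mem h4 (S.antitone (by lia) _ h₁)
  have h6 : v e₁ ∈ S.ball (J + 3) e₁ := S.symm_of_mem (hv e₁)
  exact S.subset_of_mem h5 (S.antitone (by lia) _ h6)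

theorem singMap_vertex_face {n : ℕ} (i : Fin (n + 1)) (σ : (sing E).obj (n + 1)) (j : Fin n) :
    singMap ((sing E).face i σ) (stdSimplex.vertex j) =
      singMap σ (stdSimplex.vertex (i.succAbove j)) := by
  rw [singMap_face, stdSimplex.map_vertex]

variable (F J) in
/-- The sequence of approximations of the vertices of a small simplex. -/
noncomputable def approxVertices {v : E → E} (hv : ∀ e, p (v e) ∈ F ∧ e ∈ S.ball (J + 4) (v e))
    {n : ℕ} (σ : (sing E).obj n) (hσ : σ ∈ smallSimplices (S.ball (J + 4)) n) :
    (S.closeTuples F J).obj n :=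
  ⟨fun i => v (singMap σ (stdSimplex.vertex i)), fun _ => (hv _).1, fun _ _ =>
    S.vertex_mem_of_small (fun e => (hv e).2) (hσ.choose_spec ⟨_, rfl⟩)
      (hσ.choose_spec ⟨_, rfl⟩)⟩

/-- Small chains map equivariantly to chains of close sequences. -/
theorem exists_approximation {v : E → E} (hv : ∀ e, p (v e) ∈ F ∧ e ∈ S.ball (J + 4) (v e))
    (hvG : ∀ (g : deckGroup p) e, v (g.1 e) = g.1 (v e)) :
    ∃ a : ∀ n, (sing E).Chain n →ₗ[ℤ] (S.closeTuples F J).Chain n,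
      (∀ n, (singAction (deckGroup p)).IsEquivariant (S.closeAction F J) (a n)) ∧
      (∀ n, ∀ c ∈ (sing E).chainsIn (smallSimplices (S.ball (J + 4)) (n + 1)),
        (S.closeTuples F J).bd n (a (n + 1) c) = a n ((sing E).bd n c)) ∧
      ∀ n σ, σ ∈ smallSimplices (S.ball (J + 4)) n → ∃ τ, a n (Finsupp.single σ 1) =
        Finsupp.single τ 1 ∧ ∀ i, vertex τ i = v (singMap σ (stdSimplex.vertex i)) := by
  classical
  let T := S.closeTuples F J
  -- Simplices that are not small are sent to zero. This keeps the map equivariant, as smallness is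
  -- invariant, while the chain map property is claimed only on small chains.
  let a (n : ℕ) : (sing E).Chain n →ₗ[ℤ] T.Chain n := Finsupp.linearCombination ℤ fun σ =>
    if h : σ ∈ smallSimplices (S.ball (J + 4)) n then
      Finsupp.single (S.approxVertices F J hv σ h) 1 else 0
  have ha {n : ℕ} {σ : (sing E).obj n} (h : σ ∈ smallSimplices (S.ball (J + 4)) n) :
      a n (Finsupp.single σ 1) = Finsupp.single (S.approxVertices F J hv σ h) 1 := by
    simp only [a]
    rw [Finsupp.linearCombination_single, one_smul, dif_pos h]
  refine ⟨a, fun n => FaceSet.Action.isEquivariant_of_single fun g σ => ?_, fun n c hc => ?_,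
    fun n σ hσ => ⟨_, ha hσ, fun _ => rfl⟩⟩
  · by_cases h : σ ∈ smallSimplices (S.ball (J + 4)) n
    · rw [ha h, ha (act_mem_smallSimplices (fun g e => S.image_deck g _ e) g h),
        FaceSet.Action.push_single]
      exact congrArg (Finsupp.single · 1) (closeTuples_ext fun i => hvG g _)
    · have h' : (singAction (deckGroup p)).act g σ ∉ smallSimplices (S.ball (J + 4)) n := by
        intro h'
        apply h
        have := act_mem_smallSimplices (fun g e => S.image_deck g _ e) g⁻¹ h'
        rwa [← FaceSet.Action.mul_act, inv_mul_cancel, FaceSet.Action.one_act] at this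
      simp only [a]
      rw [Finsupp.linearCombination_single, Finsupp.linearCombination_single, dif_neg h, dif_neg h',
        smul_zero, map_zero]
  · refine Finsupp.linearMap_eqOn_supported (f := T.bd n ∘ₗ a (n + 1)) (g := a n ∘ₗ (sing E).bd n)
      (fun σ hσ => ?_) hc
    rw [LinearMap.comp_apply, LinearMap.comp_apply, ha hσ, FaceSet.bd_single, FaceSet.bd_single,
      map_sum]
    refine Finset.sum_congr rfl fun i _ => ?_
    have hσ' : (sing E).face i σ ∈ smallSimplices (S.ball (J + 4)) n := by
      obtain ⟨e, he⟩ := hσ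
      exact ⟨e, (singRange_face_subset i σ).trans he⟩
    rw [map_smul, ha hσ']
    congr 2
    refine closeTuples_ext fun j => ?_
    change v _ = v _
    rw [singMap_vertex_face]

/-- Small chains are equivariantly homotopic to their approximations. -/
theorem exists_approximation_homotopy [PreconnectedSpace E] [Nonempty E] (hp : IsCoveringMap p)
    {M : ℕ} (hJ : 4 * M + 10 ≤ J) {v : E → E}
    (hv : ∀ e, e ∈ S.ball (J + 4) (v e))
    {b : ∀ n, (S.closeTuples F J).Chain n →ₗ[ℤ] (sing E).Chain n}
    (hb0 : ∀ τ σ, b 0 (Finsupp.single τ 1) = Finsupp.single σ 1)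
    (hbG : ∀ n, (S.closeAction F J).IsEquivariant (singAction (deckGroup p)) (b n))
    (hb : ∀ n < M, ∀ c, (sing E).bd n (b (n + 1) c) = b n ((S.closeTuples F J).bd n c))
    (hbJ : ∀ n ≤ M, ∀ (hn : 0 < n) τ, b n (Finsupp.single τ 1) ∈
        (sing E).chainsIn (simplicesIn (S.ball (J - 2 * n) (vertex τ ⟨0, hn⟩)) n))
    {a : ∀ n, (sing E).Chain n →ₗ[ℤ] (S.closeTuples F J).Chain n}
    (haG : ∀ n, (singAction (deckGroup p)).IsEquivariant (S.closeAction F J) (a n))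
    (ha : ∀ n, ∀ c ∈ (sing E).chainsIn (smallSimplices (S.ball (J + 4)) (n + 1)),
        (S.closeTuples F J).bd n (a (n + 1) c) = a n ((sing E).bd n c))
    (hav : ∀ n σ, σ ∈ smallSimplices (S.ball (J + 4)) n → ∃ τ, a n (Finsupp.single σ 1) =
        Finsupp.single τ 1 ∧ ∀ i, vertex τ i = v (singMap σ (stdSimplex.vertex i))) :
    ∃ k : ∀ n, (sing E).Chain n →ₗ[ℤ] (sing E).Chain (n + 1), k 0 = 0 ∧
      (∀ n, (singAction (deckGroup p)).IsEquivariant (singAction (deckGroup p)) (k n)) ∧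
      ∀ n < M, ∀ c ∈ (sing E).chainsIn (smallSimplices (S.ball (J + 4)) (n + 1)),
        (sing E).bd (n + 1) (k (n + 1) c) = b (n + 1) (a (n + 1) c) - c - k n ((sing E).bd n c) := by
  let A := singAction (deckGroup p)
  have hact {n : ℕ} (g : deckGroup p) {σ : (sing E).obj n}
      (hσ : σ ∈ smallSimplices (S.ball (J + 4)) n) :
      A.act g σ ∈ smallSimplices (S.ball (J + 4)) n :=
    act_mem_smallSimplices (fun g e => S.image_deck g _ e) g hσ
  have hact' {n : ℕ} (g : deckGroup p) {σ : (sing E).obj n}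
      (hσ : A.act g σ ∈ smallSimplices (S.ball (J + 4)) n) :
      σ ∈ smallSimplices (S.ball (J + 4)) n := by
    have := hact g⁻¹ hσ
    rwa [← FaceSet.Action.mul_act, inv_mul_cancel, FaceSet.Action.one_act] at this
  have hsingle {n : ℕ} {σ : (sing E).obj n} (hσ : σ ∈ smallSimplices (S.ball (J + 4)) n) :
      Finsupp.single σ 1 ∈ (sing E).chainsIn (smallSimplices (S.ball (J + 4)) n) :=
    Finsupp.single_mem_supported ℤ 1 hσ
  obtain ⟨k, hk0, hk⟩ := exists_seq_of_step
    (F := fun n => (sing E).Chain n →ₗ[ℤ] (sing E).Chain (n + 1))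
    (Q := fun n k => A.IsEquivariant A k ∧ (n ≤ M →
      (∀ c ∈ (sing E).chainsIn (smallSimplices (S.ball (J + 4)) (n + 1)),
        (sing E).bd n (k ((sing E).bd n c)) = b n (a n ((sing E).bd n c)) - (sing E).bd n c) ∧
      -- The homotopy loses two scales per degree, counted down from `2 * M + 6`. These balls are
      -- coarser than those containing the realizations, by the assumption on `J`.
      ∀ (hn : 0 < n) σ, σ ∈ smallSimplices (S.ball (J + 4)) n → k (Finsupp.single σ 1) ∈
        (sing E).chainsIn (simplicesIn
          (S.ball (2 * M + 6 - 2 * n) (singMap σ (stdSimplex.vertex ⟨0, hn⟩))) (n + 1))) ∧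
      ∀ _ : n = 0, k = 0)
    (R := fun n k k' => n < M →
      ∀ c ∈ (sing E).chainsIn (smallSimplices (S.ball (J + 4)) (n + 1)),
        (sing E).bd (n + 1) (k' c) = b (n + 1) (a (n + 1) c) - c - k ((sing E).bd n c))
    ⟨0, fun g c => by simp, fun _ => ⟨fun c _ => by
      -- On the empty simplex the composite is the identity, so the homotopy may start with zero.
      have h0 : b 0 ∘ₗ a 0 = LinearMap.id := Finsupp.lhom_ext' fun σ => LinearMap.ext_ring (by
        obtain ⟨τ, hτ, -⟩ := hav 0 σ (empty_mem_smallSimplices _ σ)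
        exact (congrArg (b 0) hτ).trans (hb0 τ σ))
      have := LinearMap.congr_fun h0 ((sing E).bd 0 c)
      rw [LinearMap.comp_apply, LinearMap.id_apply] at this
      rw [this, sub_self, LinearMap.zero_apply, map_zero],
      fun hn => absurd hn (lt_irrefl _)⟩, fun _ => rfl⟩
    (by
      rintro n k ⟨h1, h2, h2'⟩
      obtain ⟨k', hk, hk'⟩ := A.exists_linearMap (A' := A) (m := n + 2) (singAction_free hp n)
        (fun σ w => n < M → σ ∈ smallSimplices (S.ball (J + 4)) (n + 1) →
          (sing E).bd (n + 1) w = b (n + 1) (a (n + 1) (Finsupp.single σ 1)) -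
            Finsupp.single σ 1 - k ((sing E).bd n (Finsupp.single σ 1)) ∧
          w ∈ (sing E).chainsIn (simplicesIn
            (S.ball (2 * M + 6 - 2 * (n + 1)) (singMap σ (stdSimplex.vertex 0))) (n + 2)))
        (fun g σ w hw hn hσ => by
          obtain ⟨hw1, hw2⟩ := hw hn (hact' g hσ)
          refine ⟨?_, push_mem_chainsIn A g (fun σ hσ => S.act_mem_simplicesIn g hσ) hw2⟩
          rw [A.bd_push, hw1, ← A.push_single, haG, hbG, A.bd_push, h1, map_sub, map_sub])
        (fun σ => by
          by_cases hn : n < M ∧ σ ∈ smallSimplices (S.ball (J + 4)) (n + 1)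
          · obtain ⟨hn, hσ⟩ := hn
            obtain ⟨h2, h3⟩ := h2 hn.le
            let e := singMap σ (stdSimplex.vertex 0)
            obtain ⟨τ, hτ, hτv⟩ := hav _ σ hσ
            have hr : ∀ e' ∈ singRange σ, e' ∈ S.ball (J + 2) e := by
              obtain ⟨e₀, he₀⟩ := hσ
              intro e' he'
              have h4 : e₀ ∈ S.ball (J + 3) e := S.symm_of_mem (he₀ ⟨_, rfl⟩)
              exact S.subset_of_mem h4 (S.antitone (by lia) _ (he₀ he'))
            -- The simplex, the realization of its approximation and the homotopy on its faces all
            -- lie in one ball around its first vertex. Their combination is a cycle by the relation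
            -- in the preceding degree.
            obtain ⟨w, hw, hw'⟩ := (S.contracts (2 * M + 6 - 2 * (n + 1)) e).exists_bd
              ⟨_, S.mem_self _ _⟩ (z := b (n + 1) (a (n + 1) (Finsupp.single σ 1)) -
                Finsupp.single σ 1 - k ((sing E).bd n (Finsupp.single σ 1))) (by
                refine sub_mem (sub_mem ?_ ?_) ?_
                · rw [hτ]
                  refine chainsIn_simplicesIn_mono ?_ _ (hbJ (n + 1) hn n.succ_pos τ)
                  have h4 : vertex τ ⟨0, n.succ_pos⟩ ∈ S.ball (J + 3) e := by
                    rw [hτv]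
                    exact S.symm_of_mem (hv e)
                  have h5 : J - 2 * (n + 1) = (J - 2 * (n + 1) - 1) + 1 := by lia
                  rw [h5]
                  exact (S.subset_of_mem (S.antitone (by lia) _ h4)).trans
                    (S.antitone (by lia) _)
                · exact Finsupp.single_mem_supported ℤ 1
                    (fun e' he' => S.antitone (by lia) _ (hr e' he'))
                · refine mem_chainsIn_of_single
                    (B := Set.range fun i => (sing E).face i σ) ?_ (bd_single_mem σ)
                  rintro _ ⟨i, rfl⟩
                  have hσ' : (sing E).face i σ ∈ smallSimplices (S.ball (J + 4)) n := by
                    obtain ⟨e, he⟩ := hσ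
                    exact ⟨e, (singRange_face_subset i σ).trans he⟩
                  cases n with
                  | zero =>
                    rw [show k = 0 from h2' rfl]
                    exact zero_mem _
                  | succ n =>
                    refine chainsIn_simplicesIn_mono ?_ _ (h3 n.succ_pos _ hσ')
                    rw [singMap_vertex_face]
                    have h4 := hr _ ⟨stdSimplex.vertex (i.succAbove ⟨0, n.succ_pos⟩), rfl⟩
                    have h5 : 2 * M + 6 - 2 * (n + 1) =
                      (2 * M + 6 - 2 * (n + 1 + 1) + 1) + 1 := by lia
                    rw [h5]
                    exact S.subset_of_mem (S.antitone (by lia) _ h4)) (by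
                change (sing E).bd n _ = 0
                rw [map_sub, map_sub, hb n hn, ha n _ (hsingle hσ), h2 _ (hsingle hσ)]
                abel)
            exact ⟨w, fun _ _ => ⟨hw', hw⟩⟩
          · exact ⟨0, fun h h' => absurd ⟨h, h'⟩ hn⟩)
      have hbd (hn : n < M) (c) (hc : c ∈ (sing E).chainsIn
          (smallSimplices (S.ball (J + 4)) (n + 1))) : (sing E).bd (n + 1) (k' c) =
            b (n + 1) (a (n + 1) c) - c - k ((sing E).bd n c) :=
        Finsupp.linearMap_eqOn_supported (f := (sing E).bd (n + 1) ∘ₗ k')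
          (g := b (n + 1) ∘ₗ a (n + 1) - LinearMap.id - k ∘ₗ (sing E).bd n)
          (fun σ hσ => (hk' σ hn hσ).1) hc
      refine ⟨k', ⟨hk, fun hn => ⟨fun c hc => ?_, fun _ σ hσ => (hk' σ hn hσ).2⟩,
        fun h => by simp at h⟩, hbd⟩
      rw [hbd hn _ (bd_mem_small hc), FaceSet.bd_bd, map_zero, sub_zero])
    (fun k => k = 0) (fun k hk => hk.2.2 rfl)
  exact ⟨k, hk0, fun n => (hk n).1.1, fun n => (hk n).2⟩

/-- The singular complex of the universal covering of a locally contractible compact space is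
dominated equivariantly by a free complex with finitely many orbits in each degree. -/
theorem nonempty_finiteModel (S : BallSystem p) [SimplyConnectedSpace E] [LocallyPathConnectedSpace E]
    (hp : IsCoveringMap p) (M : ℕ) : Nonempty (FiniteModel (singAction (deckGroup p)) M) := by
  let J := 4 * M + 10
  let A := singAction (deckGroup p)
  obtain ⟨F, hF, hnet⟩ := S.exists_net (J + 4)
  -- An equivariant, in general discontinuous, choice of a nearby point over the net.
  obtain ⟨v, hvG, hv⟩ := exists_equivariant_choice (α := E) (fun (g : deckGroup p) e => g.1 e)
    (fun _ => rfl) (fun _ _ _ => rfl) (fun g g' e h => deck_free hp h)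
    (fun (g : deckGroup p) e => g.1 e) (fun _ _ _ => rfl)
    (fun e e' => p e' ∈ F ∧ e ∈ S.ball (J + 4) e')
    (fun g e e' h => ⟨(deckGroup_apply g e').symm ▸ h.1, S.act_mem g h.2⟩) hnet
  obtain ⟨s, h, hs0, hh0, hsG, hhG, hsmall, hs, hh⟩ := exists_small_deformation
    (U := S.ball (J + 4)) (S.mem_nhds _) (fun g e => S.image_deck g _ e) (singAction_free hp)
  obtain ⟨b, hb0, hbG, hb, hbJ⟩ := S.exists_realization F J hp (M := M) (by lia)
  obtain ⟨a, haG, ha, hav⟩ := S.exists_approximation hv hvG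
  obtain ⟨k, hk0, hkG, hk⟩ := S.exists_approximation_homotopy hp (M := M) le_rfl
    (fun e => (hv e).2) hb0 hbG hb hbJ haG ha hav
  exact ⟨{
    F := S.closeTuples F J
    action := S.closeAction F J
    free := S.closeAction_free F J hp
    orbits_finite := S.closeTuples_orbits_finite F J hp hF
    a := fun n => a n ∘ₗ s n
    b := b
    -- The composite homotopy corresponds to `b a s - 1 = (b a - 1) s + (s - 1)`.
    h := fun n => k n ∘ₗ s n + h n
    a_equivariant := fun n => (haG n).comp (hsG n)
    b_equivariant := hbG
    h_equivariant := fun n => ((hkG n).comp (hsG n)).add (hhG n)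
    bd_a := fun n hn c => by
      rw [LinearMap.comp_apply, LinearMap.comp_apply, ha n _ (hsmall _ _), hs]
    bd_b := hb
    h_zero := by rw [hk0, hh0, LinearMap.zero_comp, add_zero]
    bd_h := fun n hn c => by
      rw [LinearMap.add_apply, LinearMap.add_apply, LinearMap.comp_apply, LinearMap.comp_apply,
        LinearMap.comp_apply, map_add, hk n hn _ (hsmall _ _), hh, hs]
      abel }⟩

end BallSystem

end FiniteModel

/-! ### Equivariant cochains and their matrices -/

section EquivariantCochains

open Matrix

universe z z'

namespace FaceSet

variable {G : Type*} [Group G] {B : Type*} [CommRing B] {r : ℕ}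

/-- The cochains that are equivariant with respect to a family of matrices. -/
def eqCochains {K : FaceSet.{z}} (A : K.Action G) (γ : G → Matrix (Fin r) (Fin r) B) (n : ℕ) :
    Submodule B (K.obj n → Fin r → B) where
  carrier := {φ | ∀ g x, φ (A.act g x) = γ g *ᵥ φ x}
  add_mem' h h' g x := by simp [h g x, h' g x, mulVec_add]
  zero_mem' g x := by simp
  smul_mem' c φ h g x := by simp [h g x, mulVec_smul]

/-- The map on cochains given by a map on chains. -/
noncomputable def pull (B : Type*) [CommRing B] (r : ℕ) {K : FaceSet.{z}} {L : FaceSet.{z'}}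
    {m n : ℕ} (f : K.Chain n →ₗ[ℤ] L.Chain m) :
    (L.obj m → Fin r → B) →ₗ[B] (K.obj n → Fin r → B) where
  toFun φ x := Finsupp.linearCombination ℤ φ (f (Finsupp.single x 1))
  map_add' φ ψ := by
    funext x
    simp [Finsupp.linearCombination_apply, Finsupp.sum, Finset.sum_add_distrib]
  map_smul' c φ := by
    funext x
    simp only [Finsupp.linearCombination_apply, Finsupp.sum, Pi.smul_apply, Finset.smul_sum,
      RingHom.id_apply]
    exact Finset.sum_congr rfl fun y _ => smul_comm _ _ _

variable {K : FaceSet.{z}} {L : FaceSet.{z'}} {m n : ℕ}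

theorem pull_apply (f : K.Chain n →ₗ[ℤ] L.Chain m) (φ : L.obj m → Fin r → B) (x : K.obj n) :
    pull B r f φ x = Finsupp.linearCombination ℤ φ (f (Finsupp.single x 1)) := rfl

theorem linearCombination_pull (f : K.Chain n →ₗ[ℤ] L.Chain m) (φ : L.obj m → Fin r → B)
    (c : K.Chain n) :
    Finsupp.linearCombination ℤ (pull B r f φ) c = Finsupp.linearCombination ℤ φ (f c) := by
  refine Finsupp.linearMap_congr (f := Finsupp.linearCombination ℤ (pull B r f φ))
    (g := Finsupp.linearCombination ℤ φ ∘ₗ f) (fun x => ?_) c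
  rw [Finsupp.linearCombination_single, one_smul]
  rfl

theorem pull_comp {K₃ : FaceSet.{w}} {l : ℕ} (f : K.Chain n →ₗ[ℤ] L.Chain m)
    (f' : L.Chain m →ₗ[ℤ] K₃.Chain l) (φ : K₃.obj l → Fin r → B) :
    pull B r (f' ∘ₗ f) φ = pull B r f (pull B r f' φ) := by
  funext x
  rw [pull_apply, pull_apply, linearCombination_pull]
  rfl

theorem pull_id (φ : K.obj n → Fin r → B) : pull B r LinearMap.id φ = φ := by
  funext x
  rw [pull_apply, LinearMap.id_apply, Finsupp.linearCombination_single, one_smul]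

theorem pull_add (f f' : K.Chain n →ₗ[ℤ] L.Chain m) (φ : L.obj m → Fin r → B) :
    pull B r (f + f') φ = pull B r f φ + pull B r f' φ := by
  funext x
  rw [pull_apply, LinearMap.add_apply, map_add]
  rfl

theorem pull_zero (φ : L.obj m → Fin r → B) :
    pull B r (0 : K.Chain n →ₗ[ℤ] L.Chain m) φ = 0 := by
  funext x
  rw [pull_apply, LinearMap.zero_apply, map_zero]
  rfl

theorem linearCombination_push {A : K.Action G} {γ : G → Matrix (Fin r) (Fin r) B}
    {φ : K.obj n → Fin r → B} (hφ : φ ∈ eqCochains A γ n) (g : G) (c : K.Chain n) :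
    Finsupp.linearCombination ℤ φ (A.push g n c) = γ g *ᵥ Finsupp.linearCombination ℤ φ c := by
  refine Finsupp.linearMap_congr (f := Finsupp.linearCombination ℤ φ ∘ₗ A.push g n)
    (g := ((γ g).mulVecLin.restrictScalars ℤ) ∘ₗ Finsupp.linearCombination ℤ φ) (fun x => ?_) c
  rw [LinearMap.comp_apply, A.push_single, LinearMap.comp_apply, Finsupp.linearCombination_single,
    one_smul, Finsupp.linearCombination_single, one_smul]
  exact hφ g x

theorem pull_mem {A : K.Action G} {A' : L.Action G} {γ : G → Matrix (Fin r) (Fin r) B}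
    {f : K.Chain n →ₗ[ℤ] L.Chain m} (hf : A.IsEquivariant A' f) {φ : L.obj m → Fin r → B}
    (hφ : φ ∈ eqCochains A' γ m) : pull B r f φ ∈ eqCochains A γ n := fun g x => by
  rw [pull_apply, ← A.push_single, hf, linearCombination_push hφ]
  rfl

/-- A finite system of representatives of the orbits of a free action. -/
structure OrbitBasis (A : K.Action G) (n : ℕ) where
  ι : Type z
  fintype : Fintype ι
  decidableEq : DecidableEq ι
  rep : ι → K.obj n
  orbit : K.obj n → ι
  coeff : K.obj n → G
  act_rep : ∀ x, A.act (coeff x) (rep (orbit x)) = x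
  orbit_act : ∀ g x, orbit (A.act g x) = orbit x
  coeff_act : ∀ g x, coeff (A.act g x) = g * coeff x
  orbit_rep : ∀ i, orbit (rep i) = i
  coeff_rep : ∀ i, coeff (rep i) = 1

attribute [instance] OrbitBasis.fintype OrbitBasis.decidableEq

theorem OrbitBasis.nonempty {A : K.Action G} (hA : A.FreeAt n) (h : ∃ s : Set (K.obj n), s.Finite ∧
    ∀ x, ∃ y ∈ s, ∃ g, A.act g y = x) : Nonempty (OrbitBasis A n) := by
  let R : Setoid (K.obj n) :=
    { r x y := ∃ g, A.act g x = y
      iseqv :=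
        { refl x := ⟨1, A.one_act x⟩
          symm := by
            rintro x y ⟨g, rfl⟩
            exact ⟨g⁻¹, by rw [← A.mul_act, inv_mul_cancel, A.one_act]⟩
          trans := by
            rintro x y w ⟨g, rfl⟩ ⟨g', rfl⟩
            exact ⟨g' * g, A.mul_act g' g x⟩ } }
  obtain ⟨s, hs, h⟩ := h
  have := hs.to_subtype
  have hfin : Finite (Quotient R) := by
    refine Finite.of_surjective (fun y : s => Quotient.mk R y.1) fun q => ?_
    induction q using Quotient.inductionOn with | _ x =>
    obtain ⟨y, hy, hyx⟩ := h x
    exact ⟨⟨y, hy⟩, Quotient.sound hyx⟩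
  have := Fintype.ofFinite (Quotient R)
  have ho (x : K.obj n) : ∃ g, A.act g (Quotient.mk R x).out = x := Quotient.mk_out (s := R) x
  choose c hc using ho
  have horb (g : G) (x : K.obj n) : Quotient.mk R (A.act g x) = Quotient.mk R x :=
    (Quotient.sound (s := R) ⟨g, rfl⟩).symm
  refine ⟨{
    ι := Quotient R
    fintype := inferInstance
    decidableEq := Classical.decEq _
    rep := Quotient.out
    orbit := Quotient.mk R
    coeff := c
    act_rep := hc
    orbit_act := horb
    coeff_act := fun g x => ?_
    orbit_rep := Quotient.out_eq
    coeff_rep := fun i => ?_ }⟩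
  · apply hA _ _ (Quotient.mk R x).out
    rw [A.mul_act, hc]
    conv_lhs => rw [← horb g x]
    exact hc _
  · apply hA _ _ i.out
    rw [A.one_act]
    conv_rhs => rw [← hc i.out]
    rw [Quotient.out_eq]

variable {A : K.Action G} {A' : L.Action G} (O : OrbitBasis A n) (O' : OrbitBasis A' m)

/-- Equivariant cochains are given by their values on representatives of the orbits. -/
noncomputable def OrbitBasis.coord (γ : G →* Matrix (Fin r) (Fin r) B) :
    eqCochains A γ n ≃ₗ[B] (O.ι × Fin r → B) where
  toFun φ i := φ.1 (O.rep i.1) i.2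
  map_add' _ _ := rfl
  map_smul' _ _ := rfl
  invFun y := ⟨fun x => γ (O.coeff x) *ᵥ fun b => y (O.orbit x, b), fun g x => by
    change γ (O.coeff (A.act g x)) *ᵥ (fun b => y (O.orbit (A.act g x), b)) =
      γ g *ᵥ (γ (O.coeff x) *ᵥ fun b => y (O.orbit x, b))
    rw [O.orbit_act, O.coeff_act, map_mul, mulVec_mulVec]⟩
  left_inv φ := Subtype.ext (funext fun x => by
    conv_rhs => rw [← O.act_rep x, φ.2])
  right_inv y := by
    funext i
    change (γ (O.coeff (O.rep i.1)) *ᵥ fun b => y (O.orbit (O.rep i.1), b)) i.2 = _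
    rw [O.orbit_rep, O.coeff_rep, map_one, one_mulVec]

/-- The matrix of a map on equivariant cochains. -/
noncomputable def OrbitBasis.matrix (γ : G → Matrix (Fin r) (Fin r) B)
    (f : K.Chain n →ₗ[ℤ] L.Chain m) : Matrix (O.ι × Fin r) (O'.ι × Fin r) B :=
  fun i j => (f (Finsupp.single (O.rep i.1) 1)).sum fun x z =>
    if O'.orbit x = j.1 then z • γ (O'.coeff x) i.2 j.2 else 0

/-- The entries are integer combinations of entries of `γ` whose shape depends on the chains only.
This is the source of all specialization arguments. -/
theorem OrbitBasis.matrix_map {B' : Type*} [CommRing B'] (ψ : B →+* B')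
    (γ : G → Matrix (Fin r) (Fin r) B) (f : K.Chain n →ₗ[ℤ] L.Chain m) :
    (O.matrix O' γ f).map ψ = O.matrix O' (fun g => (γ g).map ψ) f := by
  ext i j
  simp only [matrix, map_apply, Finsupp.sum, map_sum]
  refine Finset.sum_congr rfl fun x _ => ?_
  split_ifs <;> simp

/-- An equivariant cochain takes at `x` the value `γ (coeff x)` applied to its value at the
representative of the orbit of `x`. -/
theorem OrbitBasis.matrix_mulVec (γ : G →* Matrix (Fin r) (Fin r) B)
    (f : K.Chain n →ₗ[ℤ] L.Chain m) (φ : eqCochains A' γ m) :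
    O.matrix O' γ f *ᵥ O'.coord γ φ = fun i => pull B r f φ.1 (O.rep i.1) i.2 := by
  funext i
  simp only [mulVec, dotProduct, matrix, Finsupp.sum, pull_apply,
    Finsupp.linearCombination_apply, Finset.sum_apply, Finset.sum_mul]
  rw [Finset.sum_comm]
  refine Finset.sum_congr rfl fun x _ => ?_
  have h : φ.1 x = γ (O'.coeff x) *ᵥ φ.1 (O'.rep (O'.orbit x)) := by
    conv_lhs => rw [← O'.act_rep x, φ.2]
  rw [h, Fintype.sum_prod_type, Finset.sum_eq_single (O'.orbit x)]
  · simp only [if_true, Pi.smul_apply, mulVec, dotProduct, Finset.smul_sum, smul_mul_assoc]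
    rfl
  · intro j _ hj
    simp [Ne.symm hj]
  · simp

/-- The map on equivariant cochains given by an equivariant map on chains. -/
noncomputable def eqPull (γ : G → Matrix (Fin r) (Fin r) B) {f : K.Chain n →ₗ[ℤ] L.Chain m}
    (hf : A.IsEquivariant A' f) : eqCochains A' γ m →ₗ[B] eqCochains A γ n :=
  (pull B r f).restrict fun _ hφ => pull_mem hf hφ

theorem OrbitBasis.coord_eqPull (γ : G →* Matrix (Fin r) (Fin r) B)
    {f : K.Chain n →ₗ[ℤ] L.Chain m} (hf : A.IsEquivariant A' f) (φ : eqCochains A' γ m) :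
    O.coord γ (eqPull γ hf φ) = O.matrix O' γ f *ᵥ O'.coord γ φ :=
  (O.matrix_mulVec O' γ f φ).symm

/-- The boundary operator of the complex truncated below simplices with one vertex. -/
noncomputable def tbd (K : FaceSet.{z}) : ∀ n : ℕ, K.Chain (n + 1) →ₗ[ℤ] K.Chain n
  | 0 => 0
  | n + 1 => K.bd (n + 1)

theorem isEquivariant_bd (A : K.Action G) (n : ℕ) : A.IsEquivariant A (K.bd n) :=
  fun g c => A.bd_push g n c

theorem isEquivariant_tbd (A : K.Action G) (n : ℕ) : A.IsEquivariant A (K.tbd n) := by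
  cases n with
  | zero => intro g c; simp [tbd]
  | succ n => exact isEquivariant_bd A (n + 1)

end FaceSet

end EquivariantCochains

/-! ### Presentation of cohomology by matrices -/

section Presentation

open Matrix

universe z z'

theorem finrank_range_add_finrank_ker_of_isDomain {B : Type*} [CommRing B] [IsDomain B]
    [IsNoetherianRing B] {M N : Type*} [AddCommGroup M] [Module B M] [Module.Finite B M]
    [AddCommGroup N] [Module B N] (f : M →ₗ[B] N) :
    Module.finrank B (LinearMap.range f) + Module.finrank B (LinearMap.ker f) =
      Module.finrank B M := by
  rw [← f.quotKerEquivRange.finrank_eq, Submodule.finrank_quotient_add_finrank]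

/-- The rank of a cohomology module presented by matrices. -/
theorem finrank_add_rank_add_rank {B : Type*} [CommRing B] [IsDomain B] [IsNoetherianRing B]
    {p q s : Type*} [Fintype p]
    [Fintype q] [Fintype s] (D₁ : Matrix p q B) (D₀ : Matrix q s B) (e : Matrix q q B)
    {N : Type*} [AddCommGroup N] [Module B N] (Λ : LinearMap.ker D₁.mulVecLin →ₗ[B] N)
    (hΛ : Function.Surjective Λ) (hΛ' : ∀ z, Λ z = 0 ↔ ∃ w, e *ᵥ z.1 = D₀ *ᵥ w) :
    Module.finrank B N + D₁.rank + D₀.rank = (fromBlocks D₁ 0 e (-D₀)).rank := by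
  have h1 := finrank_range_add_finrank_ker_of_isDomain D₁.mulVecLin
  have h2 := finrank_range_add_finrank_ker_of_isDomain D₀.mulVecLin
  have h3 := finrank_range_add_finrank_ker_of_isDomain (fromBlocks D₁ 0 e (-D₀)).mulVecLin
  have h4 := finrank_range_add_finrank_ker_of_isDomain Λ
  rw [LinearMap.range_eq_top.2 hΛ, finrank_top] at h4
  -- The kernel of the block matrix consists of the pairs `(z, w)` with `D₁ z = 0` and `e z = D₀ w`.
  -- Projection to `z` maps it onto the kernel of `Λ`, and the kernel of this projection is that of
  -- `D₀`.
  let Φ := (fromBlocks D₁ 0 e (-D₀)).mulVecLin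
  have hΦ (x : q ⊕ s → B) (hx : x ∈ LinearMap.ker Φ) :
      D₁ *ᵥ (x ∘ Sum.inl) = 0 ∧ e *ᵥ (x ∘ Sum.inl) = D₀ *ᵥ (x ∘ Sum.inr) := by
    have hx : fromBlocks D₁ 0 e (-D₀) *ᵥ x = 0 := hx
    rw [fromBlocks_mulVec] at hx
    refine ⟨?_, ?_⟩
    · funext i
      simpa using congrFun hx (Sum.inl i)
    · funext i
      have := congrFun hx (Sum.inr i)
      simp only [Sum.elim_inr, neg_mulVec, Pi.add_apply, Pi.neg_apply, Pi.zero_apply] at this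
      exact add_neg_eq_zero.1 this
  let π : LinearMap.ker Φ →ₗ[B] LinearMap.ker Λ :=
    { toFun x := ⟨⟨x.1 ∘ Sum.inl, (hΦ x.1 x.2).1⟩, (hΛ' _).2 ⟨_, (hΦ x.1 x.2).2⟩⟩
      map_add' _ _ := rfl
      map_smul' _ _ := rfl }
  have hπ : Function.Surjective π := by
    rintro ⟨⟨z, hz⟩, hzΛ⟩
    obtain ⟨w, hw⟩ := (hΛ' _).1 hzΛ
    refine ⟨⟨Sum.elim z w, ?_⟩, rfl⟩
    have hz : D₁ *ᵥ z = 0 := hz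
    have hw : e *ᵥ z = D₀ *ᵥ w := hw
    change fromBlocks D₁ 0 e (-D₀) *ᵥ Sum.elim z w = 0
    rw [fromBlocks_mulVec]
    funext i
    rcases i with i | i <;> simp [hz, hw, neg_mulVec]
  have h5 := finrank_range_add_finrank_ker_of_isDomain (M := LinearMap.ker Φ)
    (N := LinearMap.ker Λ) π
  rw [LinearMap.range_eq_top.2 hπ, finrank_top] at h5
  let ι : LinearMap.ker D₀.mulVecLin ≃ₗ[B] LinearMap.ker π := LinearEquiv.symm
    { toFun x := ⟨x.1.1 ∘ Sum.inr, by
        have h : x.1.1 ∘ Sum.inl = 0 := congrArg (fun y => y.1.1) x.2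
        have := (hΦ x.1.1 x.1.2).2
        rw [h, mulVec_zero] at this
        exact this.symm⟩
      map_add' _ _ := rfl
      map_smul' _ _ := rfl
      invFun w := ⟨⟨Sum.elim 0 w.1, by
        have hw : D₀ *ᵥ w.1 = 0 := w.2
        change fromBlocks D₁ 0 e (-D₀) *ᵥ Sum.elim 0 w.1 = 0
        rw [fromBlocks_mulVec]
        funext i
        rcases i with i | i <;> simp [hw, neg_mulVec]⟩, rfl⟩
      left_inv x := by
        have h : x.1.1 ∘ Sum.inl = 0 := congrArg (fun y => y.1.1) x.2
        refine Subtype.ext (Subtype.ext (funext fun i => ?_))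
        rcases i with i | i
        · exact (congrFun h i).symm
        · rfl
      right_inv w := rfl }
  have h6 := ι.finrank_eq
  simp only [Module.finrank_fintype_fun_eq_card, Fintype.card_sum] at h1 h2 h3
  simp only [Matrix.rank]
  change Module.finrank B (LinearMap.range Φ) + Module.finrank B (LinearMap.ker Φ) = _ at h3
  change _ = Module.finrank B (LinearMap.range Φ)
  lia

namespace FaceSet

variable {G : Type*} [Group G] {B : Type*} [CommRing B] {r : ℕ} {C : FaceSet.{z}}
  (A : C.Action G)

/-- The equivariant cocycles of ordinary degree `k`. -/
noncomputable def eqCocycles (γ : G → Matrix (Fin r) (Fin r) B) (k : ℕ) :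
    Submodule B (C.obj (k + 1) → Fin r → B) :=
  eqCochains A γ (k + 1) ⊓ LinearMap.ker (pull B r (C.bd (k + 1)))

/-- The equivariant coboundaries of ordinary degree `k`. -/
noncomputable def eqCoboundaries (γ : G → Matrix (Fin r) (Fin r) B) (k : ℕ) :
    Submodule B (C.obj (k + 1) → Fin r → B) :=
  (eqCochains A γ k).map (pull B r (C.tbd k))

end FaceSet

open FaceSet

variable {G : Type*} [Group G] {B : Type*} [CommRing B] {r : ℕ} {C : FaceSet.{z}}
  {A : C.Action G}

namespace FiniteModel

variable {M : ℕ} (T : FiniteModel A M) {k : ℕ} (γ : G → Matrix (Fin r) (Fin r) B)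

/-- Dualize the chain homotopy: on a cocycle the term through the next boundary vanishes, and the
other is the coboundary of the pullback under `h`. -/
theorem pull_pull_sub (hk : k < M) {φ : C.obj (k + 1) → Fin r → B}
    (hφ : φ ∈ eqCocycles A γ k) :
    pull B r (T.a (k + 1)) (pull B r (T.b (k + 1)) φ) - φ ∈ eqCoboundaries A γ k := by
  refine ⟨pull B r (T.h k) φ, pull_mem (T.h_equivariant k) hφ.1, ?_⟩
  rw [← pull_comp, ← pull_comp]
  have h1 : T.b (k + 1) ∘ₗ T.a (k + 1) =
      LinearMap.id + T.h k ∘ₗ C.tbd k + C.bd (k + 1) ∘ₗ T.h (k + 1) := by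
    refine LinearMap.ext fun c => ?_
    -- In the lowest degree the augmented and truncated boundaries differ, but `h 0 = 0` kills both.
    have h2 : T.h k (C.tbd k c) = T.h k (C.bd k c) := by
      cases k with
      | zero => simp [T.h_zero]
      | succ k => rfl
    simp only [LinearMap.comp_apply, LinearMap.add_apply, LinearMap.id_apply]
    rw [T.bd_h k hk, h2]
    abel
  rw [h1, pull_add, pull_add, pull_id, pull_comp (T.h (k + 1)), LinearMap.mem_ker.1 hφ.2, map_zero]
  abel

theorem pull_a_mem_eqCocycles (hk : k + 1 < M) {z : T.F.obj (k + 1) → Fin r → B}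
    (hz : z ∈ eqCocycles T.action γ k) : pull B r (T.a (k + 1)) z ∈ eqCocycles A γ k := by
  refine ⟨pull_mem (T.a_equivariant _) hz.1, ?_⟩
  have h : T.a (k + 1) ∘ₗ C.bd (k + 1) = T.F.bd (k + 1) ∘ₗ T.a (k + 1 + 1) :=
    LinearMap.ext fun c => (T.bd_a (k + 1) hk c).symm
  refine LinearMap.mem_ker.2 ?_
  rw [← pull_comp, h, pull_comp, LinearMap.mem_ker.1 hz.2, map_zero]

theorem pull_b_mem_eqCocycles (hk : k + 1 < M) {φ : C.obj (k + 1) → Fin r → B}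
    (hφ : φ ∈ eqCocycles A γ k) : pull B r (T.b (k + 1)) φ ∈ eqCocycles T.action γ k := by
  refine ⟨pull_mem (T.b_equivariant _) hφ.1, ?_⟩
  have h : T.b (k + 1) ∘ₗ T.F.bd (k + 1) = C.bd (k + 1) ∘ₗ T.b (k + 1 + 1) :=
    LinearMap.ext fun c => (T.bd_b (k + 1) hk c).symm
  refine LinearMap.mem_ker.2 ?_
  rw [← pull_comp, h, pull_comp, LinearMap.mem_ker.1 hφ.2, map_zero]

theorem tbd_a (hk : k < M) : T.F.tbd k ∘ₗ T.a (k + 1) = T.a k ∘ₗ C.tbd k := by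
  cases k with
  | zero => simp [tbd]
  | succ k => exact LinearMap.ext (T.bd_a (k + 1) hk)

theorem tbd_b (hk : k < M) : C.tbd k ∘ₗ T.b (k + 1) = T.b k ∘ₗ T.F.tbd k := by
  cases k with
  | zero => simp [tbd]
  | succ k => exact LinearMap.ext (T.bd_b (k + 1) hk)

/-- Pulling back along `b` gives one direction; the other holds because `a* b* a* z` and `a* z`
differ by a coboundary. No homotopy from `a b` to the identity on the model is required. -/
theorem pull_a_mem_eqCoboundaries_iff (hk : k + 1 < M) {z : T.F.obj (k + 1) → Fin r → B}
    (hz : z ∈ eqCocycles T.action γ k) : pull B r (T.a (k + 1)) z ∈ eqCoboundaries A γ k ↔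
      pull B r (T.a (k + 1) ∘ₗ T.b (k + 1)) z ∈ eqCoboundaries T.action γ k := by
  rw [pull_comp]
  constructor
  · rintro ⟨ψ, hψ, h⟩
    refine ⟨pull B r (T.b k) ψ, pull_mem (T.b_equivariant k) hψ, ?_⟩
    rw [← h, ← pull_comp, ← pull_comp, T.tbd_b (by lia)]
  · rintro ⟨w, hw, h⟩
    have h1 := T.pull_pull_sub γ (by lia) (T.pull_a_mem_eqCocycles γ hk hz)
    have h2 : pull B r (T.a (k + 1)) (pull B r (T.b (k + 1)) (pull B r (T.a (k + 1)) z)) ∈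
        eqCoboundaries A γ k := by
      refine ⟨pull B r (T.a k) w, pull_mem (T.a_equivariant k) hw, ?_⟩
      rw [← h, ← pull_comp, ← pull_comp, T.tbd_a (by lia)]
    simpa using sub_mem h2 h1

end FiniteModel

/-- Matrices, natural in the coefficients, that present the equivariant cohomology in degree
`k`. -/
structure MatrixPresentation (A : C.Action G) (k r : ℕ) where
  p : Type z
  q : Type z
  s : Type z
  fintypeP : Fintype p
  fintypeQ : Fintype q
  fintypeS : Fintype s
  D₁ : ∀ {B : Type} [CommRing B], (G → Matrix (Fin r) (Fin r) B) → Matrix p q B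
  D₀ : ∀ {B : Type} [CommRing B], (G → Matrix (Fin r) (Fin r) B) → Matrix q s B
  e : ∀ {B : Type} [CommRing B], (G → Matrix (Fin r) (Fin r) B) → Matrix q q B
  D₁_map : ∀ {B B' : Type} [CommRing B] [CommRing B'] (ψ : B →+* B')
    (γ : G → Matrix (Fin r) (Fin r) B), (D₁ γ).map ψ = D₁ fun g => (γ g).map ψ
  D₀_map : ∀ {B B' : Type} [CommRing B] [CommRing B'] (ψ : B →+* B')
    (γ : G → Matrix (Fin r) (Fin r) B), (D₀ γ).map ψ = D₀ fun g => (γ g).map ψ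
  e_map : ∀ {B B' : Type} [CommRing B] [CommRing B'] (ψ : B →+* B')
    (γ : G → Matrix (Fin r) (Fin r) B), (e γ).map ψ = e fun g => (γ g).map ψ
  exists_class : ∀ {B : Type} [CommRing B] (γ : G →* Matrix (Fin r) (Fin r) B) {N : Type z}
    [AddCommGroup N] [Module B N] (cl : eqCocycles A γ k →ₗ[B] N), Function.Surjective cl →
    (∀ φ, cl φ = 0 ↔ φ.1 ∈ eqCoboundaries A γ k) →
    ∃ Λ : LinearMap.ker (D₁ γ).mulVecLin →ₗ[B] N, Function.Surjective Λ ∧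
      ∀ z, Λ z = 0 ↔ ∃ w, e γ *ᵥ z.1 = D₀ γ *ᵥ w

attribute [instance] MatrixPresentation.fintypeP MatrixPresentation.fintypeQ
  MatrixPresentation.fintypeS

/-- `Λ` sends a cocycle `z` of the model to the class of `a* z`. It is onto because `a* b* φ` is
cohomologous to `φ`, and its kernel involves the composite `a b`, which accounts for the matrix `e`.
-/
theorem FiniteModel.exists_class {M : ℕ} (T : FiniteModel A M) {k : ℕ} (hk : k + 1 < M)
    (O₁ : OrbitBasis T.action (k + 1)) (O₂ : OrbitBasis T.action (k + 2))
    (γ : G →* Matrix (Fin r) (Fin r) B) {N : Type*} [AddCommGroup N] [Module B N]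
    (cl : eqCocycles A γ k →ₗ[B] N) (hcl : Function.Surjective cl)
    (hcl' : ∀ φ, cl φ = 0 ↔ φ.1 ∈ eqCoboundaries A γ k) :
    ∃ Λ : LinearMap.ker (O₂.matrix O₁ γ (T.F.bd (k + 1))).mulVecLin →ₗ[B] N,
      Function.Surjective Λ ∧ ∀ z, Λ z = 0 ↔
        ∃ w : eqCochains T.action γ k, O₁.matrix O₁ γ (T.a (k + 1) ∘ₗ T.b (k + 1)) *ᵥ z.1 =
          O₁.coord γ (eqPull γ (isEquivariant_tbd T.action k) w) := by
  let D := O₂.matrix O₁ γ (T.F.bd (k + 1))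
  have hker (φ : eqCochains T.action γ (k + 1)) :
      O₁.coord γ φ ∈ LinearMap.ker D.mulVecLin ↔ φ.1 ∈ eqCocycles T.action γ k := by
    rw [LinearMap.mem_ker, Matrix.mulVecLin_apply,
      ← O₂.coord_eqPull O₁ γ (isEquivariant_bd T.action (k + 1)), map_eq_zero_iff _
      (O₂.coord γ).injective, Subtype.ext_iff]
    exact ⟨fun h => ⟨φ.2, h⟩, fun h => h.2⟩
  have hmem (y : LinearMap.ker D.mulVecLin) :
      ((O₁.coord γ).symm y.1).1 ∈ eqCocycles T.action γ k :=
    (hker _).1 (by rw [LinearEquiv.apply_symm_apply]; exact y.2)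
  let Λ₀ : LinearMap.ker D.mulVecLin →ₗ[B] eqCocycles A γ k :=
    { toFun y := ⟨_, T.pull_a_mem_eqCocycles γ hk (hmem y)⟩
      map_add' y y' := Subtype.ext (by simp)
      map_smul' c y := Subtype.ext (by simp) }
  refine ⟨cl ∘ₗ Λ₀, fun x => ?_, fun y => ?_⟩
  · obtain ⟨φ, rfl⟩ := hcl x
    have h1 := T.pull_b_mem_eqCocycles γ hk φ.2
    let φ' : eqCochains T.action γ (k + 1) := ⟨_, h1.1⟩
    refine ⟨⟨O₁.coord γ φ', (hker φ').2 h1⟩, ?_⟩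
    rw [LinearMap.comp_apply, ← sub_eq_zero, ← map_sub, hcl']
    change pull B r (T.a (k + 1)) ((O₁.coord γ).symm (O₁.coord γ φ')).1 - φ.1 ∈ _
    rw [LinearEquiv.symm_apply_apply]
    exact T.pull_pull_sub γ (by lia) φ.2
  · rw [LinearMap.comp_apply, hcl']
    change pull B r (T.a (k + 1)) ((O₁.coord γ).symm y.1).1 ∈ _ ↔ _
    rw [T.pull_a_mem_eqCoboundaries_iff γ hk (hmem y)]
    have heq := (T.a_equivariant (k + 1)).comp (T.b_equivariant (k + 1))
    generalize hφ : (O₁.coord γ).symm y.1 = φ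
    rw [← (O₁.coord γ).eq_symm_apply.1 hφ.symm, ← O₁.coord_eqPull O₁ γ heq]
    constructor
    · rintro ⟨w, hw, h⟩
      exact ⟨⟨w, hw⟩, congrArg _ (Subtype.ext h.symm)⟩
    · rintro ⟨w, h⟩
      exact ⟨w.1, w.2, congrArg Subtype.val ((O₁.coord γ).injective h).symm⟩

theorem FiniteModel.nonempty_matrixPresentation {M k : ℕ} (T : FiniteModel A M) (hk : k + 1 < M)
    (r : ℕ) : Nonempty (MatrixPresentation A k r) := by
  obtain ⟨O₁⟩ := OrbitBasis.nonempty (T.free k) (T.orbits_finite (k + 1))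
  obtain ⟨O₂⟩ := OrbitBasis.nonempty (T.free (k + 1)) (T.orbits_finite (k + 2))
  cases k with
  | zero =>
    refine ⟨{
      p := O₂.ι × Fin r
      q := O₁.ι × Fin r
      -- There are no coboundaries in degree zero. An orbit basis of the empty simplices is also
      -- unavailable, since the action is assumed free only on nonempty ones.
      s := PEmpty
      fintypeP := inferInstance
      fintypeQ := inferInstance
      fintypeS := inferInstance
      D₁ := fun γ => O₂.matrix O₁ γ (T.F.bd 1)
      D₀ := fun _ => 0
      e := fun γ => O₁.matrix O₁ γ (T.a 1 ∘ₗ T.b 1)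
      D₁_map := fun ψ γ => O₂.matrix_map O₁ ψ γ _
      D₀_map := fun ψ γ => Matrix.map_zero _ (map_zero ψ)
      e_map := fun ψ γ => O₁.matrix_map O₁ ψ γ _
      exists_class := fun γ N _ _ cl hcl hcl' => ?_ }⟩
    obtain ⟨Λ, h1, h2⟩ := T.exists_class hk O₁ O₂ γ cl hcl hcl'
    refine ⟨Λ, h1, fun z => (h2 z).trans ?_⟩
    have h3 (w : eqCochains T.action γ 0) :
        eqPull γ (isEquivariant_tbd T.action 0) w = 0 := Subtype.ext (pull_zero w.1)
    simp only [h3, map_zero, zero_mulVec]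
    exact ⟨fun ⟨_, h⟩ => ⟨0, h⟩, fun ⟨_, h⟩ => ⟨0, h⟩⟩
  | succ k =>
    obtain ⟨O₀⟩ := OrbitBasis.nonempty (T.free k) (T.orbits_finite (k + 1))
    refine ⟨{
      p := O₂.ι × Fin r
      q := O₁.ι × Fin r
      s := O₀.ι × Fin r
      fintypeP := inferInstance
      fintypeQ := inferInstance
      fintypeS := inferInstance
      D₁ := fun γ => O₂.matrix O₁ γ (T.F.bd (k + 2))
      D₀ := fun γ => O₁.matrix O₀ γ (T.F.tbd (k + 1))
      e := fun γ => O₁.matrix O₁ γ (T.a (k + 2) ∘ₗ T.b (k + 2))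
      D₁_map := fun ψ γ => O₂.matrix_map O₁ ψ γ _
      D₀_map := fun ψ γ => O₁.matrix_map O₀ ψ γ _
      e_map := fun ψ γ => O₁.matrix_map O₁ ψ γ _
      exists_class := fun γ N _ _ cl hcl hcl' => ?_ }⟩
    obtain ⟨Λ, h1, h2⟩ := T.exists_class hk O₁ O₂ γ cl hcl hcl'
    refine ⟨Λ, h1, fun z => (h2 z).trans ?_⟩
    simp only [O₁.coord_eqPull O₀]
    refine ⟨fun ⟨w, h⟩ => ⟨_, h⟩, fun ⟨w, h⟩ => ⟨(O₀.coord γ).symm w, ?_⟩⟩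
    rw [LinearEquiv.apply_symm_apply]
    exact h

end Presentation

/-! ### The rank of a matrix of exponential sums -/

section ExponentialSums

open Matrix

theorem Matrix.exists_linearIndependent_rows {K : Type*} [Field K] {p q : Type*} [Fintype p]
    [Fintype q] (A : Matrix p q K) {r : ℕ} (hr : r ≤ A.rank) :
    ∃ g : Fin r → p, LinearIndependent K (A.submatrix g id).row := by
  rw [A.rank_eq_finrank_span_row] at hr
  obtain ⟨v, hv, -, hli⟩ := Submodule.exists_fun_fin_finrank_span_eq K (Set.range A.row)
  choose g hg using hv
  refine ⟨fun i => g (Fin.castLE hr i), ?_⟩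
  have : (A.submatrix (fun i => g (Fin.castLE hr i)) id).row = v ∘ Fin.castLE hr :=
    funext fun i => hg (Fin.castLE hr i)
  rw [this]
  exact hli.comp _ (Fin.castLE_injective hr)

theorem Matrix.exists_det_ne_zero_of_le_rank_of_field {K : Type*} [Field K] {p q : Type*}
    [Fintype p] [Fintype q] (A : Matrix p q K) {r : ℕ} (hr : r ≤ A.rank) :
    ∃ (f : Fin r → p) (g : Fin r → q), (A.submatrix f g).det ≠ 0 := by
  obtain ⟨f, hf⟩ := A.exists_linearIndependent_rows hr
  have h1 : r ≤ (A.submatrix f id)ᵀ.rank := by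
    rw [rank_transpose, hf.rank_matrix, Fintype.card_fin]
  obtain ⟨g, hg⟩ := exists_linearIndependent_rows _ h1
  refine ⟨f, g, ?_⟩
  have h2 := linearIndependent_rows_iff_isUnit.1 hg
  rw [isUnit_iff_isUnit_det] at h2
  have h3 := h2.ne_zero
  rw [← det_transpose] at h3
  exact h3

/-- Independent vectors in the image stay independent over the field of fractions, where a minor
must be nonzero; it is the image of a minor over `B`. -/
theorem Matrix.le_rank_iff_exists_det_ne_zero {B : Type*} [CommRing B] [IsDomain B] {p q : Type*}
    [Fintype p] [Fintype q] (A : Matrix p q B) (r : ℕ) :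
    r ≤ A.rank ↔ ∃ (f : Fin r → p) (g : Fin r → q), (A.submatrix f g).det ≠ 0 := by
  constructor
  · intro hr
    let K := FractionRing B
    let φ := algebraMap B K
    obtain ⟨v, hv⟩ := exists_linearIndependent_of_le_finrank hr
    have hv' (i : Fin r) : ∃ w, A *ᵥ w = (v i).1 := (v i).2
    choose w hw using hv'
    -- The columns of `A * W` are the independent vectors, so `A` has rank at least `r` over the
    -- field of fractions.
    let W : Matrix q (Fin r) B := Matrix.of fun j i => w i j
    have h1 : LinearIndependent B fun i => (v i).1 :=
      hv.map' (LinearMap.range A.mulVecLin).subtype (Submodule.ker_subtype _)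
    have h2 : LinearIndependent B (((A * W).map φ)ᵀ).row := by
      have := h1.map' ((Algebra.linearMap B K).compLeft p) (by
        refine LinearMap.ker_eq_bot.2 fun x y h => ?_
        funext i
        exact IsFractionRing.injective B K (congrFun h i))
      have h0 : (((A * W).map φ)ᵀ).row =
          (Algebra.linearMap B K).compLeft p ∘ fun i => (v i).1 := ?_
      · rw [h0]
        exact this
      funext i j
      change φ ((A * W) j i) = φ ((v i).1 j)
      rw [← hw]
      rfl
    rw [LinearIndependent.iff_fractionRing B K] at h2
    have h3 := h2.rank_matrix
    rw [rank_transpose, Matrix.map_mul, Fintype.card_fin] at h3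
    have h4 := (rank_mul_le_left (A.map φ) (W.map φ))
    obtain ⟨f, g, hfg⟩ := (A.map φ).exists_det_ne_zero_of_le_rank_of_field (h3 ▸ h4)
    refine ⟨f, g, fun h => hfg ?_⟩
    rw [submatrix_map, ← RingHom.mapMatrix_apply, ← RingHom.map_det, h, map_zero]
  · rintro ⟨f, g, h⟩
    have := rank_of_det_ne_zero h
    rw [Fintype.card_fin] at this
    exact this ▸ A.rank_submatrix_le f g

/-- The ring of formal complex exponential sums `∑ cᵢ e^{t aᵢ}`. -/
abbrev ExpSum : Type := MonoidAlgebra ℂ (Multiplicative ℂ)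

/-- The value of a formal exponential sum at `t`. -/
noncomputable def ExpSum.eval (t : ℂ) : ExpSum →ₐ[ℂ] ℂ :=
  MonoidAlgebra.lift ℂ ℂ (Multiplicative ℂ) ((Units.coeHom ℂ).comp (expHom t))

/-- The power series of a formal exponential sum. -/
noncomputable def ExpSum.series : ExpSum →ₐ[ℂ] PowerSeries ℂ :=
  MonoidAlgebra.lift ℂ (PowerSeries ℂ) (Multiplicative ℂ)
    ((Units.coeHom (PowerSeries ℂ)).comp formalExpHom)

theorem ExpSum.eval_apply (t : ℂ) (m : ExpSum) :
    ExpSum.eval t m = m.coeff.sum fun a b => b * Complex.exp (t * a.toAdd) :=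
  MonoidAlgebra.lift_apply _ _

theorem ExpSum.series_apply (m : ExpSum) : ExpSum.series m =
    m.coeff.sum fun a b => b • PowerSeries.rescale a.toAdd (PowerSeries.exp ℂ) :=
  MonoidAlgebra.lift_apply _ _

theorem ExpSum.coeff_series (m : ExpSum) (j : ℕ) : PowerSeries.coeff j (ExpSum.series m) =
    m.coeff.sum fun a b => b * (a.toAdd ^ j * (1 / (j.factorial : ℂ))) := by
  rw [ExpSum.series_apply, Finsupp.sum, map_sum]
  refine Finset.sum_congr rfl fun a _ => ?_
  rw [PowerSeries.coeff_smul, PowerSeries.coeff_rescale, PowerSeries.coeff_exp]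
  simp

/-- The formal series converges everywhere to the exponential sum. -/
theorem ExpSum.eval_eq_zero_of_series {m : ExpSum} (h : ExpSum.series m = 0) (t : ℂ) :
    ExpSum.eval t m = 0 := by
  have h1 : HasSum (fun j => PowerSeries.coeff j (ExpSum.series m) * t ^ j) (ExpSum.eval t m) := by
    rw [ExpSum.eval_apply]
    simp only [ExpSum.coeff_series, Finsupp.sum, Finset.sum_mul]
    refine hasSum_sum fun a _ => ?_
    have h2 := (NormedSpace.expSeries_div_hasSum_exp (t * a.toAdd)).mul_left (m.coeff a)
    rw [← Complex.exp_eq_exp_ℂ] at h2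
    refine h2.congr_fun fun j => ?_
    rw [mul_pow]
    ring
  simp only [h, map_zero, zero_mul] at h1
  exact h1.unique hasSum_zero

theorem ExpSum.differentiable_eval (m : ExpSum) :
    Differentiable ℂ fun t => ExpSum.eval t m := by
  simp only [ExpSum.eval_apply, Finsupp.sum]
  fun_prop

/-- If the function vanished identically, so would all its derivatives; at `0` these are the
coefficients of the series up to factorials. -/
theorem ExpSum.exists_eval_ne_zero {m : ExpSum} (h : ExpSum.series m ≠ 0) :
    ∃ t, ExpSum.eval t m ≠ 0 := by
  by_contra! h0
  apply h
  have h1 (j : ℕ) : ∀ t, m.coeff.sum (fun a b => b * a.toAdd ^ j * Complex.exp (t * a.toAdd)) = 0 := by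
    induction j with
    | zero =>
      intro t
      simpa [ExpSum.eval_apply] using h0 t
    | succ j ih =>
      intro t
      have hd : HasDerivAt
          (fun t => m.coeff.sum fun a b => b * a.toAdd ^ j * Complex.exp (t * a.toAdd))
          (m.coeff.sum fun a b => b * a.toAdd ^ (j + 1) * Complex.exp (t * a.toAdd)) t := by
        simp only [Finsupp.sum]
        refine HasDerivAt.fun_sum fun a _ => ?_
        have := ((hasDerivAt_id t).mul_const a.toAdd).cexp.const_mul (m.coeff a * a.toAdd ^ j)
        refine this.congr_deriv ?_
        simp only [id, one_mul]
        ring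
      have hz : (fun t => m.coeff.sum fun a b => b * a.toAdd ^ j * Complex.exp (t * a.toAdd)) =
          fun _ => 0 := funext ih
      rw [hz] at hd
      exact hd.unique (hasDerivAt_const t 0)
  ext j
  rw [ExpSum.coeff_series, map_zero]
  have := h1 j 0
  simp only [zero_mul, Complex.exp_zero, mul_one] at this
  simp only [← mul_assoc]
  simp only [Finsupp.sum] at this ⊢
  rw [← Finset.sum_mul, this, zero_mul]

/-- A nonzero entire function has isolated zeros. -/
theorem ExpSum.eventually_eval_ne_zero {m : ExpSum} (h : ExpSum.series m ≠ 0) :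
    ∀ᶠ t in Filter.codiscrete ℂ, ExpSum.eval t m ≠ 0 := by
  obtain ⟨t, ht⟩ := ExpSum.exists_eval_ne_zero h
  exact AnalyticOnNhd.preimage_zero_mem_codiscrete
    (fun z _ => (ExpSum.differentiable_eval m).analyticAt z) ht

/-- The rank of a matrix of exponential sums at a point `t` agrees with its rank over the ring of
power series, except for `t` in a closed discrete set. -/
theorem ExpSum.eventually_rank_eq {p q : Type*} [Fintype p] [Fintype q] (A : Matrix p q ExpSum) :
    ∀ᶠ t in Filter.codiscrete ℂ, (A.map (ExpSum.eval t)).rank = (A.map ExpSum.series).rank := by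
  have hdet {B : Type} [CommRing B] (ψ : ExpSum →+* B) {r : ℕ} (f : Fin r → p) (g : Fin r → q) :
      ((A.map ψ).submatrix f g).det = ψ (A.submatrix f g).det := by
    rw [submatrix_map, ← RingHom.mapMatrix_apply, ← RingHom.map_det]
  have hdet₁ {r : ℕ} (f : Fin r → p) (g : Fin r → q) :
      ((A.map ExpSum.series).submatrix f g).det = ExpSum.series (A.submatrix f g).det :=
    hdet (ExpSum.series : ExpSum →+* PowerSeries ℂ) f g
  have hdet₂ (t : ℂ) {r : ℕ} (f : Fin r → p) (g : Fin r → q) :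
      ((A.map (ExpSum.eval t)).submatrix f g).det = ExpSum.eval t (A.submatrix f g).det :=
    hdet (ExpSum.eval t : ExpSum →+* ℂ) f g
  -- One maximal nonzero minor of the series matrix determines the exceptional set. The opposite
  -- inequality holds for every `t`, as a minor nonzero at `t` has nonzero series.
  obtain ⟨f, g, h⟩ := (Matrix.le_rank_iff_exists_det_ne_zero (A.map ExpSum.series) _).1 le_rfl
  rw [hdet₁] at h
  filter_upwards [ExpSum.eventually_eval_ne_zero h] with t ht
  refine le_antisymm ?_ ?_
  · obtain ⟨f, g, h⟩ := (Matrix.le_rank_iff_exists_det_ne_zero (A.map (ExpSum.eval t)) _).1 le_rfl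
    refine (Matrix.le_rank_iff_exists_det_ne_zero _ _).2 ⟨f, g, fun h0 => h ?_⟩
    rw [hdet₁] at h0
    rw [hdet₂, ExpSum.eval_eq_zero_of_series h0]
  · exact (Matrix.le_rank_iff_exists_det_ne_zero _ _).2 ⟨f, g, by rwa [hdet₂]⟩

end ExponentialSums

/-! ### Twisted cohomology through equivariant cochains on singular simplices -/

section Comparison

open Matrix Simplicial FaceSet

universe z

/-! ### Cohomology classes of explicit cocycles -/

section ClassMap

variable {k : Type w} [CommRing k] (K L : CochainComplex (ModuleCat.{z} k) ℕ)

/-- A cocycle as an element of the module of cycles. -/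
noncomputable def cocycleLift (m : ℕ) :
    ModuleCat.of k (LinearMap.ker (K.d m (m + 1)).hom) ⟶ K.cycles m :=
  K.liftCycles (ModuleCat.ofHom (LinearMap.ker (K.d m (m + 1)).hom).subtype) (m + 1)
    (by simp) (ModuleCat.hom_ext (LinearMap.ext fun x => x.2))

/-- The map sending a cocycle to its cohomology class. -/
noncomputable def classMap (m : ℕ) : LinearMap.ker (K.d m (m + 1)).hom →ₗ[k] K.homology m :=
  (cocycleLift K m ≫ K.homologyπ m).hom

variable {K L}

theorem iCycles_cocycleLift {m : ℕ} (x : LinearMap.ker (K.d m (m + 1)).hom) :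
    K.iCycles m (cocycleLift K m x) = x.1 :=
  ConcreteCategory.congr_hom (K.liftCycles_i (ModuleCat.ofHom
    (LinearMap.ker (K.d m (m + 1)).hom).subtype) (m + 1) (by simp)
    (ModuleCat.hom_ext (LinearMap.ext fun x => x.2))) x

theorem iCycles_injective (m : ℕ) : Function.Injective (K.iCycles m) :=
  (ModuleCat.mono_iff_injective (K.iCycles m)).1 inferInstance

theorem classMap_surjective (m : ℕ) : Function.Surjective (classMap K m) := fun y => by
  obtain ⟨c, rfl⟩ := (ModuleCat.epi_iff_surjective (K.homologyπ m)).1 inferInstance y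
  have hx : K.iCycles m c ∈ LinearMap.ker (K.d m (m + 1)).hom :=
    ConcreteCategory.congr_hom (K.iCycles_d m (m + 1)) c
  exact ⟨⟨_, hx⟩, congrArg (K.homologyπ m) (iCycles_injective m (iCycles_cocycleLift _))⟩

theorem classMap_eq_zero_iff {m i : ℕ} (hi : (ComplexShape.up ℕ).prev m = i)
    (x : LinearMap.ker (K.d m (m + 1)).hom) :
    classMap K m x = 0 ↔ ∃ y : K.X i, K.d i m y = x.1 := by
  have hex : (ShortComplex.mk _ _ (K.toCycles_comp_homologyπ i m)).Exact :=
    ShortComplex.exact_of_g_is_cokernel _ (K.homologyIsCokernel i m hi)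
  rw [ShortComplex.moduleCat_exact_iff] at hex
  have htoc (y : K.X i) : K.iCycles m (K.toCycles i m y) = K.d i m y :=
    ConcreteCategory.congr_hom (K.toCycles_i i m) y
  change K.homologyπ m (cocycleLift K m x) = 0 ↔ _
  constructor
  · intro h
    obtain ⟨y, hy⟩ := hex (cocycleLift K m x) h
    refine ⟨y, ?_⟩
    rw [← iCycles_cocycleLift x, ← htoc]
    exact congrArg _ hy
  · rintro ⟨y, hy⟩
    have : cocycleLift K m x = K.toCycles i m y :=
      iCycles_injective m (by rw [iCycles_cocycleLift, htoc, hy])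
    rw [this]
    exact ConcreteCategory.congr_hom (K.toCycles_comp_homologyπ i m) y

theorem homologyMap_classMap (f : K ⟶ L) {m : ℕ} (x : LinearMap.ker (K.d m (m + 1)).hom)
    (x' : LinearMap.ker (L.d m (m + 1)).hom) (h : f.f m x.1 = x'.1) :
    HomologicalComplex.homologyMap f m (classMap K m x) = classMap L m x' := by
  have h1 : HomologicalComplex.homologyMap f m (K.homologyπ m (cocycleLift K m x)) =
      L.homologyπ m (HomologicalComplex.cyclesMap f m (cocycleLift K m x)) :=
    ConcreteCategory.congr_hom (HomologicalComplex.homologyπ_naturality f m) _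
  refine h1.trans (congrArg (L.homologyπ m) (iCycles_injective m ?_))
  refine (ConcreteCategory.congr_hom (HomologicalComplex.cyclesMap_i f m) _).trans ?_
  refine Eq.trans ?_ (iCycles_cocycleLift x').symm
  exact (congrArg (f.f m) (iCycles_cocycleLift x)).trans h

end ClassMap

variable {X : Type u} {E : Type z} [TopologicalSpace X] [TopologicalSpace E]
  [SimplyConnectedSpace E]

/-- The matrices by which deck transformations act on the coefficients. -/
noncomputable def deckMatrix {B : Type} [CommRing B] {n : ℕ} (p : C(E, X)) (e₀ : E)
    (γ : FundamentalGroup X (p e₀) →* GL (Fin n) B) :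
    deckGroup p →* Matrix (Fin n) (Fin n) B :=
  (Units.coeHom _).comp (γ.comp (deckToPi p e₀))

variable (k : Type w) [CommRing k] {B : Type} [CommRing B] [Algebra k B] {n : ℕ} (p : C(E, X))
  (e₀ : E) (γ : FundamentalGroup X (p e₀) →* GL (Fin n) B)

/-- A singular simplex of Mathlib as a singular simplex with vertices counted. -/
noncomputable def toSing {m : ℕ} (σ : (TopCat.toSSet.obj (TopCat.of E)) _⦋m⦌) :
    (sing E).obj (m + 1) :=
  (TopCat.of E).toSSetObjEquiv (.op ⦋m⦌) σ

/-- The cochains of the twisted complex. -/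
abbrev twistedCochains (m : ℕ) : Type _ :=
  equivariantCochains (TopCat.toSSet.obj (TopCat.of E)) (deckAct p)
    (matrixRep k (γ.comp (deckToPi p e₀))) ⦋m⦌

/-- The cochains of the twisted complex are the equivariant cochains on singular simplices. -/
noncomputable def cochainEquiv (m : ℕ) :
    eqCochains (singAction (deckGroup p)) (deckMatrix p e₀ γ) (m + 1) ≃ₗ[k]
      twistedCochains k p e₀ γ m where
  toFun φ := ⟨fun σ => φ.1 (toSing σ), fun g σ => φ.2 g (toSing σ)⟩
  map_add' _ _ := rfl
  map_smul' _ _ := rfl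
  invFun ψ := ⟨fun σ => ψ.1 (((TopCat.of E).toSSetObjEquiv (.op ⦋m⦌)).symm σ), fun g σ =>
    ψ.2 g (((TopCat.of E).toSSetObjEquiv (.op ⦋m⦌)).symm σ)⟩
  left_inv _ := rfl
  right_inv _ := rfl

theorem d_cochainEquiv (m : ℕ)
    (φ : eqCochains (singAction (deckGroup p)) (deckMatrix p e₀ γ) (m + 1)) :
    (twistedComplex k p e₀ γ).d m (m + 1) (cochainEquiv k p e₀ γ m φ) =
      cochainEquiv k p e₀ γ (m + 1) (eqPull _ (isEquivariant_bd _ (m + 1)) φ) := by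
  refine Subtype.ext (funext fun σ => ?_)
  refine (cochainComplex_d_apply _ _ _ m (cochainEquiv k p e₀ γ m φ) σ).trans ?_
  change _ = pull B n ((sing E).bd (m + 1)) φ.1 (toSing σ)
  rw [pull_apply, FaceSet.bd_single, map_sum]
  refine Finset.sum_congr rfl fun i _ => ?_
  rw [map_smul, Finsupp.linearCombination_single, one_smul]
  rfl

/-- The class in twisted cohomology of an equivariant cocycle. -/
noncomputable def twistedClass (m : ℕ) :
    eqCocycles (singAction (deckGroup p)) (deckMatrix p e₀ γ) m →ₗ[k]
      twistedCohomology k p e₀ γ m :=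
  classMap (twistedComplex k p e₀ γ) m ∘ₗ
    { toFun φ := ⟨cochainEquiv k p e₀ γ m ⟨φ.1, φ.2.1⟩, by
        refine (d_cochainEquiv k p e₀ γ m _).trans ?_
        have h : eqPull (deckMatrix p e₀ γ) (isEquivariant_bd (singAction (deckGroup p)) (m + 1))
          ⟨φ.1, φ.2.1⟩ = 0 := Subtype.ext φ.2.2
        rw [h, map_zero]
        rfl⟩
      map_add' _ _ := rfl
      map_smul' _ _ := rfl }

theorem twistedClass_surjective (m : ℕ) : Function.Surjective (twistedClass k p e₀ γ m) := by
  refine (classMap_surjective m).comp fun x => ?_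
  let φ := (cochainEquiv k p e₀ γ m).symm x.1
  have hφ : cochainEquiv k p e₀ γ m φ = x.1 := (cochainEquiv k p e₀ γ m).apply_symm_apply x.1
  have h1 : cochainEquiv k p e₀ γ (m + 1) (eqPull _ (isEquivariant_bd _ (m + 1)) φ) = 0 := by
    rw [← d_cochainEquiv, hφ]
    exact x.2
  rw [map_eq_zero_iff _ (cochainEquiv k p e₀ γ (m + 1)).injective] at h1
  exact ⟨⟨φ.1, φ.2, congrArg Subtype.val h1⟩, Subtype.ext hφ⟩

theorem twistedClass_eq_zero_iff (m : ℕ)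
    (φ : eqCocycles (singAction (deckGroup p)) (deckMatrix p e₀ γ) m) :
    twistedClass k p e₀ γ m φ = 0 ↔
      φ.1 ∈ eqCoboundaries (singAction (deckGroup p)) (deckMatrix p e₀ γ) m := by
  cases m with
  | zero =>
    refine (classMap_eq_zero_iff (i := 0) (by simp) _).trans ?_
    -- The predecessor of degree zero is zero itself by convention, with zero differential; so both
    -- conditions say that the cocycle vanishes.
    have hd : (twistedComplex k p e₀ γ).d 0 0 = 0 := HomologicalComplex.shape _ _ _ (by simp)
    constructor
    · rintro ⟨y, hy⟩
      rw [hd] at hy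
      have h : cochainEquiv k p e₀ γ 0 ⟨φ.1, φ.2.1⟩ = 0 := hy.symm
      rw [map_eq_zero_iff _ (cochainEquiv k p e₀ γ 0).injective] at h
      have h : φ.1 = 0 := congrArg Subtype.val h
      rw [h]
      exact zero_mem _
    · rintro ⟨ψ, -, hψ⟩
      refine ⟨0, ?_⟩
      have h : φ.1 = 0 := hψ.symm.trans (pull_zero ψ)
      have h1 : (⟨φ.1, φ.2.1⟩ : eqCochains (singAction (deckGroup p)) (deckMatrix p e₀ γ) 1) = 0 :=
        Subtype.ext h
      have h2 : cochainEquiv k p e₀ γ 0 ⟨φ.1, φ.2.1⟩ = 0 :=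
        (congrArg (cochainEquiv k p e₀ γ 0) h1).trans (map_zero _)
      exact (map_zero _).trans h2.symm
  | succ m =>
    refine (classMap_eq_zero_iff (i := m) (by simp) _).trans ?_
    constructor
    · rintro ⟨y, hy⟩
      let ψ := (cochainEquiv k p e₀ γ m).symm y
      have hψ : cochainEquiv k p e₀ γ m ψ = y := (cochainEquiv k p e₀ γ m).apply_symm_apply y
      refine ⟨ψ.1, ψ.2, ?_⟩
      rw [← hψ] at hy
      have h := (d_cochainEquiv k p e₀ γ m ψ).symm.trans hy
      exact congrArg Subtype.val ((cochainEquiv k p e₀ γ (m + 1)).injective h)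
    · rintro ⟨ψ, hψ, h⟩
      refine ⟨cochainEquiv k p e₀ γ m ⟨ψ, hψ⟩, (d_cochainEquiv k p e₀ γ m ⟨ψ, hψ⟩).trans ?_⟩
      exact congrArg (cochainEquiv k p e₀ γ (m + 1)) (Subtype.ext h)

end Comparison

/-! ### Betti numbers as ranks of matrices -/

section Betti

open Matrix FaceSet

universe z

variable {X : Type u} {E : Type z} [TopologicalSpace X] [TopologicalSpace E]
  [SimplyConnectedSpace E] {n k : ℕ} {p : C(E, X)}

namespace MatrixPresentation

variable (e₀ : E)

section Ring

variable {B : Type} [CommRing B] [IsNoetherianRing B]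
  (γ : FundamentalGroup X (p e₀) →* GL (Fin n) B)

/-- The cohomology is a quotient of a submodule of a finite free module over a Noetherian ring. -/
theorem finite_twistedCohomology (P : MatrixPresentation (singAction (deckGroup p)) k n) :
    Module.Finite B (twistedCohomology B p e₀ γ k) := by
  obtain ⟨Λ, hΛ, -⟩ := P.exists_class (deckMatrix p e₀ γ) (twistedClass B p e₀ γ k)
    (twistedClass_surjective B p e₀ γ k) (twistedClass_eq_zero_iff B p e₀ γ k)
  exact Module.Finite.of_surjective Λ hΛ

theorem twistedBetti_eq_finrank [IsDomain B]
    (P : MatrixPresentation (singAction (deckGroup p)) k n) : twistedBetti p e₀ γ k =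
    (Module.finrank B (twistedCohomology B p e₀ γ k) : Cardinal) := by
  have := P.finite_twistedCohomology e₀ γ
  have h := (TensorProduct.isBaseChange B (twistedCohomology B p e₀ γ k)
    (FractionRing B)).lift_rank_eq
  rw [Cardinal.lift_id, Cardinal.lift_id] at h
  exact h.trans (Module.finrank_eq_rank _ _).symm

theorem finrank_twistedCohomology [IsDomain B]
    (P : MatrixPresentation (singAction (deckGroup p)) k n) :
    Module.finrank B (twistedCohomology B p e₀ γ k) + (P.D₁ (deckMatrix p e₀ γ)).rank +
      (P.D₀ (deckMatrix p e₀ γ)).rank =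
      (fromBlocks (P.D₁ (deckMatrix p e₀ γ)) 0 (P.e (deckMatrix p e₀ γ))
        (-P.D₀ (deckMatrix p e₀ γ))).rank := by
  obtain ⟨Λ, hΛ, hΛ'⟩ := P.exists_class (deckMatrix p e₀ γ) (twistedClass B p e₀ γ k)
    (twistedClass_surjective B p e₀ γ k) (twistedClass_eq_zero_iff B p e₀ γ k)
  exact finrank_add_rank_add_rank _ _ _ Λ hΛ hΛ'

end Ring

variable (ρ : FundamentalGroup X (p e₀) →* GL (Fin n) ℂ)
  (a : FundamentalGroup X (p e₀) →* Multiplicative ℂ)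

/-- The universal exponential deformation, with values in matrices of exponential sums. -/
noncomputable def _root_.expSumDeformation (g : deckGroup p) : Matrix (Fin n) (Fin n) ExpSum :=
  (ρ (deckToPi p e₀ g) : Matrix (Fin n) (Fin n) ℂ).map
    (MonoidAlgebra.single (a (deckToPi p e₀ g)))

theorem _root_.expSumDeformation_map_eval (t : ℂ) :
    (fun g => (expSumDeformation e₀ ρ a g).map (ExpSum.eval t : ExpSum →+* ℂ)) =
      deckMatrix p e₀ (expDeformation ρ a t) := by
  refine funext fun g => Matrix.ext fun i j => ?_
  refine (MonoidAlgebra.lift_single (R := ℂ) (A := ℂ)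
    ((Units.coeHom ℂ).comp (expHom t)) _ _).trans ?_
  exact mul_comm _ _

theorem _root_.expSumDeformation_map_series :
    (fun g => (expSumDeformation e₀ ρ a g).map (ExpSum.series : ExpSum →+* PowerSeries ℂ)) =
      deckMatrix p e₀ (formalExpDeformation ρ a) := by
  refine funext fun g => Matrix.ext fun i j => ?_
  refine (MonoidAlgebra.lift_single (R := ℂ) (A := PowerSeries ℂ)
    ((Units.coeHom (PowerSeries ℂ)).comp formalExpHom) _ _).trans ?_
  exact (PowerSeries.smul_eq_C_mul _ _).trans (mul_comm _ _)

/-- Each Betti number is the same expression in the ranks of three matrices, and both families of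
matrices specialize from exponential sums. -/
theorem eventually_twistedBetti_eq (P : MatrixPresentation (singAction (deckGroup p)) k n) :
    ∀ᶠ t in Filter.codiscrete ℂ,
    twistedBetti p e₀ (formalExpDeformation ρ a) k =
      twistedBetti p e₀ (expDeformation ρ a t) k := by
  let γ := expSumDeformation e₀ ρ a
  filter_upwards [ExpSum.eventually_rank_eq (P.D₁ γ), ExpSum.eventually_rank_eq (P.D₀ γ),
    ExpSum.eventually_rank_eq (fromBlocks (P.D₁ γ) 0 (P.e γ) (-P.D₀ γ))] with t h₁ h₀ h
  have hblock {B : Type} [CommRing B] (ψ : ExpSum →+* B) :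
      (fromBlocks (P.D₁ γ) 0 (P.e γ) (-P.D₀ γ)).map ψ =
        fromBlocks ((P.D₁ γ).map ψ) 0 ((P.e γ).map ψ) (-(P.D₀ γ).map ψ) := by
    rw [fromBlocks_map, Matrix.map_zero _ (map_zero ψ)]
    congr 1
    ext i j
    simp
  have e₁ := expSumDeformation_map_eval e₀ ρ a t
  have e₂ := expSumDeformation_map_series e₀ ρ a
  change ((P.D₁ γ).map (ExpSum.eval t : ExpSum →+* ℂ)).rank =
    ((P.D₁ γ).map (ExpSum.series : ExpSum →+* PowerSeries ℂ)).rank at h₁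
  change ((P.D₀ γ).map (ExpSum.eval t : ExpSum →+* ℂ)).rank =
    ((P.D₀ γ).map (ExpSum.series : ExpSum →+* PowerSeries ℂ)).rank at h₀
  change ((fromBlocks (P.D₁ γ) 0 (P.e γ) (-P.D₀ γ)).map (ExpSum.eval t : ExpSum →+* ℂ)).rank =
    ((fromBlocks (P.D₁ γ) 0 (P.e γ) (-P.D₀ γ)).map
      (ExpSum.series : ExpSum →+* PowerSeries ℂ)).rank at h
  rw [hblock, hblock] at h
  simp only [P.D₁_map, P.D₀_map, P.e_map] at h₁ h₀ h
  simp only [γ, e₁, e₂] at h₁ h₀ h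
  have f₁ := P.finrank_twistedCohomology e₀ (expDeformation ρ a t)
  have f₂ := P.finrank_twistedCohomology e₀ (formalExpDeformation ρ a)
  rw [P.twistedBetti_eq_finrank, P.twistedBetti_eq_finrank, Nat.cast_inj]
  lia

end MatrixPresentation

end Betti

/-! ### The limit term of an exact couple -/

namespace ExactCouple

section

variable {R : Type u} [Ring R] (C : ExactCouple.{u, v} R)

theorem coe_derived_i_pow (k n : ℕ) (y : C.derivedD k) :
    ((C.derived.i k ^ n) y : C.derivedD k).1 = (C.i k ^ n) y.1 := by
  induction n generalizing y with
  | zero => rfl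
  | succ n ih => exact ih _

theorem mem_Z_succ_iff {n k : ℕ} {x : C.E k} : x ∈ Z (n + 1) C k ↔ ∃ hx : x ∈ C.cycles k,
    (Submodule.Quotient.mk ⟨x, hx⟩ : C.derivedE k) ∈ Z n C.derived k := by
  constructor
  · rintro ⟨y, hy, rfl⟩
    exact ⟨y.2, hy⟩
  · rintro ⟨hx, h⟩
    exact ⟨⟨x, hx⟩, h, rfl⟩

theorem mem_B_succ_iff {n k : ℕ} {x : C.E k} : x ∈ B (n + 1) C k ↔ ∃ hx : x ∈ C.cycles k,
    (Submodule.Quotient.mk ⟨x, hx⟩ : C.derivedE k) ∈ B n C.derived k := by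
  constructor
  · rintro ⟨y, hy, rfl⟩
    exact ⟨y.2, hy⟩
  · rintro ⟨hx, h⟩
    exact ⟨⟨x, hx⟩, h, rfl⟩

/-- The first component of the `n`-th derived couple is `i^n(D)`, so surviving `n` pages means that
`δ x` lies in it. The induction runs over the couple itself. -/
theorem mem_Z_iff {n : ℕ} (C : ExactCouple.{u, v} R) {k : ℕ} {x : C.E k} :
    x ∈ Z n C k ↔ ∃ y, (C.i (k + 1) ^ n) y = C.δ k x := by
  induction n generalizing C with
  | zero => exact ⟨fun _ => ⟨_, rfl⟩, fun _ => trivial⟩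
  | succ n ih =>
    rw [mem_Z_succ_iff]
    constructor
    · rintro ⟨hx, h⟩
      obtain ⟨⟨_, y, rfl⟩, hy⟩ := (ih C.derived).1 h
      exact ⟨y, (C.coe_derived_i_pow (k + 1) n ⟨_, y, rfl⟩).symm.trans (congrArg Subtype.val hy)⟩
    · rintro ⟨y, hy⟩
      have hx : x ∈ C.cycles k := by
        change C.j (k + 1) (C.δ k x) = 0
        have : C.δ k x ∈ LinearMap.range (C.i (k + 1)) := by
          rw [← hy, pow_succ']
          exact LinearMap.mem_range_self _ _
        rw [← C.ker_j] at this
        exact this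
      refine ⟨hx, (ih C.derived).2 ⟨⟨_, y, rfl⟩, Subtype.ext ?_⟩⟩
      exact (C.coe_derived_i_pow (k + 1) n ⟨_, y, rfl⟩).trans hy

theorem exists_of_mem_boundaries {k : ℕ} {x : C.E k} (hx : x ∈ C.boundaries k) :
    ∃ y, C.i k y = 0 ∧ C.j k y = x := by
  cases k with
  | zero => exact ⟨0, map_zero _, (map_zero _).trans ((Submodule.mem_bot R).1 hx).symm⟩
  | succ k =>
    obtain ⟨y, rfl⟩ := hx
    have : C.δ k y ∈ LinearMap.ker (C.i (k + 1)) := C.ker_i_succ k ▸ LinearMap.mem_range_self _ y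
    exact ⟨C.δ k y, this, rfl⟩

theorem mem_B_iff {n : ℕ} (C : ExactCouple.{u, v} R) {k : ℕ} {x : C.E k} :
    x ∈ B n C k ↔ ∃ y, (C.i k ^ n) y = 0 ∧ C.j k y = x := by
  induction n generalizing C with
  | zero =>
    constructor
    · intro h
      exact ⟨0, rfl, (map_zero _).trans ((Submodule.mem_bot R).1 h).symm⟩
    · rintro ⟨y, rfl, rfl⟩
      exact (Submodule.mem_bot R).2 (map_zero _)
  | succ n ih =>
    rw [mem_B_succ_iff]
    constructor
    · rintro ⟨hx, h⟩
      obtain ⟨⟨_, y, rfl⟩, hy, hyx⟩ := (ih C.derived).1 h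
      have h1 := (C.coe_derived_i_pow k n ⟨_, y, rfl⟩).symm.trans (congrArg Subtype.val hy)
      have h2 := (C.derivedJ_apply k y).symm.trans hyx
      have h3 : C.j k y - x ∈ C.boundaries k :=
        (Submodule.Quotient.eq ((C.boundaries k).submoduleOf (C.cycles k))).1 h2
      obtain ⟨w, hw, hwx⟩ := C.exists_of_mem_boundaries h3
      -- On the derived page `j y` represents `x` only up to a boundary, which is `j` of an element
      -- `w` killed by `i`; subtracting `w` repairs this.
      refine ⟨y - w, ?_, by rw [map_sub, hwx, sub_sub_cancel]⟩
      change (C.i k ^ n) (C.i k (y - w)) = 0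
      rw [map_sub, hw, sub_zero]
      exact h1
    · rintro ⟨y, hy, rfl⟩
      refine ⟨C.j_mem_cycles k y, (ih C.derived).2 ⟨⟨_, y, rfl⟩, Subtype.ext ?_, ?_⟩⟩
      · exact (C.coe_derived_i_pow k n ⟨_, y, rfl⟩).trans hy
      · exact C.derivedJ_apply k y

theorem mem_iSup_B_iff {k : ℕ} {x : C.E k} :
    x ∈ ⨆ n, B n C k ↔ ∃ n y, (C.i k ^ n) y = 0 ∧ C.j k y = x := by
  have hmono : Monotone fun n => B n C k := monotone_nat_of_le_succ fun n x hx => by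
    obtain ⟨y, hy, rfl⟩ := (mem_B_iff C).1 hx
    refine (mem_B_iff C).2 ⟨y, ?_, rfl⟩
    rw [pow_succ', Module.End.mul_apply, hy, map_zero]
  rw [Submodule.mem_iSup_of_directed _ hmono.directed_le]
  exact exists_congr fun n => mem_B_iff C

end

end ExactCouple

/-! ### Finite modules over the ring of formal power series -/

section PowerSeriesModule

open Pointwise

variable {N : Type*} [AddCommGroup N] [Module (PowerSeries ℂ) N]

/-- This is Krull's intersection theorem over a Noetherian local ring. -/
theorem PowerSeries.eq_zero_of_forall_exists_X_pow_smul [Module.Finite (PowerSeries ℂ) N] {x : N}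
    (h : ∀ n : ℕ, ∃ y : N, (X : PowerSeries ℂ) ^ n • y = x) : x = 0 := by
  have h1 : x ∈ (⨅ n : ℕ, (Ideal.span {(X : PowerSeries ℂ)}) ^ n • (⊤ : Submodule (PowerSeries ℂ) N)) := by
    rw [Submodule.mem_iInf]
    intro n
    obtain ⟨y, rfl⟩ := h n
    exact Submodule.smul_mem_smul (Ideal.pow_mem_pow (Ideal.mem_span_singleton_self _) n) trivial
  rw [Ideal.iInf_pow_smul_eq_bot_of_isLocalRing] at h1
  · exact h1
  · rw [Ne, Ideal.span_singleton_eq_top]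
    exact fun h => X_prime.not_isUnit h

/-- Every nonzero power series is a unit times a power of the variable. -/
theorem PowerSeries.exists_X_pow_smul_eq_zero {x : N}
    (hx : x ∈ Submodule.torsion (PowerSeries ℂ) N) :
    ∃ n : ℕ, (X : PowerSeries ℂ) ^ n • x = 0 := by
  obtain ⟨⟨a, ha⟩, hax⟩ := hx
  obtain ⟨n, u, hu⟩ := IsDiscreteValuationRing.eq_unit_mul_pow_irreducible
    (nonZeroDivisors.ne_zero ha) (X_irreducible (R := ℂ))
  refine ⟨n, ?_⟩
  have h : a • x = 0 := hax
  rw [hu, mul_smul] at h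
  exact (smul_eq_zero_iff_eq u).1 h

/-- A finite module over `ℂ[[t]]` of rank `r` maps onto `ℂʳ` with kernel `T + tN` where `T` is the
`t`-power torsion. -/
theorem PowerSeries.exists_reduction [Module ℂ N] [IsScalarTower ℂ (PowerSeries ℂ) N]
    [Module.Finite (PowerSeries ℂ) N] : ∃ q : N →ₗ[ℂ]
    (Fin (Module.finrank (PowerSeries ℂ) N) → ℂ), Function.Surjective q ∧
      ∀ x, q x = 0 ↔ ∃ (n : ℕ) (y z : N), (X : PowerSeries ℂ) ^ n • y = 0 ∧
        x = y + (X : PowerSeries ℂ) • z := by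
  let A := PowerSeries ℂ
  let T := Submodule.torsion A N
  have hr : Module.finrank A (N ⧸ T) = Module.finrank A N := by
    have h1 := Submodule.finrank_quotient_add_finrank (R := A) T
    have h2 : Module.finrank A T = 0 := by
      rw [Module.finrank_eq_zero_iff_isTorsion]
      exact Submodule.torsion_isTorsion
    lia
  -- Over a principal ideal domain the finite torsion-free quotient is free, and its rank is that of
  -- `N`. The map `q` is reduction of its coordinates at zero.
  let b : Module.Basis (Fin (Module.finrank A N)) A (N ⧸ T) := Module.finBasisOfFinrankEq A _ hr
  let q : N →ₗ[ℂ] (Fin (Module.finrank A N) → ℂ) :=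
    evalZero _ ∘ₗ (b.equivFun.toLinearMap ∘ₗ T.mkQ).restrictScalars ℂ
  refine ⟨q, fun c => ?_, fun x => ?_⟩
  · obtain ⟨y, hy⟩ := T.mkQ_surjective (b.equivFun.symm fun i => C (c i))
    refine ⟨y, ?_⟩
    change evalZero _ (b.equivFun (T.mkQ y)) = c
    rw [hy, LinearEquiv.apply_symm_apply]
    ext i
    exact constantCoeff_C _
  · constructor
    · intro h
      have h1 (i) : ∃ c, b.equivFun (T.mkQ x) i = X * c := X_dvd_iff.2 (congrFun h i)
      choose c hc using h1
      obtain ⟨z, hz⟩ := T.mkQ_surjective (b.equivFun.symm c)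
      have h2 : T.mkQ (x - (X : A) • z) = 0 := by
        rw [map_sub, map_smul, hz, ← map_smul, sub_eq_zero, LinearEquiv.eq_symm_apply]
        exact funext hc
      obtain ⟨n, hn⟩ := exists_X_pow_smul_eq_zero ((Submodule.Quotient.mk_eq_zero T).1 h2)
      exact ⟨n, _, z, hn, (sub_add_cancel _ _).symm⟩
    · rintro ⟨n, y, z, hy, rfl⟩
      have h1 : T.mkQ y = 0 := by
        refine (Submodule.Quotient.mk_eq_zero T).2 ?_
        exact ⟨⟨X ^ n, pow_mem (mem_nonZeroDivisors_of_ne_zero X_ne_zero) n⟩, hy⟩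
      change evalZero _ (b.equivFun (T.mkQ (y + (X : A) • z))) = 0
      rw [map_add, h1, zero_add, map_smul, map_smul]
      ext i
      change constantCoeff (X * _) = (0 : ℂ)
      simp

end PowerSeriesModule

/-- The limit term of an exact couple of `ℂ[[t]]`-modules with `i` the multiplication by `t`. -/
theorem ExactCouple.rank_eInfty (C : ExactCouple.{0, v} ℂ) (k : ℕ) {N N' : Type*}
    [AddCommGroup N] [Module (PowerSeries ℂ) N] [Module ℂ N] [IsScalarTower ℂ (PowerSeries ℂ) N]
    [Module.Finite (PowerSeries ℂ) N] [AddCommGroup N'] [Module (PowerSeries ℂ) N'] [Module ℂ N']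
    [IsScalarTower ℂ (PowerSeries ℂ) N'] [Module.Finite (PowerSeries ℂ) N']
    (e : N ≃ₗ[ℂ] C.D k) (he : ∀ x, C.i k (e x) = e ((PowerSeries.X : PowerSeries ℂ) • x))
    (e' : N' ≃ₗ[ℂ] C.D (k + 1))
    (he' : ∀ x, C.i (k + 1) (e' x) = e' ((PowerSeries.X : PowerSeries ℂ) • x)) :
    Module.rank ℂ (C.EInfty k) = (Module.finrank (PowerSeries ℂ) N : Cardinal) := by
  have hpow (n : ℕ) (x : N) :
      (C.i k ^ n) (e x) = e ((PowerSeries.X : PowerSeries ℂ) ^ n • x) := by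
    induction n generalizing x with
    | zero => rw [pow_zero, pow_zero, one_smul]; rfl
    | succ n ih => rw [pow_succ, Module.End.mul_apply, he, ih, smul_smul, pow_succ]
  have hpow' (n : ℕ) (x : N') :
      (C.i (k + 1) ^ n) (e' x) = e' ((PowerSeries.X : PowerSeries ℂ) ^ n • x) := by
    induction n generalizing x with
    | zero => rw [pow_zero, pow_zero, one_smul]; rfl
    | succ n ih => rw [pow_succ, Module.End.mul_apply, he', ih, smul_smul, pow_succ]
  -- If `δ x` is divisible by all powers of the variable, it is zero by Krull, so `x` is in the
  -- image of `j`. Here finiteness in degree `k + 1` enters.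
  have hZ (x : C.E k) : x ∈ ⨅ n, Z n C k ↔ ∃ y, C.j k y = x := by
    rw [Submodule.mem_iInf]
    constructor
    · intro h
      have h1 : e'.symm (C.δ k x) = 0 :=
        PowerSeries.eq_zero_of_forall_exists_X_pow_smul fun n => by
          obtain ⟨y, hy⟩ := (mem_Z_iff C).1 (h n)
          refine ⟨e'.symm y, ?_⟩
          rw [← hy, LinearEquiv.eq_symm_apply, ← hpow', LinearEquiv.apply_symm_apply]
      rw [map_eq_zero_iff _ e'.symm.injective] at h1
      have h2 : x ∈ LinearMap.ker (C.δ k) := h1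
      rw [C.ker_δ] at h2
      exact h2
    · rintro ⟨y, rfl⟩ n
      refine (mem_Z_iff C).2 ⟨0, ?_⟩
      rw [map_zero, C.δ_j]
  let f : N →ₗ[ℂ] C.EInfty k :=
    Submodule.mkQ _ ∘ₗ (C.j k ∘ₗ e.toLinearMap).codRestrict (⨅ n, Z n C k) fun y =>
      (hZ _).2 ⟨_, rfl⟩
  have hf : Function.Surjective f := fun x => by
    obtain ⟨⟨x, hx⟩, rfl⟩ := Submodule.Quotient.mk_surjective _ x
    obtain ⟨y, rfl⟩ := (hZ x).1 hx
    refine ⟨e.symm y, congrArg (Submodule.Quotient.mk) (Subtype.ext ?_)⟩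
    exact congrArg (C.j k) (e.apply_symm_apply y)
  obtain ⟨q, hq, hq'⟩ := PowerSeries.exists_reduction (N := N)
  -- The image `j y` dies in the limit iff it agrees with `j` of a power-torsion element; as the
  -- kernel of `j` is the image of multiplication by the variable, this is membership in `T + tN`.
  have hker : LinearMap.ker f = LinearMap.ker q := by
    ext x
    rw [LinearMap.mem_ker, LinearMap.mem_ker, hq']
    refine (Submodule.Quotient.mk_eq_zero _).trans ?_
    change C.j k (e x) ∈ ⨆ n, B n C k ↔ _
    rw [mem_iSup_B_iff]
    constructor
    · rintro ⟨n, y, hy, hyx⟩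
      have h1 : e x - y ∈ LinearMap.ker (C.j k) := by
        rw [LinearMap.mem_ker, map_sub, hyx, sub_self]
      rw [C.ker_j] at h1
      obtain ⟨z, hz⟩ := h1
      refine ⟨n, e.symm y, e.symm z, ?_, ?_⟩
      · apply e.injective
        rw [← hpow, e.apply_symm_apply, hy, map_zero]
      · apply e.injective
        rw [map_add, ← he, e.apply_symm_apply, e.apply_symm_apply, hz, add_sub_cancel]
    · rintro ⟨n, y, z, hy, rfl⟩
      refine ⟨n, e y, by rw [hpow, hy, map_zero], ?_⟩
      have h1 : C.i k (e z) ∈ LinearMap.ker (C.j k) := by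
        rw [C.ker_j]
        exact LinearMap.mem_range_self _ _
      rw [map_add, ← he, map_add, LinearMap.mem_ker.1 h1, add_zero]
  let E := (f.quotKerEquivOfSurjective hf).symm ≪≫ₗ Submodule.quotEquivOfEq _ _ hker ≪≫ₗ
    q.quotKerEquivOfSurjective hq
  have := Module.Finite.equiv E.symm
  rw [← Module.finrank_eq_rank, E.finrank_eq, Module.finrank_fin_fun]

/-! ### The limit term of the spectral sequence of the deformation -/

section Deformation

open Matrix FaceSet

universe z

variable {X : Type u} {E : Type z} [TopologicalSpace X] [TopologicalSpace E]
  [SimplyConnectedSpace E] {n : ℕ} (p : C(E, X)) (e₀ : E)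

/-- The cohomology with coefficients in `Bⁿ` as a quotient of the module of equivariant
cocycles. -/
abbrev cocycleClasses {B : Type} [CommRing B] (γ : FundamentalGroup X (p e₀) →* GL (Fin n) B)
    (m : ℕ) : Type z :=
  eqCocycles (singAction (deckGroup p)) (deckMatrix p e₀ γ) m ⧸
    LinearMap.ker (twistedClass B p e₀ γ m)

theorem restrictScalars_ker_twistedClass (k : Type w) [CommRing k] {B : Type} [CommRing B]
    [Algebra k B] (γ : FundamentalGroup X (p e₀) →* GL (Fin n) B) (m : ℕ) :
    (LinearMap.ker (twistedClass B p e₀ γ m)).restrictScalars k =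
      LinearMap.ker (twistedClass k p e₀ γ m) := by
  ext φ
  exact (twistedClass_eq_zero_iff B p e₀ γ m φ).trans (twistedClass_eq_zero_iff k p e₀ γ m φ).symm

/-- The cohomology over a ring of scalars `k` acting on `B` is the one over `B`, with scalars
restricted to `k`. -/
noncomputable def cocycleClassesEquiv (k : Type w) [CommRing k] {B : Type} [CommRing B]
    [Algebra k B] (γ : FundamentalGroup X (p e₀) →* GL (Fin n) B) (m : ℕ) :
    cocycleClasses p e₀ γ m ≃ₗ[k] twistedCohomology k p e₀ γ m :=
  (Submodule.Quotient.restrictScalarsEquiv k (LinearMap.ker (twistedClass B p e₀ γ m))).symm ≪≫ₗ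
    Submodule.quotEquivOfEq _ _ (restrictScalars_ker_twistedClass p e₀ k γ m) ≪≫ₗ
      (twistedClass k p e₀ γ m).quotKerEquivOfSurjective (twistedClass_surjective k p e₀ γ m)

/-- The couple is formed over `ℂ`; the power series structure on its first component is transported
from classes of cocycles, where multiplication by the variable is literal. -/
theorem deformationCouple_i_cocycleClassesEquiv (ρ : FundamentalGroup X (p e₀) →* GL (Fin n) ℂ)
    (a : FundamentalGroup X (p e₀) →* Multiplicative ℂ) (hp : IsCoveringMap p) (m : ℕ)
    (x : cocycleClasses p e₀ (formalExpDeformation ρ a) m) :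
    (deformationCouple p e₀ ρ a hp).i m
        (cocycleClassesEquiv p e₀ ℂ (formalExpDeformation ρ a) m x) =
      cocycleClassesEquiv p e₀ ℂ (formalExpDeformation ρ a) m
        ((PowerSeries.X : PowerSeries ℂ) • x) := by
  obtain ⟨φ, rfl⟩ := Submodule.Quotient.mk_surjective _ x
  exact homologyMap_classMap (deformationSequence p e₀ ρ a).f _ _ rfl

variable {p}

theorem MatrixPresentation.rank_eInfty {m : ℕ}
    (P : MatrixPresentation (singAction (deckGroup p)) m n)
    (P' : MatrixPresentation (singAction (deckGroup p)) (m + 1) n)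
    (ρ : FundamentalGroup X (p e₀) →* GL (Fin n) ℂ)
    (a : FundamentalGroup X (p e₀) →* Multiplicative ℂ) (hp : IsCoveringMap p) :
    Module.rank ℂ ((deformationCouple p e₀ ρ a hp).EInfty m) =
      twistedBetti p e₀ (formalExpDeformation ρ a) m := by
  let γ := formalExpDeformation ρ a
  have h := P.finite_twistedCohomology e₀ γ
  have h' := P'.finite_twistedCohomology e₀ γ
  have : Module.Finite (PowerSeries ℂ) (cocycleClasses p e₀ γ m) :=
    Module.Finite.equiv (cocycleClassesEquiv p e₀ (PowerSeries ℂ) γ m).symm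
  have : Module.Finite (PowerSeries ℂ) (cocycleClasses p e₀ γ (m + 1)) :=
    Module.Finite.equiv (cocycleClassesEquiv p e₀ (PowerSeries ℂ) γ (m + 1)).symm
  rw [P.twistedBetti_eq_finrank e₀ γ,
    ← (cocycleClassesEquiv p e₀ (PowerSeries ℂ) γ m).finrank_eq]
  exact (deformationCouple p e₀ ρ a hp).rank_eInfty m (cocycleClassesEquiv p e₀ ℂ γ m)
    (deformationCouple_i_cocycleClassesEquiv p e₀ ρ a hp m)
    (cocycleClassesEquiv p e₀ ℂ γ (m + 1))
    (deformationCouple_i_cocycleClassesEquiv p e₀ ρ a hp (m + 1))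

end Deformation

theorem mainTheorem12 {X : Type u} [TopologicalSpace X] [T2Space X] [ConnectedSpace X]
    [Topology.CWComplex (Set.univ : Set X)] [Topology.CWComplex.Finite (Set.univ : Set X)]
    {E : Type v} [TopologicalSpace E] [SimplyConnectedSpace E]
    (p : C(E, X)) (hp : IsCoveringMap p) (e₀ : E)
    {n : ℕ} (ρ : FundamentalGroup X (p e₀) →* GL (Fin n) ℂ) (α : singularCohomology X 1)
    (k : ℕ) :
    Module.rank ℂ ((deformationCouple p e₀ ρ (pairing α (p e₀)) hp).EInfty k) =
        twistedBetti p e₀ (formalExpDeformation ρ (pairing α (p e₀))) k ∧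
      twistedBetti p e₀ (formalExpDeformation ρ (pairing α (p e₀))) k < Cardinal.aleph0 ∧
      ∃ S : Set ℂ, IsClosed S ∧ IsDiscrete S ∧ ∀ t ∉ S,
        twistedBetti p e₀ (formalExpDeformation ρ (pairing α (p e₀))) k =
          twistedBetti p e₀ (expDeformation ρ (pairing α (p e₀)) t) k := by
  have : CompactSpace X := compactSpace_of_finite_CWComplex
  have hX : LocallyContractibleOn (Set.univ : Set X) := locallyContractibleOn_of_finite_CWComplex
  have := hX.locallyPathConnectedSpace
  have : LocallyPathConnectedSpace E := hp.isLocalHomeomorph.locallyPathConnectedSpace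
  obtain ⟨S⟩ := BallSystem.nonempty hX hp
  -- Presentations are needed in degrees `k` and `k + 1`, the latter because `δ` raises the degree;
  -- a presentation in degree `m` uses the model strictly beyond `m + 1`.
  obtain ⟨T⟩ := S.nonempty_finiteModel hp (k + 3)
  obtain ⟨P⟩ := T.nonempty_matrixPresentation (k := k) (by lia) n
  obtain ⟨P'⟩ := T.nonempty_matrixPresentation (k := k + 1) (by lia) n
  have h := P.eventually_twistedBetti_eq e₀ ρ (pairing α (p e₀))
  -- The exceptional set is simply where the two Betti numbers differ; it is closed and discrete
  -- since its complement is codiscrete.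
  refine ⟨P.rank_eInfty e₀ P' ρ _ hp, ?_, {t | twistedBetti p e₀
    (formalExpDeformation ρ (pairing α (p e₀))) k =
      twistedBetti p e₀ (expDeformation ρ (pairing α (p e₀)) t) k}ᶜ, ?_⟩
  · rw [P.twistedBetti_eq_finrank]
    exact Cardinal.natCast_lt_aleph0
  · obtain ⟨h1, h2⟩ := compl_mem_codiscrete_iff.1 (by rwa [compl_compl])
    exact ⟨h1, h2, fun t ht => by_contra ht⟩
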